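/- Let $V=\mathbb C^4$ with basis $e_1,\dots,e_4$. A Lie structure is a Lie bracket $d$ on $V$; two Lie structures are equivalent ($\sim$) if they define isomorphic Lie algebras. Let $\psi^{ij}_k$ be the alternating bilinear map with $e_i\wedge e_j\mapsto e_k$ that kills the other $e_a\wedge e_b$ ($a<b$). Put $$d_3(\lambda:\mu:\nu)=\lambda\psi^{14}_1+\psi^{24}_1+\mu\psi^{24}_2+\psi^{34}_2+\nu\psi^{34}_3\quad\text{(big family)},$$ $$d_3(\lambda:\mu)=\lambda\psi^{14}_1+\lambda\psi^{24}_2+\psi^{34}_2+\mu\psi^{34}_3\quad\text{(small family)},$$ $$d_1(\lambda:\mu)=\psi^{23}_1+(\lambda+\mu)\psi^{14}_1+\lambda\psi^{24}_2+\psi^{34}_2+\mu\psi^{34}_3,$$ with parameters not all zero, and $d_1=\psi^{24}_1$ ($=\mathfrak n_3\oplus\mathbb C$), $d_1^\sharp=\psi^{23}_1+2\psi^{14}_1+\psi^{24}_2+\psi^{34}_3$, $d_2^*=\psi^{24}_1+\psi^{34}_2$, $d_2^\sharp=\psi^{12}_1+\psi^{34}_3$, $d_3=\psi^{12}_3+\psi^{13}_2+\psi^{23}_1$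 ($=\mathfrak{sl}_2\oplus\mathbb C$), $d_3^*=\psi^{14}_1+\psi^{24}_2+\psi^{34}_3$. A one-parameter deformation of $d$ is a family $\gamma(t)$ of Lie structures, complex analytic near $t=0$, with $\gamma(0)=d$. We say that $d$ *jumps* to $d'$ if $d\not\sim d'$ and $d$ has a one-parameter deformation with $\gamma(t)\sim d'$ for all small $t\ne0$. For one of the three families $F$ and a parameter $p\neq 0$, we say that $d$ *deforms along $F$ at $p$* if $d$ has a one-parameter deformation with $\gamma(t)\sim F(v(t))$ for small $t\ne0$, where $v$ is analytic at $0$, $v(0)=p$, and on some disc around $0$ every equivalence class is attained by $\gamma(t)$ for only finitely many $t$. Then the following hold. 1. (Points.) All the structures listed are nonzero Lie structures, and every nonzero Lie structure on $V$ is equivalent to one of them. The only equivalences among them are that two members of the big family, of the small family, or of $d_1(\lambda:\mu)$ are equivalent precisely when their parameters give the same point of $\mathbb P^2/\Sigma_3$, of $\mathbb P^1$, or of $\mathbb P^1/\Sigma_2$, respectively. 2. (Jumps.) Up to equivalence, the complete lists of jump deformations are: - $d_3$ and $d_2^\sharp$: none. - $d_1(\lambda:\mu)$: to $d_3$ if $\lambda+\mu=0$;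 to $d_2^\sharp$ if $\lambda\mu=0$; otherwise none. - $d_1^\sharp$: exactly to $d_1(1:1)$. - $d_3(\lambda:\mu:\nu)$: to $d_2^\sharp$ if $\lambda\mu\nu=0$; to $d_1(\alpha:\beta)$ if $(\lambda:\mu:\nu)$ equals $(\alpha:\beta:\alpha+\beta)$ in $\mathbb P^2/\Sigma_3$; to $d_3$ if it equals $(1:-1:0)$ in $\mathbb P^2/\Sigma_3$; to nothing else. - $d_3(\lambda:\mu)$: to $d_3(\lambda:\lambda:\mu)$; to $d_2^\sharp$ if $\lambda\mu=0$; to $d_1(1:0)$ if $\mu=0$; to $d_1^\sharp$ and $d_1(1:1)$ if $\mu=2\lambda$; to nothing else. - $d_3^*$: exactly to $d_3(1:1)$ and $d_3(1:1:1)$. - $d_2^*$: exactly to every member of the big family, every $d_1(\lambda:\mu)$, $d_2^\sharp$ and $d_3$. - $d_1$: to every nonzero Lie structure not equivalent to $d_1$ or $d_3^*$, and to nothing else. - The zero structure: to every nonzero Lie structure. 3. (Deformations along families.) For every Lie structure $d$, each of the three families $F$ and each $p\ne0$: $d$ deforms along $F$ at $p$ if and only if $d\sim F(p)$ or $d$ jumps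 to $F(p)$. In that case, for every neighbourhood $U$ of $d$, all $F(q)$ with $q$ sufficiently close to $p$ are equivalent to Lie structures in $U$. 4. (Pattern.) If $d$ jumps to $d'$, then $d$ jumps to every structure to which $d'$ jumps, and $d$ deforms along each of the three families at every $p\neq0$ at which $d'$ does. 5. (Nothing else.) For every Lie structure $d$ and every $\varepsilon>0$, every Lie structure $d'$ sufficiently close to $d$ satisfies $d'\sim d$, or $d$ jumps to $d'$, or $d'\sim F(q)$ for one of the three families $F$ and some $q\ne0$ with $\|q-p\|<\varepsilon$, where $\|p\|=1$ (maximum norm) and $d$ deforms along $F$ at $p$. -/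

import Mathlib

open Filter Topology

namespace FourDimLie

/-- Underlying vector space `ℂ⁴` with its standard basis `e₁, …, e₄`. -/
abbrev V := Fin 4 → ℂ

/-- Structure constants of a bilinear product on `ℂ⁴`: `[e_i, e_j] = ∑ k, c i j k • e_k`. -/
abbrev StructConst := Fin 4 → Fin 4 → Fin 4 → ℂ

/-- The bilinear product with structure constants `c`. -/
def bracket (c : StructConst) (x y : V) : V :=
  fun k => ∑ i, ∑ j, c i j k * x i * y j

/-- `c` is a Lie algebra structure on `ℂ⁴`: the product is alternating and satisfies the
Jacobi identity. -/
def IsLie (c : StructConst) : Prop :=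
  (∀ x, bracket c x x = 0) ∧
    ∀ x y z, bracket c (bracket c x y) z + bracket c (bracket c y z) x
      + bracket c (bracket c z x) y = 0

/-- Equivalence of structures, `d' = g⁻¹ ∘ d ∘ (g ∧ g)` for a linear automorphism `g` of `ℂ⁴`;
for Lie structures this is isomorphism of Lie algebras. -/
def Equivalent (d d' : StructConst) : Prop :=
  ∃ g : V ≃ₗ[ℂ] V, ∀ x y, g (bracket d' x y) = bracket d (g x) (g y)

/-- The elementary alternating 2-cochain `ψ^{ij}_k` (for `i ≠ j`): it sends `e_i ∧ e_j` to `e_k`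
and the other basis bivectors to `0`. The indices are the numbers `1, …, 4`. -/
def psi (i j k : ℕ) : StructConst := fun a b c =>
  if (a : ℕ) + 1 = i ∧ (b : ℕ) + 1 = j ∧ (c : ℕ) + 1 = k then 1
  else if (a : ℕ) + 1 = j ∧ (b : ℕ) + 1 = i ∧ (c : ℕ) + 1 = k then -1
  else 0

/-! The standard forms. -/

/-- The big family `d₃(λ : μ : ν)`. -/
noncomputable def bigFamily (p : Fin 3 → ℂ) : StructConst :=
  p 0 • psi 1 4 1 + psi 2 4 1 + p 1 • psi 2 4 2 + psi 3 4 2 + p 2 • psi 3 4 3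

/-- The small family `d₃(λ : μ)`. -/
noncomputable def smallFamily (p : Fin 2 → ℂ) : StructConst :=
  p 0 • psi 1 4 1 + p 0 • psi 2 4 2 + psi 3 4 2 + p 1 • psi 3 4 3

/-- The family `d₁(λ : μ)`. -/
noncomputable def heisFamily (p : Fin 2 → ℂ) : StructConst :=
  psi 2 3 1 + (p 0 + p 1) • psi 1 4 1 + p 0 • psi 2 4 2 + psi 3 4 2 + p 1 • psi 3 4 3

/-- `d₁ = n₃ ⊕ ℂ`. -/
noncomputable def dOne : StructConst := psi 2 4 1

/-- `d₁^♯`. -/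
noncomputable def dOneSharp : StructConst :=
  psi 2 3 1 + (2 : ℂ) • psi 1 4 1 + psi 2 4 2 + psi 3 4 3

/-- `d₂^* = n₄`. -/
noncomputable def dTwoStar : StructConst := psi 2 4 1 + psi 3 4 2

/-- `d₂^♯ = r₂ ⊕ r₂`. -/
noncomputable def dTwoSharp : StructConst := psi 1 2 1 + psi 3 4 3

/-- `d₃ = sl₂ ⊕ ℂ`. -/
noncomputable def dThree : StructConst := psi 1 2 3 + psi 1 3 2 + psi 2 3 1

/-- `d₃^*`. -/
noncomputable def dThreeStar : StructConst := psi 1 4 1 + psi 2 4 2 + psi 3 4 3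

/-- Labels for the points of the moduli space: a family together with homogeneous coordinates,
or one of the six exceptional points. -/
inductive Label
  | big (p : Fin 3 → ℂ) (hp : p ≠ 0)
  | small (p : Fin 2 → ℂ) (hp : p ≠ 0)
  | heis (p : Fin 2 → ℂ) (hp : p ≠ 0)
  | one
  | oneSharp
  | twoStar
  | twoSharp
  | three
  | threeStar

/-- The standard form with a given label. -/
noncomputable def Label.form : Label → StructConst
  | .big p _ => bigFamily p
  | .small p _ => smallFamily p
  | .heis p _ => heisFamily p
  | .one => dOne
  | .oneSharp => dOneSharp
  | .twoStar => dTwoStar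
  | .twoSharp => dTwoSharp
  | .three => dThree
  | .threeStar => dThreeStar

/-- Two labels denote the same point of the disjoint union of `ℙ² / Σ₃` (big family),
`ℙ¹` (small family), `ℙ¹ / Σ₂` (family `d₁(λ : μ)`) and six points. -/
def Label.Same : Label → Label → Prop
  | .big p _, .big q _ => ∃ (c : ℂ) (σ : Equiv.Perm (Fin 3)), c ≠ 0 ∧ q = c • (p ∘ σ)
  | .small p _, .small q _ => ∃ c : ℂ, c ≠ 0 ∧ q = c • p
  | .heis p _, .heis q _ => ∃ (c : ℂ) (σ : Equiv.Perm (Fin 2)), c ≠ 0 ∧ q = c • (p ∘ σ)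
  | .one, .one => True
  | .oneSharp, .oneSharp => True
  | .twoStar, .twoStar => True
  | .twoSharp, .twoSharp => True
  | .three, .three => True
  | .threeStar, .threeStar => True
  | _, _ => False

/-- `γ` is a one-parameter (complex analytic) deformation of `d` through Lie structures. -/
def IsDeformation (γ : ℂ → StructConst) (d : StructConst) : Prop :=
  AnalyticAt ℂ γ 0 ∧ γ 0 = d ∧ ∀ᶠ t in 𝓝 (0 : ℂ), IsLie (γ t)

/-- `d` has a jump deformation to `d'`: there is a one-parameter deformation of `d` all of whose
members with small nonzero parameter are equivalent to `d'`, and `d'` is not equivalent to `d`. -/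
def Jumps (d d' : StructConst) : Prop :=
  ¬ Equivalent d d' ∧
    ∃ γ : ℂ → StructConst, IsDeformation γ d ∧ ∀ᶠ t in 𝓝[≠] (0 : ℂ), Equivalent (γ t) d'

/-- `d` deforms along the family `F` at the parameter value `p`: there is a one-parameter
deformation `γ` of `d` whose member at small `t ≠ 0` is equivalent to `F (v t)`, where `v t` moves
analytically in the parameter space with `v 0 = p`, and whose equivalence class really moves: near
`0` each class is attained by only finitely many values of the parameter. -/
def DeformsAlong {n : ℕ} (F : (Fin n → ℂ) → StructConst) (p : Fin n → ℂ) (d : StructConst) :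
    Prop :=
  ∃ (γ : ℂ → StructConst) (v : ℂ → Fin n → ℂ),
    IsDeformation γ d ∧ AnalyticAt ℂ v 0 ∧ v 0 = p ∧
    (∀ᶠ t in 𝓝[≠] (0 : ℂ), Equivalent (γ t) (F (v t))) ∧
    ∃ r > 0, ∀ s ∈ Metric.ball (0 : ℂ) r,
      {t ∈ Metric.ball (0 : ℂ) r | Equivalent (γ t) (γ s)}.Finite

/-- `d'` is a member of `F` whose parameter is within `ε` of a normalized parameter value at
which `d` deforms along `F`. -/
def NearAlong {n : ℕ} (F : (Fin n → ℂ) → StructConst) (ε : ℝ) (d d' : StructConst) : Prop :=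
  ∃ p q : Fin n → ℂ, ‖p‖ = 1 ∧ DeformsAlong F p d ∧ q ≠ 0 ∧ ‖q - p‖ < ε ∧ Equivalent d' (F q)

/-- The deformations of `d` along `F` are exactly those prescribed by equality with, or a jump to,
a member of `F`; and they reach the whole of a neighbourhood of that member in `F`. -/
def FamilyRule {n : ℕ} (F : (Fin n → ℂ) → StructConst) (d : StructConst) : Prop :=
  ∀ p : Fin n → ℂ, p ≠ 0 →
    (DeformsAlong F p d ↔ Equivalent d (F p) ∨ Jumps d (F p)) ∧
    (DeformsAlong F p d → ∀ U ∈ 𝓝 d, ∀ᶠ q in 𝓝 p, ∃ d' ∈ U, IsLie d' ∧ Equivalent d' (F q))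

end FourDimLie

namespace FourDimLie

open Matrix

/-! The theorem reduces to the orbit closure order on Lie structures: `d` jumps to `d'` exactly when
`d` lies in the closure of the orbit of `d'` but not in the orbit itself. This order is written down
combinatorially on labels (`Label.Below`, `AtMost`) and shown to be correct by bounding it from both
sides.

Classification (`isClassified_of_isLie`). Every Lie structure has a nonzero functional `φ` that
kills the derived algebra and whose kernel has zero adjoint trace: the trace of ad itself if that is
nonzero, and otherwise one provided by a dimension bound for isotropic subspaces of a quadratic form
on a six-dimensional space. Its kernel is a unimodular ideal of dimension three. It is abelian or
Heisenberg, which leads to normal forms of small matrices, or some element of it has a nonzero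
ad-eigenvalue, and then the structure is computed from the weights.

Upper bound (`atMost_of_mem_closure`). A closed condition invariant under equivalence passes from an
orbit to its closure. The conditions used are metabelian, isotropic, quadratic, planes closed,
vanishing of symmetric functions of ad, and the spectrum of ad up to scale. For each point those
satisfied by it exclude every point not below it. As the order is antisymmetric (`level`), this also
separates the equivalence classes.

Lower bound (`Label.Below.isDegeneration`). Explicit analytic curves of matrices realize a
generating set of the relations, and degenerations compose. Composition and the deformations along
families both rest on `IsDegeneration.exists_curve`: after a substitution `t ↦ t ^ N`, a curve
through `d'` can be pulled back along a degeneration of `d'` to `d`.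

Families. The spectrum condition is closed jointly in the parameter and the structure, so even a
limit of members with moving parameter is a degeneration of the limit member. Conversely, pulling
back a line in parameter space gives a deformation whose class really moves. Compactness of the unit
sphere of parameters, together with the finiteness of the list of isolated points, leaves no other
structure nearby. -/

theorem bracket_add_left (c : StructConst) (x x' y : V) :
    bracket c (x + x') y = bracket c x y + bracket c x' y := by
  ext k; simp only [bracket, Pi.add_apply, ← Finset.sum_add_distrib]
  refine Finset.sum_congr rfl fun i _ => Finset.sum_congr rfl fun j _ => by ring

theorem bracket_add_right (c : StructConst) (x y y' : V) :
    bracket c x (y + y') = bracket c x y + bracket c x y' := by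
  ext k; simp only [bracket, Pi.add_apply, ← Finset.sum_add_distrib]
  refine Finset.sum_congr rfl fun i _ => Finset.sum_congr rfl fun j _ => by ring

theorem bracket_smul_left (c : StructConst) (a : ℂ) (x y : V) :
    bracket c (a • x) y = a • bracket c x y := by
  ext k; simp only [bracket, Pi.smul_apply, smul_eq_mul, Finset.mul_sum]
  refine Finset.sum_congr rfl fun i _ => Finset.sum_congr rfl fun j _ => by ring

theorem bracket_smul_right (c : StructConst) (a : ℂ) (x y : V) :
    bracket c x (a • y) = a • bracket c x y := by
  ext k; simp only [bracket, Pi.smul_apply, smul_eq_mul, Finset.mul_sum]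
  refine Finset.sum_congr rfl fun i _ => Finset.sum_congr rfl fun j _ => by ring

/-- The bracket as a bilinear map. -/
def bracketHom (c : StructConst) : V →ₗ[ℂ] V →ₗ[ℂ] V :=
  LinearMap.mk₂ ℂ (bracket c) (bracket_add_left c) (bracket_smul_left c)
    (bracket_add_right c) (bracket_smul_right c)

@[simp] theorem bracketHom_apply (c : StructConst) (x y : V) :
    bracketHom c x y = bracket c x y := rfl

theorem bracket_single (c : StructConst) (i j : Fin 4) :
    bracket c (Pi.single i 1) (Pi.single j 1) = c i j := by
  ext k
  simp [bracket, Pi.single_apply]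

theorem bracket_injective {c c' : StructConst} (h : ∀ x y, bracket c x y = bracket c' x y) :
    c = c' := by
  funext i j
  rw [← bracket_single c, ← bracket_single c', h]

theorem bracket_zero_const (x y : V) : bracket 0 x y = 0 := by
  ext k; simp [bracket]

theorem bracket_smul_const (a : ℂ) (c : StructConst) (x y : V) :
    bracket (a • c) x y = a • bracket c x y := by
  ext k; simp [bracket, Finset.mul_sum, mul_assoc]

theorem bracket_add_const (c c' : StructConst) (x y : V) :
    bracket (c + c') x y = bracket c x y + bracket c' x y := by
  ext k; simp [bracket, add_mul, Finset.sum_add_distrib]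

theorem IsLie.skew {c : StructConst} (h : IsLie c) (x y : V) :
    bracket c y x = -bracket c x y := by
  have := h.1 (x + y)
  rw [bracket_add_left, bracket_add_right, bracket_add_right, h.1, h.1] at this
  simp only [zero_add, add_zero] at this
  exact eq_neg_of_add_eq_zero_right this

/-- Left multiplication by `x`, as a matrix. -/
def adMatrix (c : StructConst) (x : V) : Matrix (Fin 4) (Fin 4) ℂ :=
  Matrix.of fun k j => ∑ i, c i j k * x i

theorem adMatrix_mulVec (c : StructConst) (x y : V) : adMatrix c x *ᵥ y = bracket c x y := by
  ext k
  simp only [mulVec, dotProduct, adMatrix, of_apply, bracket, Finset.sum_mul]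
  rw [Finset.sum_comm]

/-! ### Equivalence of structures in terms of matrices and bases. -/

theorem equivalent_iff_matrix {d d' : StructConst} : Equivalent d d' ↔
    ∃ G : Matrix (Fin 4) (Fin 4) ℂ, G.det ≠ 0 ∧
      ∀ x y, G *ᵥ bracket d' x y = bracket d (G *ᵥ x) (G *ᵥ y) := by
  constructor
  · rintro ⟨g, hg⟩
    refine ⟨LinearMap.toMatrix' (g : V →ₗ[ℂ] V), ?_, fun x y => ?_⟩
    · rw [LinearMap.det_toMatrix']
      exact (LinearEquiv.isUnit_det' g).ne_zero
    · simpa [← Matrix.toLin'_apply] using hg x y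
  · rintro ⟨G, hG, h⟩
    have hu : IsUnit G.det := isUnit_iff_ne_zero.mpr hG
    exact ⟨Matrix.toLin'OfInv (Matrix.nonsing_inv_mul G hu) (Matrix.mul_nonsing_inv G hu),
      fun x y => by simpa [Matrix.toLin'OfInv] using h x y⟩

theorem Equivalent.refl (d : StructConst) : Equivalent d d :=
  ⟨LinearEquiv.refl ℂ V, fun _ _ => rfl⟩

theorem Equivalent.symm {d d' : StructConst} (h : Equivalent d d') : Equivalent d' d := by
  obtain ⟨g, hg⟩ := h
  refine ⟨g.symm, fun x y => ?_⟩
  apply g.injective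
  rw [hg]; simp

theorem Equivalent.trans {d d' d'' : StructConst} (h : Equivalent d d') (h' : Equivalent d' d'') :
    Equivalent d d'' := by
  obtain ⟨g, hg⟩ := h
  obtain ⟨g', hg'⟩ := h'
  exact ⟨g'.trans g, fun x y => by simp [hg, hg']⟩

theorem Equivalent.isLie {d d' : StructConst} (h : Equivalent d d') (hd : IsLie d) :
    IsLie d' := by
  obtain ⟨g, hg⟩ := h
  constructor
  · intro x
    apply g.injective
    rw [hg, hd.1, map_zero]
  · intro x y z
    apply g.injective
    simp only [map_add, hg, map_zero, hd.2]

theorem equivalent_zero_iff {d : StructConst} : Equivalent d 0 ↔ d = 0 := by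
  constructor
  · rintro ⟨g, hg⟩
    apply bracket_injective
    intro x y
    have := hg (g.symm x) (g.symm y)
    rw [bracket_zero_const, map_zero] at this
    simpa [bracket_zero_const] using this.symm
  · rintro rfl; exact .refl 0

theorem isLie_zero : IsLie 0 := by
  constructor <;> simp [bracket_zero_const]

/-- A basis of `V` in which `d` has the structure constants `d'` is an equivalence. -/
theorem equivalent_of_basis {d d' : StructConst} (b : Fin 4 → V) (hb : LinearIndependent ℂ b)
    (h : ∀ i j, bracket d (b i) (b j) = ∑ k, d' i j k • b k) : Equivalent d d' := by
  let B : Module.Basis (Fin 4) ℂ V := basisOfLinearIndependentOfCardEqFinrank hb (by simp)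
  have hB : ∀ i, B i = b i := fun i => by simp [B]
  refine ⟨B.equivFun.symm, fun x y => ?_⟩
  have hexp : ∀ z : V, B.equivFun.symm z = ∑ i, z i • b i := fun z => by
    rw [Module.Basis.equivFun_symm_apply]; simp [hB]
  rw [hexp (bracket d' x y), hexp x, hexp y, ← bracketHom_apply d]
  simp only [map_sum, LinearMap.sum_apply, map_smul, LinearMap.smul_apply, bracketHom_apply, h]
  simp only [Finset.smul_sum, smul_smul]
  simp only [bracket, Finset.sum_smul]
  rw [Finset.sum_comm]
  refine (Finset.sum_congr rfl fun i _ => Finset.sum_comm).trans ?_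
  rw [Finset.sum_comm]
  refine Finset.sum_congr rfl fun i _ => Finset.sum_congr rfl fun j _ =>
    Finset.sum_congr rfl fun k _ => ?_
  congr 1; ring

theorem equivalent_of_basis_lt {d d' : StructConst} (hd : IsLie d) (hd' : IsLie d')
    (b : Fin 4 → V) (hb : LinearIndependent ℂ b)
    (h : ∀ i j, i < j → bracket d (b i) (b j) = ∑ k, d' i j k • b k) : Equivalent d d' := by
  refine equivalent_of_basis b hb fun i j => ?_
  have hskew : ∀ i j, d' j i = -d' i j := fun i j => by
    rw [← bracket_single d' i j, ← bracket_single d' j i, hd'.skew]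
  rcases lt_trichotomy i j with hij | rfl | hij
  · exact h i j hij
  · have : d' i i = 0 := by rw [← bracket_single d' i i, hd'.1]
    simp [hd.1, this]
  · rw [hd.skew, h j i hij, hskew j i]
    simp [Finset.sum_neg_distrib]

/-! Brackets of the standard forms. -/

theorem bracket_bigFamily (p : Fin 3 → ℂ) (x y : V) : bracket (bigFamily p) x y =
    ![p 0 * (x 0 * y 3 - x 3 * y 0) + (x 1 * y 3 - x 3 * y 1),
      p 1 * (x 1 * y 3 - x 3 * y 1) + (x 2 * y 3 - x 3 * y 2),
      p 2 * (x 2 * y 3 - x 3 * y 2), 0] := by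
  ext k
  fin_cases k <;> simp [bracket, Fin.sum_univ_four, bigFamily, psi] <;> ring

theorem bracket_smallFamily (p : Fin 2 → ℂ) (x y : V) : bracket (smallFamily p) x y =
    ![p 0 * (x 0 * y 3 - x 3 * y 0),
      p 0 * (x 1 * y 3 - x 3 * y 1) + (x 2 * y 3 - x 3 * y 2),
      p 1 * (x 2 * y 3 - x 3 * y 2), 0] := by
  ext k
  fin_cases k <;> simp [bracket, Fin.sum_univ_four, smallFamily, psi] <;> ring

theorem bracket_heisFamily (p : Fin 2 → ℂ) (x y : V) : bracket (heisFamily p) x y =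
    ![(x 1 * y 2 - x 2 * y 1) + (p 0 + p 1) * (x 0 * y 3 - x 3 * y 0),
      p 0 * (x 1 * y 3 - x 3 * y 1) + (x 2 * y 3 - x 3 * y 2),
      p 1 * (x 2 * y 3 - x 3 * y 2), 0] := by
  ext k
  fin_cases k <;> simp [bracket, Fin.sum_univ_four, heisFamily, psi] <;> ring

theorem bracket_dOne (x y : V) : bracket dOne x y = ![x 1 * y 3 - x 3 * y 1, 0, 0, 0] := by
  ext k
  fin_cases k <;> simp [bracket, Fin.sum_univ_four, dOne, psi] <;> ring

theorem bracket_dOneSharp (x y : V) : bracket dOneSharp x y =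
    ![(x 1 * y 2 - x 2 * y 1) + 2 * (x 0 * y 3 - x 3 * y 0),
      x 1 * y 3 - x 3 * y 1, x 2 * y 3 - x 3 * y 2, 0] := by
  ext k
  fin_cases k <;> simp [bracket, Fin.sum_univ_four, dOneSharp, psi] <;> ring

theorem bracket_dTwoStar (x y : V) : bracket dTwoStar x y =
    ![x 1 * y 3 - x 3 * y 1, x 2 * y 3 - x 3 * y 2, 0, 0] := by
  ext k
  fin_cases k <;> simp [bracket, Fin.sum_univ_four, dTwoStar, psi] <;> ring

theorem bracket_dTwoSharp (x y : V) : bracket dTwoSharp x y =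
    ![x 0 * y 1 - x 1 * y 0, 0, x 2 * y 3 - x 3 * y 2, 0] := by
  ext k
  fin_cases k <;> simp [bracket, Fin.sum_univ_four, dTwoSharp, psi] <;> ring

theorem bracket_dThree (x y : V) : bracket dThree x y =
    ![x 1 * y 2 - x 2 * y 1, x 0 * y 2 - x 2 * y 0, x 0 * y 1 - x 1 * y 0, 0] := by
  ext k
  fin_cases k <;> simp [bracket, Fin.sum_univ_four, dThree, psi] <;> ring

theorem bracket_dThreeStar (x y : V) : bracket dThreeStar x y =
    ![x 0 * y 3 - x 3 * y 0, x 1 * y 3 - x 3 * y 1, x 2 * y 3 - x 3 * y 2, 0] := by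
  ext k
  fin_cases k <;> simp [bracket, Fin.sum_univ_four, dThreeStar, psi] <;> ring

theorem isLie_bigFamily (p : Fin 3 → ℂ) : IsLie (bigFamily p) := by
  constructor
  · intro x; ext k; fin_cases k <;> simp [bracket_bigFamily, mul_comm]
  · intro x y z; ext k; fin_cases k <;> simp [bracket_bigFamily] <;> ring

theorem isLie_smallFamily (p : Fin 2 → ℂ) : IsLie (smallFamily p) := by
  constructor
  · intro x; ext k; fin_cases k <;> simp [bracket_smallFamily, mul_comm]
  · intro x y z; ext k; fin_cases k <;> simp [bracket_smallFamily] <;> ring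

theorem isLie_heisFamily (p : Fin 2 → ℂ) : IsLie (heisFamily p) := by
  constructor
  · intro x; ext k; fin_cases k <;> simp [bracket_heisFamily, mul_comm]
  · intro x y z; ext k; fin_cases k <;> simp [bracket_heisFamily] <;> ring

theorem isLie_dOne : IsLie dOne := by
  constructor
  · intro x; ext k; fin_cases k <;> simp [bracket_dOne]; ring
  · intro x y z; ext k; fin_cases k <;> simp [bracket_dOne]

theorem isLie_dOneSharp : IsLie dOneSharp := by
  constructor
  · intro x; ext k; fin_cases k <;> simp [bracket_dOneSharp] <;> ring
  · intro x y z; ext k; fin_cases k <;> simp [bracket_dOneSharp] <;> ring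

theorem isLie_dTwoStar : IsLie dTwoStar := by
  constructor
  · intro x; ext k; fin_cases k <;> simp [bracket_dTwoStar] <;> ring
  · intro x y z; ext k; fin_cases k <;> simp [bracket_dTwoStar] <;> ring

theorem isLie_dTwoSharp : IsLie dTwoSharp := by
  constructor
  · intro x; ext k; fin_cases k <;> simp [bracket_dTwoSharp] <;> ring
  · intro x y z; ext k; fin_cases k <;> simp [bracket_dTwoSharp] <;> ring

theorem isLie_dThree : IsLie dThree := by
  constructor
  · intro x; ext k; fin_cases k <;> simp [bracket_dThree] <;> ring
  · intro x y z; ext k; fin_cases k <;> simp [bracket_dThree] <;> ring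

theorem isLie_dThreeStar : IsLie dThreeStar := by
  constructor
  · intro x; ext k; fin_cases k <;> simp [bracket_dThreeStar] <;> ring
  · intro x y z; ext k; fin_cases k <;> simp [bracket_dThreeStar] <;> ring

/-! Equivalences inside the families. -/

/-- The first elementary symmetric function of three numbers. -/
def esymmOne (p : Fin 3 → ℂ) : ℂ := p 0 + p 1 + p 2

/-- The second elementary symmetric function. -/
def esymmTwo (p : Fin 3 → ℂ) : ℂ := p 0 * p 1 + p 0 * p 2 + p 1 * p 2

/-- The third elementary symmetric function. -/
def esymmThree (p : Fin 3 → ℂ) : ℂ := p 0 * p 1 * p 2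

/-- With `A` the bidiagonal matrix of `p` on the span of `e₁, e₂, e₃`, the vector `e₃` is cyclic.
The change of basis sends `e₁, e₂, e₃` to `(A - q 1)(A - q 2) e₃`, `(A - q 2) e₃`, `e₃`. Since the
characteristic polynomials agree, `A - q 0` kills the first vector by Cayley–Hamilton, so `A`
becomes the bidiagonal matrix of `q`. -/
theorem equivalent_bigFamily_of_esymm {p q : Fin 3 → ℂ} (h₁ : esymmOne p = esymmOne q)
    (h₂ : esymmTwo p = esymmTwo q) (h₃ : esymmThree p = esymmThree q) :
    Equivalent (bigFamily p) (bigFamily q) := by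
  simp only [esymmOne, esymmTwo, esymmThree] at h₁ h₂ h₃
  refine equivalent_iff_matrix.mpr ⟨!![1, 0, 0, 0; p 1 - q 1 + (p 2 - q 2), 1, 0, 0;
    (p 2 - q 2) * (p 2 - q 1), p 2 - q 2, 1, 0; 0, 0, 0, 1], ?_, fun x y => ?_⟩
  · simp [det_succ_row_zero, Fin.sum_univ_succ, Fin.succAbove]
  · have k₁ : q 0 = p 0 + (p 1 - q 1 + (p 2 - q 2)) := by linear_combination -h₁
    have k₂ : p 1 * (p 1 - q 1 + (p 2 - q 2)) + (p 2 - q 2) * (p 2 - q 1)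
        = q 0 * (p 1 - q 1 + (p 2 - q 2)) := by
      linear_combination (p 1 + p 2) * h₁ - h₂
    have k₃ : (p 2 - q 0) * ((p 2 - q 2) * (p 2 - q 1)) = 0 := by
      linear_combination p 2 ^ 2 * h₁ - p 2 * h₂ + h₃
    ext k
    fin_cases k <;> simp [bracket_bigFamily, mulVec, dotProduct, Fin.sum_univ_four]
    · linear_combination (x 0 * y 3 - x 3 * y 0) * k₁
    · linear_combination -(x 0 * y 3 - x 3 * y 0) * k₂
    · linear_combination -(x 0 * y 3 - x 3 * y 0) * k₃

theorem equivalent_bigFamily_smul (p : Fin 3 → ℂ) {c : ℂ} (hc : c ≠ 0) :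
    Equivalent (bigFamily p) (bigFamily (c • p)) := by
  refine equivalent_iff_matrix.mpr ⟨!![c ^ 2, 0, 0, 0; 0, c, 0, 0; 0, 0, 1, 0; 0, 0, 0, c],
    ?_, fun x y => ?_⟩
  · simp [det_succ_row_zero, Fin.sum_univ_succ, Fin.succAbove, hc]
  · ext k
    fin_cases k <;> simp [bracket_bigFamily, mulVec, dotProduct, Fin.sum_univ_four] <;> ring

theorem equivalent_smallFamily_smul (p : Fin 2 → ℂ) {c : ℂ} (hc : c ≠ 0) :
    Equivalent (smallFamily p) (smallFamily (c • p)) := by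
  refine equivalent_iff_matrix.mpr ⟨!![1, 0, 0, 0; 0, c, 0, 0; 0, 0, 1, 0; 0, 0, 0, c],
    ?_, fun x y => ?_⟩
  · simp [det_succ_row_zero, Fin.sum_univ_succ, Fin.succAbove, hc]
  · ext k
    fin_cases k <;> simp [bracket_smallFamily, mulVec, dotProduct, Fin.sum_univ_four] <;> ring

theorem equivalent_heisFamily_smul (p : Fin 2 → ℂ) {c : ℂ} (hc : c ≠ 0) :
    Equivalent (heisFamily p) (heisFamily (c • p)) := by
  refine equivalent_iff_matrix.mpr ⟨!![c, 0, 0, 0; 0, c, 0, 0; 0, 0, 1, 0; 0, 0, 0, c],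
    ?_, fun x y => ?_⟩
  · simp [det_succ_row_zero, Fin.sum_univ_succ, Fin.succAbove, hc]
  · ext k
    fin_cases k <;> simp [bracket_heisFamily, mulVec, dotProduct, Fin.sum_univ_four] <;> ring

/-- The same cyclic vector construction on the quotient of the Heisenberg ideal by its centre. The
change of basis there has determinant 1, so the centre is fixed. -/
theorem equivalent_heisFamily_swap {p q : Fin 2 → ℂ} (h₀ : q 0 = p 1) (h₁ : q 1 = p 0) :
    Equivalent (heisFamily p) (heisFamily q) := by
  refine equivalent_iff_matrix.mpr ⟨!![1, 0, 0, 0; 0, 1, 0, 0; 0, p 1 - p 0, 1, 0; 0, 0, 0, 1],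
    ?_, fun x y => ?_⟩
  · simp [det_succ_row_zero, Fin.sum_univ_succ, Fin.succAbove]
  · ext k
    fin_cases k <;>
      simp [bracket_heisFamily, mulVec, dotProduct, Fin.sum_univ_four, h₀, h₁] <;> ring

theorem esymm_comp_perm (p : Fin 3 → ℂ) (σ : Equiv.Perm (Fin 3)) :
    esymmOne (p ∘ σ) = esymmOne p ∧ esymmTwo (p ∘ σ) = esymmTwo p ∧
      esymmThree (p ∘ σ) = esymmThree p := by
  have h1 : ∑ i, p (σ i) = ∑ i, p i := Equiv.sum_comp σ p
  have h2 : ∑ i, p (σ i) ^ 2 = ∑ i, p i ^ 2 := Equiv.sum_comp σ (fun i => p i ^ 2)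
  have h3 : ∏ i, p (σ i) = ∏ i, p i := Equiv.prod_comp σ p
  simp only [Fin.sum_univ_three, Fin.prod_univ_three] at h1 h2 h3
  simp only [esymmOne, esymmTwo, esymmThree, Function.comp]
  refine ⟨h1, ?_, h3⟩
  -- Newton: twice the second symmetric function is the square of the sum minus the sum of squares.
  linear_combination (1 / 2 : ℂ) * (p (σ 0) + p (σ 1) + p (σ 2) + (p 0 + p 1 + p 2)) * h1
    - (1 / 2 : ℂ) * h2

/-- Two triples with the same elementary symmetric functions differ by a permutation. -/
theorem exists_perm_of_esymm {p q : Fin 3 → ℂ} (h₁ : esymmOne p = esymmOne q)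
    (h₂ : esymmTwo p = esymmTwo q) (h₃ : esymmThree p = esymmThree q) :
    ∃ σ : Equiv.Perm (Fin 3), q = p ∘ σ := by
  simp only [esymmOne, esymmTwo, esymmThree] at h₁ h₂ h₃
  have key : ∀ p q : Fin 3 → ℂ, p 0 + p 1 + p 2 = q 0 + q 1 + q 2 →
      p 0 * p 1 + p 0 * p 2 + p 1 * p 2 = q 0 * q 1 + q 0 * q 2 + q 1 * q 2 →
      p 0 = q 0 → ∃ σ : Equiv.Perm (Fin 3), q = p ∘ σ := by
    intro p q h₁ h₂ h0
    have hs : p 1 + p 2 = q 1 + q 2 := by linear_combination h₁ - h0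
    have hm : (p 1 - q 1) * (p 1 - q 2) = 0 := by
      linear_combination -h₂ + p 0 * hs + (q 1 + q 2) * h0 + p 1 * hs
    rcases mul_eq_zero.mp hm with h | h
    · refine ⟨1, ?_⟩
      funext i
      fin_cases i
      · simp [h0]
      · simpa using (sub_eq_zero.mp h).symm
      · simp; linear_combination h - hs
    · refine ⟨Equiv.swap 1 2, ?_⟩
      funext i
      fin_cases i
      · simp [h0, Equiv.swap_apply_of_ne_of_ne]
      · simp; linear_combination h - hs
      · simpa using (sub_eq_zero.mp h).symm
  -- `q 0` is a root of the monic cubic with roots `q`, which is also the one with roots `p`. A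
  -- transposition then reduces to equal first entries.
  have hroot : (q 0 - p 0) * ((q 0 - p 1) * (q 0 - p 2)) = 0 := by
    linear_combination -q 0 ^ 2 * h₁ + q 0 * h₂ - h₃
  rcases mul_eq_zero.mp hroot with h | h
  · exact key p q h₁ h₂ (sub_eq_zero.mp h).symm
  · rcases mul_eq_zero.mp h with h | h
    · obtain ⟨σ, hσ⟩ := key (p ∘ Equiv.swap 0 1) q
        (by simp [Equiv.swap_apply_of_ne_of_ne]; linear_combination h₁)
        (by simp [Equiv.swap_apply_of_ne_of_ne]; linear_combination h₂)
        (by simp; linear_combination -h)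
      exact ⟨σ.trans (Equiv.swap 0 1), by rw [hσ]; rfl⟩
    · obtain ⟨σ, hσ⟩ := key (p ∘ Equiv.swap 0 2) q
        (by simp [Equiv.swap_apply_of_ne_of_ne]; linear_combination h₁)
        (by simp [Equiv.swap_apply_of_ne_of_ne]; linear_combination h₂)
        (by simp; linear_combination -h)
      exact ⟨σ.trans (Equiv.swap 0 2), by rw [hσ]; rfl⟩

/-- Equality in `ℙ² / Σ₃`. -/
def Proportional (p q : Fin 3 → ℂ) : Prop :=
  ∃ (c : ℂ) (σ : Equiv.Perm (Fin 3)), c ≠ 0 ∧ q = c • (p ∘ σ)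

theorem Proportional.symm {p q : Fin 3 → ℂ} (h : Proportional p q) : Proportional q p := by
  obtain ⟨c, σ, hc, rfl⟩ := h
  refine ⟨c⁻¹, σ⁻¹, inv_ne_zero hc, ?_⟩
  funext i
  simp [hc]

theorem Proportional.trans {p q r : Fin 3 → ℂ} (h : Proportional p q) (h' : Proportional q r) :
    Proportional p r := by
  obtain ⟨c, σ, hc, rfl⟩ := h
  obtain ⟨c', σ', hc', rfl⟩ := h'
  refine ⟨c' * c, σ'.trans σ, mul_ne_zero hc' hc, ?_⟩
  funext i
  simp [mul_assoc]

/-- The symmetric functions identify `ℙ² / Σ₃` with the weighted projective plane of weights 1, 2,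
3. In this form equality of points can be read off from traces of powers of ad. -/
theorem proportional_iff_esymm {p q : Fin 3 → ℂ} : Proportional p q ↔
    ∃ c : ℂ, c ≠ 0 ∧ esymmOne q = c * esymmOne p ∧ esymmTwo q = c ^ 2 * esymmTwo p ∧
      esymmThree q = c ^ 3 * esymmThree p := by
  constructor
  · rintro ⟨c, σ, hc, rfl⟩
    obtain ⟨h₁, h₂, h₃⟩ := esymm_comp_perm p σ
    refine ⟨c, hc, ?_, ?_, ?_⟩
    · rw [← h₁]; simp [esymmOne]; ring
    · rw [← h₂]; simp [esymmTwo]; ring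
    · rw [← h₃]; simp [esymmThree]; ring
  · rintro ⟨c, hc, h₁, h₂, h₃⟩
    obtain ⟨σ, hσ⟩ := exists_perm_of_esymm (p := c • p) (q := q)
      (by rw [h₁]; simp [esymmOne]; ring) (by rw [h₂]; simp [esymmTwo]; ring)
      (by rw [h₃]; simp [esymmThree]; ring)
    exact ⟨c, σ, hc, hσ⟩

theorem Proportional.equivalent {p q : Fin 3 → ℂ} (h : Proportional p q) :
    Equivalent (bigFamily p) (bigFamily q) := by
  obtain ⟨c, σ, hc, rfl⟩ := h
  obtain ⟨h₁, h₂, h₃⟩ := esymm_comp_perm p σ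
  exact (equivalent_bigFamily_of_esymm h₁.symm h₂.symm h₃.symm).trans
    (equivalent_bigFamily_smul _ hc)

theorem Label.Same.equivalent {x y : Label} (h : x.Same y) : Equivalent x.form y.form := by
  cases x <;> cases y <;> simp only [Label.Same] at h <;>
    first
    | exact h.elim
    | exact .refl _
    | skip
  · exact Proportional.equivalent h
  · obtain ⟨c, hc, rfl⟩ := h
    exact equivalent_smallFamily_smul _ hc
  · obtain ⟨c, σ, hc, rfl⟩ := h
    refine Equivalent.trans ?_ (equivalent_heisFamily_smul _ hc)
    by_cases h0 : σ 0 = 0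
    · have h1 : σ 1 = 1 := by
        have : σ 1 ≠ σ 0 := fun h => by simpa using σ.injective h
        omega
      have : σ = 1 := Equiv.ext fun i => by fin_cases i <;> simp [h0, h1]
      subst this
      exact .refl _
    · have h0' : σ 0 = 1 := by omega
      have h1 : σ 1 = 0 := by
        have : σ 1 ≠ σ 0 := fun h => by simpa using σ.injective h
        omega
      exact equivalent_heisFamily_swap (by simp [h0']) (by simp [h1])

/-! Closed conditions on structures, invariant under equivalence. -/

/-- The trace of `ad x`. -/
noncomputable def adOne (d : StructConst) (x : V) : ℂ := (adMatrix d x).trace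

/-- The second elementary symmetric function of the eigenvalues of `ad x`. -/
noncomputable def adTwo (d : StructConst) (x : V) : ℂ :=
  ((adMatrix d x).trace ^ 2 - (adMatrix d x * adMatrix d x).trace) / 2

/-- The third elementary symmetric function of the eigenvalues of `ad x`. -/
noncomputable def adThree (d : StructConst) (x : V) : ℂ :=
  ((adMatrix d x).trace ^ 3 - 3 * (adMatrix d x).trace * (adMatrix d x * adMatrix d x).trace
    + 2 * (adMatrix d x * adMatrix d x * adMatrix d x).trace) / 6

/-! ### Continuity and equivariance of the symmetric functions of ad. -/

theorem continuous_bracket {X : Type*} [TopologicalSpace X] {f : X → StructConst} {u v : X → V}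
    (hf : Continuous f) (hu : Continuous u) (hv : Continuous v) :
    Continuous fun a => bracket (f a) (u a) (v a) := by
  unfold bracket
  fun_prop

theorem continuous_adMatrix (x : V) : Continuous fun d : StructConst => adMatrix d x := by
  unfold adMatrix
  refine continuous_matrix fun i j => ?_
  simp only [of_apply]
  fun_prop

theorem continuous_adMatrix_bracket (x y : V) :
    Continuous fun d : StructConst => adMatrix d (bracket d x y) := by
  unfold adMatrix bracket
  refine continuous_matrix fun i j => ?_
  simp only [of_apply]
  fun_prop

theorem continuous_adOne (x : V) : Continuous fun d : StructConst => adOne d x := by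
  have := continuous_adMatrix x
  unfold adOne
  fun_prop

theorem continuous_adTwo (x : V) : Continuous fun d : StructConst => adTwo d x := by
  have := continuous_adMatrix x
  unfold adTwo
  fun_prop

theorem continuous_adThree (x : V) : Continuous fun d : StructConst => adThree d x := by
  have := continuous_adMatrix x
  unfold adThree
  fun_prop

theorem continuous_adTwo_bracket (x y : V) :
    Continuous fun d : StructConst => adTwo d (bracket d x y) := by
  have := continuous_adMatrix_bracket x y
  unfold adTwo
  fun_prop

/-- An equivalence conjugates the matrix of `ad x` to that of `ad (g x)`, and the three functions
depend only on traces of powers. -/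
theorem Equivalent.exists_ad {d d' : StructConst} (h : Equivalent d d') :
    ∃ g : V ≃ₗ[ℂ] V, (∀ x y, g (bracket d' x y) = bracket d (g x) (g y)) ∧
      ∀ x, adOne d' x = adOne d (g x) ∧ adTwo d' x = adTwo d (g x) ∧
        adThree d' x = adThree d (g x) := by
  obtain ⟨g, hg⟩ := h
  refine ⟨g, hg, fun x => ?_⟩
  set G := LinearMap.toMatrix' (g : V →ₗ[ℂ] V) with hGdef
  have hG : IsUnit G.det := by
    rw [hGdef, LinearMap.det_toMatrix']
    exact LinearEquiv.isUnit_det' g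
  have hmul : ∀ y, G *ᵥ y = g y := fun y => by
    rw [← Matrix.toLin'_apply, hGdef, Matrix.toLin'_toMatrix']; rfl
  have h1 : G * adMatrix d' x = adMatrix d (g x) * G := by
    refine Matrix.ext_iff_mulVec.mpr fun y => ?_
    rw [← mulVec_mulVec, ← mulVec_mulVec, adMatrix_mulVec, adMatrix_mulVec, hmul, hmul, hg]
  have h2 : adMatrix d' x = G⁻¹ * adMatrix d (g x) * G := by
    rw [Matrix.mul_assoc, ← h1, ← Matrix.mul_assoc, Matrix.nonsing_inv_mul _ hG, Matrix.one_mul]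
  have hc : ∀ A B : Matrix (Fin 4) (Fin 4) ℂ, G⁻¹ * A * G * (G⁻¹ * B * G) = G⁻¹ * (A * B) * G := by
    intro A B
    have := Matrix.mul_nonsing_inv G hG
    calc G⁻¹ * A * G * (G⁻¹ * B * G) = G⁻¹ * A * (G * G⁻¹) * B * G := by noncomm_ring
      _ = _ := by rw [this]; noncomm_ring
  have ht : ∀ A : Matrix (Fin 4) (Fin 4) ℂ, (G⁻¹ * A * G).trace = A.trace := by
    intro A
    rw [Matrix.trace_mul_comm, ← Matrix.mul_assoc, Matrix.mul_nonsing_inv _ hG, Matrix.one_mul]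
  simp only [adOne, adTwo, adThree, h2, hc, ht, and_self]

/-- A set of structures is invariant if it is a union of equivalence classes. -/
def IsInvariant (P : StructConst → Prop) : Prop := ∀ d d', Equivalent d d' → P d → P d'

/-- The algebra is metabelian. -/
def Metabelian (d : StructConst) : Prop :=
  ∀ x y z w, bracket d (bracket d x y) (bracket d z w) = 0

/-- The 2-forms `f ∘ d`, for `f` a linear functional, have zero square. -/
def Isotropic (d : StructConst) : Prop :=
  ∀ (f : V →ₗ[ℂ] ℂ) (x y z w : V), f (bracket d x y) * f (bracket d z w)
    - f (bracket d x z) * f (bracket d y w) + f (bracket d x w) * f (bracket d y z) = 0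

/-- The vectors `x`, `y`, `[x, y]` and `[x, [x, y]]` are always dependent. -/
def Quadratic (d : StructConst) : Prop :=
  ∀ x y, (Matrix.of ![x, y, bracket d x y, bracket d x (bracket d x y)]).det = 0

/-- Every plane is a subalgebra. -/
def PlanesClosed (d : StructConst) : Prop :=
  ∀ (f : V →ₗ[ℂ] ℂ) (x y : V), f x = 0 → f y = 0 → f (bracket d x y) = 0

/-- A consequence of Cartan's criterion for solvability. -/
def DerivedTwo (d : StructConst) : Prop := ∀ x y, adTwo d (bracket d x y) = 0

/-- All `ad x` have zero third symmetric function. -/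
def AdThreeZero (d : StructConst) : Prop := ∀ x, adThree d x = 0

/-- All `ad x` are nilpotent. -/
def AdNilpotent (d : StructConst) : Prop := ∀ x, adOne d x = 0 ∧ adTwo d x = 0 ∧ adThree d x = 0

/-- The nonzero eigenvalues of all `ad x` are proportional to `p`. -/
def SpectrumIn (p : Fin 3 → ℂ) (d : StructConst) : Prop :=
  ∀ x, esymmOne p ^ 2 * adTwo d x = esymmTwo p * adOne d x ^ 2 ∧
    esymmOne p ^ 3 * adThree d x = esymmThree p * adOne d x ^ 3 ∧
    esymmTwo p ^ 3 * adThree d x ^ 2 = esymmThree p ^ 2 * adTwo d x ^ 3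

theorem Equivalent.exists_inverse_hom {d d' : StructConst} (h : Equivalent d d') :
    ∃ g : V ≃ₗ[ℂ] V, ∀ x y, bracket d' x y = g.symm (bracket d (g x) (g y)) := by
  obtain ⟨g, hg⟩ := h
  exact ⟨g, fun x y => by rw [← hg, g.symm_apply_apply]⟩

/-! ### Invariance of the conditions under equivalence. -/

theorem isInvariant_metabelian : IsInvariant Metabelian := by
  intro d d' h hd x y z w
  obtain ⟨g, hg⟩ := h.exists_inverse_hom
  simp [hg, hd _ _ _ _]

theorem isInvariant_isotropic : IsInvariant Isotropic := by
  intro d d' h hd f x y z w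
  obtain ⟨g, hg⟩ := h.exists_inverse_hom
  simpa [hg] using hd (f ∘ₗ (g.symm : V →ₗ[ℂ] V)) (g x) (g y) (g z) (g w)

theorem isInvariant_planesClosed : IsInvariant PlanesClosed := by
  intro d d' h hd f x y hx hy
  obtain ⟨g, hg⟩ := h.exists_inverse_hom
  simpa [hg] using hd (f ∘ₗ (g.symm : V →ₗ[ℂ] V)) (g x) (g y) (by simpa) (by simpa)

theorem isInvariant_quadratic : IsInvariant Quadratic := by
  intro d d' h hd x y
  obtain ⟨G, hG, h⟩ := equivalent_iff_matrix.mp h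
  have key : Matrix.of ![G *ᵥ x, G *ᵥ y, bracket d (G *ᵥ x) (G *ᵥ y),
      bracket d (G *ᵥ x) (bracket d (G *ᵥ x) (G *ᵥ y))]
      = Matrix.of ![x, y, bracket d' x y, bracket d' x (bracket d' x y)] * Gᵀ := by
    rw [← h, ← h]
    ext i j
    fin_cases i <;> simp [Matrix.mul_apply, mulVec, dotProduct, mul_comm]
  have := hd (G *ᵥ x) (G *ᵥ y)
  rw [key, det_mul, det_transpose] at this
  exact (mul_eq_zero.mp this).resolve_right hG

theorem isInvariant_derivedTwo : IsInvariant DerivedTwo := by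
  intro d d' h hd x y
  obtain ⟨g, hg, ha⟩ := h.exists_ad
  rw [(ha _).2.1, hg, hd]

theorem isInvariant_adThreeZero : IsInvariant AdThreeZero := by
  intro d d' h hd x
  obtain ⟨g, -, ha⟩ := h.exists_ad
  rw [(ha _).2.2, hd]

theorem isInvariant_adNilpotent : IsInvariant AdNilpotent := by
  intro d d' h hd x
  obtain ⟨g, -, ha⟩ := h.exists_ad
  rw [(ha _).1, (ha _).2.1, (ha _).2.2]
  exact hd _

theorem isInvariant_spectrumIn (p : Fin 3 → ℂ) : IsInvariant (SpectrumIn p) := by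
  intro d d' h hd x
  obtain ⟨g, -, ha⟩ := h.exists_ad
  rw [(ha _).1, (ha _).2.1, (ha _).2.2]
  exact hd _

/-! ### Closedness of the conditions. -/

theorem isClosed_metabelian : IsClosed {d | Metabelian d} := by
  simp only [Metabelian, Set.ofPred_forall]
  refine isClosed_iInter fun x => isClosed_iInter fun y => isClosed_iInter fun z =>
    isClosed_iInter fun w => isClosed_eq ?_ continuous_const
  exact continuous_bracket continuous_id
    (continuous_bracket continuous_id continuous_const continuous_const)
    (continuous_bracket continuous_id continuous_const continuous_const)

theorem continuous_apply_bracket (f : V →ₗ[ℂ] ℂ) (x y : V) :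
    Continuous fun d : StructConst => f (bracket d x y) :=
  f.continuous_of_finiteDimensional.comp
    (continuous_bracket continuous_id continuous_const continuous_const)

theorem isClosed_isotropic : IsClosed {d | Isotropic d} := by
  simp only [Isotropic, Set.ofPred_forall]
  refine isClosed_iInter fun f => isClosed_iInter fun x => isClosed_iInter fun y =>
    isClosed_iInter fun z => isClosed_iInter fun w => isClosed_eq ?_ continuous_const
  have h := continuous_apply_bracket f
  exact (((h x y).mul (h z w)).sub ((h x z).mul (h y w))).add ((h x w).mul (h y z))

theorem isClosed_planesClosed : IsClosed {d | PlanesClosed d} := by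
  simp only [PlanesClosed, Set.ofPred_forall]
  exact isClosed_iInter fun f => isClosed_iInter fun x => isClosed_iInter fun y =>
    isClosed_iInter fun _ => isClosed_iInter fun _ =>
      isClosed_eq (continuous_apply_bracket f x y) continuous_const

theorem isClosed_quadratic : IsClosed {d | Quadratic d} := by
  simp only [Quadratic, Set.ofPred_forall]
  refine isClosed_iInter fun x => isClosed_iInter fun y => isClosed_eq ?_ continuous_const
  refine Continuous.matrix_det (continuous_matrix fun i j => ?_)
  have h1 : Continuous fun d : StructConst => bracket d x y :=
    continuous_bracket continuous_id continuous_const continuous_const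
  have h2 := continuous_bracket (X := StructConst) continuous_id (continuous_const (y := x)) h1
  simp only [id] at h2
  fin_cases i
  · exact continuous_const
  · exact continuous_const
  · exact (continuous_apply j).comp h1
  · exact (continuous_apply j).comp h2

theorem isClosed_derivedTwo : IsClosed {d | DerivedTwo d} := by
  simp only [DerivedTwo, Set.ofPred_forall]
  exact isClosed_iInter fun x => isClosed_iInter fun y =>
    isClosed_eq (continuous_adTwo_bracket x y) continuous_const

theorem isClosed_adThreeZero : IsClosed {d | AdThreeZero d} := by
  simp only [AdThreeZero, Set.ofPred_forall]
  exact isClosed_iInter fun x => isClosed_eq (continuous_adThree x) continuous_const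

theorem isClosed_adNilpotent : IsClosed {d | AdNilpotent d} := by
  simp only [AdNilpotent, Set.ofPred_forall]
  exact isClosed_iInter fun x => (isClosed_eq (continuous_adOne x) continuous_const).inter
    ((isClosed_eq (continuous_adTwo x) continuous_const).inter
      (isClosed_eq (continuous_adThree x) continuous_const))

/-- Closedness is needed jointly in the parameter and the structure, because limits of family
members with varying parameter have to be controlled. -/
theorem isClosed_spectrumIn :
    IsClosed {a : (Fin 3 → ℂ) × StructConst | SpectrumIn a.1 a.2} := by
  have h1 := continuous_adOne
  have h2 := continuous_adTwo
  have h3 := continuous_adThree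
  have e1 : Continuous esymmOne := by unfold esymmOne; fun_prop
  have e2 : Continuous esymmTwo := by unfold esymmTwo; fun_prop
  have e3 : Continuous esymmThree := by unfold esymmThree; fun_prop
  simp only [SpectrumIn, Set.ofPred_forall]
  refine isClosed_iInter fun x => ?_
  have h1 : Continuous fun a : (Fin 3 → ℂ) × StructConst => adOne a.2 x := (h1 x).comp continuous_snd
  have h2 : Continuous fun a : (Fin 3 → ℂ) × StructConst => adTwo a.2 x := (h2 x).comp continuous_snd
  have h3 : Continuous fun a : (Fin 3 → ℂ) × StructConst => adThree a.2 x :=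
    (h3 x).comp continuous_snd
  have e1 : Continuous fun a : (Fin 3 → ℂ) × StructConst => esymmOne a.1 := e1.comp continuous_fst
  have e2 : Continuous fun a : (Fin 3 → ℂ) × StructConst => esymmTwo a.1 := e2.comp continuous_fst
  have e3 : Continuous fun a : (Fin 3 → ℂ) × StructConst => esymmThree a.1 := e3.comp continuous_fst
  exact (isClosed_eq (by fun_prop) (by fun_prop)).inter
    ((isClosed_eq (by fun_prop) (by fun_prop)).inter (isClosed_eq (by fun_prop) (by fun_prop)))

/-! ### Recovering a spectrum up to scale and order. -/

theorem esymm_eq_zero {p : Fin 3 → ℂ} (h₁ : esymmOne p = 0) (h₂ : esymmTwo p = 0)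
    (h₃ : esymmThree p = 0) : p = 0 := by
  obtain ⟨σ, hσ⟩ := exists_perm_of_esymm (p := 0) (q := p) (by rw [h₁]; simp [esymmOne])
    (by rw [h₂]; simp [esymmTwo]) (by rw [h₃]; simp [esymmThree])
  rw [hσ]; rfl

/-- If the spectra of `ad x` for `d` lie over `p`, and some `ad x` has spectrum `q`, then `q`
is proportional to `p`. -/
theorem SpectrumIn.proportional {p q : Fin 3 → ℂ} {d : StructConst} (h : SpectrumIn p d)
    (hp : p ≠ 0) (hq : q ≠ 0) {x : V} (h₁ : adOne d x = esymmOne q) (h₂ : adTwo d x = esymmTwo q)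
    (h₃ : adThree d x = esymmThree q) : Proportional p q := by
  obtain ⟨k₁, k₂, k₃⟩ := h x
  rw [h₁, h₂] at k₁
  rw [h₁, h₃] at k₂
  rw [h₂, h₃] at k₃
  rw [proportional_iff_esymm]
  have hq' : ¬ (esymmOne q = 0 ∧ esymmTwo q = 0 ∧ esymmThree q = 0) :=
    fun h => hq (esymm_eq_zero h.1 h.2.1 h.2.2)
  have hp' : ¬ (esymmOne p = 0 ∧ esymmTwo p = 0 ∧ esymmThree p = 0) :=
    fun h => hp (esymm_eq_zero h.1 h.2.1 h.2.2)
  generalize esymmOne p = s₁ at *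
  generalize esymmTwo p = s₂ at *
  generalize esymmThree p = s₃ at *
  generalize esymmOne q = t₁ at *
  generalize esymmTwo q = t₂ at *
  generalize esymmThree q = t₃ at *
  -- The scale `c` is read off from the first nonvanishing symmetric function of `p`: as a ratio, a
  -- square root or a cube root.
  by_cases hs₁ : s₁ = 0
  · subst hs₁
    by_cases hs₂ : s₂ = 0
    · subst hs₂
      have hs₃ : s₃ ≠ 0 := by simpa using hp'
      have ht₁ : t₁ = 0 := by simpa [hs₃] using k₂
      have ht₂ : t₂ = 0 := by simpa [hs₃] using k₃
      subst ht₁ ht₂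
      have ht₃ : t₃ ≠ 0 := by simpa using hq'
      obtain ⟨c, hc⟩ := IsAlgClosed.exists_pow_nat_eq (t₃ / s₃) (n := 3) (by norm_num)
      refine ⟨c, ?_, by simp, by simp, by rw [hc]; field_simp⟩
      rintro rfl
      simp [eq_comm, hs₃, ht₃] at hc
    · have ht₁ : t₁ = 0 := by simpa [hs₂] using k₁
      subst ht₁
      have ht₂ : t₂ ≠ 0 := by
        rintro rfl
        have : t₃ = 0 := by simpa [hs₂] using k₃
        simp [this] at hq'
      obtain ⟨c, hc⟩ := IsAlgClosed.exists_pow_nat_eq (t₂ / s₂) (n := 2) (by norm_num)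
      have hc' : t₂ = c ^ 2 * s₂ := by rw [hc]; field_simp
      have hc0 : c ≠ 0 := by
        rintro rfl
        simp [ht₂] at hc'
      subst hc'
      -- The third equation fixes `t₃` only up to sign. The sign is absorbed by replacing the square
      -- root `c` by `-c`, which leaves `t₂` unchanged.
      have : (t₃ - c ^ 3 * s₃) * (t₃ + c ^ 3 * s₃) = 0 := by
        have : s₂ ^ 3 * ((t₃ - c ^ 3 * s₃) * (t₃ + c ^ 3 * s₃)) = 0 := by
          linear_combination k₃
        simpa [hs₂] using this
      rcases mul_eq_zero.mp this with h | h
      · exact ⟨c, hc0, by simp, rfl, by linear_combination h⟩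
      · exact ⟨-c, neg_ne_zero.mpr hc0, by simp, by ring, by linear_combination h⟩
  · have ht₁ : t₁ ≠ 0 := by
      rintro rfl
      have ht₂ : t₂ = 0 := by simpa [hs₁] using k₁
      have ht₃ : t₃ = 0 := by simpa [hs₁] using k₂
      simp [ht₂, ht₃] at hq'
    refine ⟨t₁ / s₁, div_ne_zero ht₁ hs₁, by field_simp, ?_, ?_⟩
    · field_simp; linear_combination k₁
    · field_simp; linear_combination k₂

/-- Both sides of each defining equation have the same weight in the symmetric functions of `ad x`,
so the scale factor cancels. -/
theorem SpectrumIn.of_adEigenvalues {p : Fin 3 → ℂ} {d : StructConst}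
    (h : ∀ x, ∃ c : ℂ, adOne d x = c * esymmOne p ∧ adTwo d x = c ^ 2 * esymmTwo p ∧
      adThree d x = c ^ 3 * esymmThree p) : SpectrumIn p d := by
  intro x
  obtain ⟨c, h₁, h₂, h₃⟩ := h x
  rw [h₁, h₂, h₃]
  refine ⟨by ring, by ring, by ring⟩

/-! Spectra of the standard forms. -/

/-- The eigenvalues for the family `d₃(λ : μ)`. -/
def smallSpectrum (p : Fin 2 → ℂ) : Fin 3 → ℂ := ![p 0, p 0, p 1]

/-- The eigenvalues for the family `d₁(λ : μ)`. -/
def heisSpectrum (p : Fin 2 → ℂ) : Fin 3 → ℂ := ![p 0, p 1, p 0 + p 1]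

theorem ad_bigFamily (p : Fin 3 → ℂ) (x : V) :
    adOne (bigFamily p) x = -x 3 * esymmOne p ∧
    adTwo (bigFamily p) x = (-x 3) ^ 2 * esymmTwo p ∧
    adThree (bigFamily p) x = (-x 3) ^ 3 * esymmThree p := by
  have h : adMatrix (bigFamily p) x = !![-p 0 * x 3, -x 3, 0, p 0 * x 0 + x 1;
      0, -p 1 * x 3, -x 3, p 1 * x 1 + x 2; 0, 0, -p 2 * x 3, p 2 * x 2; 0, 0, 0, 0] := by
    refine Matrix.ext_iff_mulVec.mpr fun y => ?_
    rw [adMatrix_mulVec, bracket_bigFamily]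
    ext k
    fin_cases k <;> simp [mulVec, dotProduct, Fin.sum_univ_four] <;> ring
  simp only [adOne, adTwo, adThree, h, esymmOne, esymmTwo, esymmThree]
  refine ⟨?_, ?_, ?_⟩ <;> simp [Matrix.trace, Fin.sum_univ_four] <;> ring

theorem ad_smallFamily (p : Fin 2 → ℂ) (x : V) :
    adOne (smallFamily p) x = -x 3 * esymmOne (smallSpectrum p) ∧
    adTwo (smallFamily p) x = (-x 3) ^ 2 * esymmTwo (smallSpectrum p) ∧
    adThree (smallFamily p) x = (-x 3) ^ 3 * esymmThree (smallSpectrum p) := by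
  have h : adMatrix (smallFamily p) x = !![-p 0 * x 3, 0, 0, p 0 * x 0;
      0, -p 0 * x 3, -x 3, p 0 * x 1 + x 2; 0, 0, -p 1 * x 3, p 1 * x 2; 0, 0, 0, 0] := by
    refine Matrix.ext_iff_mulVec.mpr fun y => ?_
    rw [adMatrix_mulVec, bracket_smallFamily]
    ext k
    fin_cases k <;> simp [mulVec, dotProduct, Fin.sum_univ_four] <;> ring
  simp only [adOne, adTwo, adThree, h, esymmOne, esymmTwo, esymmThree, smallSpectrum]
  refine ⟨?_, ?_, ?_⟩ <;> simp [Matrix.trace, Fin.sum_univ_four] <;> ring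

theorem ad_heisFamily (p : Fin 2 → ℂ) (x : V) :
    adOne (heisFamily p) x = -x 3 * esymmOne (heisSpectrum p) ∧
    adTwo (heisFamily p) x = (-x 3) ^ 2 * esymmTwo (heisSpectrum p) ∧
    adThree (heisFamily p) x = (-x 3) ^ 3 * esymmThree (heisSpectrum p) := by
  have h : adMatrix (heisFamily p) x = !![-(p 0 + p 1) * x 3, -x 2, x 1, (p 0 + p 1) * x 0;
      0, -p 0 * x 3, -x 3, p 0 * x 1 + x 2; 0, 0, -p 1 * x 3, p 1 * x 2; 0, 0, 0, 0] := by
    refine Matrix.ext_iff_mulVec.mpr fun y => ?_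
    rw [adMatrix_mulVec, bracket_heisFamily]
    ext k
    fin_cases k <;> simp [mulVec, dotProduct, Fin.sum_univ_four] <;> ring
  simp only [adOne, adTwo, adThree, h, esymmOne, esymmTwo, esymmThree, heisSpectrum]
  refine ⟨?_, ?_, ?_⟩ <;> simp [Matrix.trace, Fin.sum_univ_four] <;> ring

theorem ad_dOneSharp (x : V) :
    adOne dOneSharp x = -x 3 * esymmOne ![1, 1, 2] ∧
    adTwo dOneSharp x = (-x 3) ^ 2 * esymmTwo ![1, 1, 2] ∧
    adThree dOneSharp x = (-x 3) ^ 3 * esymmThree ![1, 1, 2] := by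
  have h : adMatrix dOneSharp x = !![-2 * x 3, -x 2, x 1, 2 * x 0;
      0, -x 3, 0, x 1; 0, 0, -x 3, x 2; 0, 0, 0, 0] := by
    refine Matrix.ext_iff_mulVec.mpr fun y => ?_
    rw [adMatrix_mulVec, bracket_dOneSharp]
    ext k
    fin_cases k <;> simp [mulVec, dotProduct, Fin.sum_univ_four] <;> ring
  simp only [adOne, adTwo, adThree, h, esymmOne, esymmTwo, esymmThree]
  refine ⟨?_, ?_, ?_⟩ <;> simp [Matrix.trace, Fin.sum_univ_four] <;> ring

theorem ad_dThreeStar (x : V) :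
    adOne dThreeStar x = -x 3 * esymmOne ![1, 1, 1] ∧
    adTwo dThreeStar x = (-x 3) ^ 2 * esymmTwo ![1, 1, 1] ∧
    adThree dThreeStar x = (-x 3) ^ 3 * esymmThree ![1, 1, 1] := by
  have h : adMatrix dThreeStar x = !![-x 3, 0, 0, x 0;
      0, -x 3, 0, x 1; 0, 0, -x 3, x 2; 0, 0, 0, 0] := by
    refine Matrix.ext_iff_mulVec.mpr fun y => ?_
    rw [adMatrix_mulVec, bracket_dThreeStar]
    ext k
    fin_cases k <;> simp [mulVec, dotProduct, Fin.sum_univ_four] <;> ring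
  simp only [adOne, adTwo, adThree, h, esymmOne, esymmTwo, esymmThree]
  refine ⟨?_, ?_, ?_⟩ <;> simp [Matrix.trace, Fin.sum_univ_four] <;> ring

theorem ad_dTwoSharp (x : V) :
    adOne dTwoSharp x = esymmOne ![-x 1, -x 3, 0] ∧
    adTwo dTwoSharp x = esymmTwo ![-x 1, -x 3, 0] ∧
    adThree dTwoSharp x = esymmThree ![-x 1, -x 3, 0] := by
  have h : adMatrix dTwoSharp x = !![-x 1, x 0, 0, 0; 0, 0, 0, 0; 0, 0, -x 3, x 2;
      0, 0, 0, 0] := by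
    refine Matrix.ext_iff_mulVec.mpr fun y => ?_
    rw [adMatrix_mulVec, bracket_dTwoSharp]
    ext k
    fin_cases k <;> simp [mulVec, dotProduct, Fin.sum_univ_four] <;> ring
  simp only [adOne, adTwo, adThree, h, esymmOne, esymmTwo, esymmThree]
  refine ⟨?_, ?_, ?_⟩ <;> simp [Matrix.trace, Fin.sum_univ_four] <;> ring

theorem ad_dThree (x : V) :
    adOne dThree x = 0 ∧ adTwo dThree x = -x 0 ^ 2 + x 1 ^ 2 - x 2 ^ 2 ∧ adThree dThree x = 0 := by
  have h : adMatrix dThree x = !![0, -x 2, x 1, 0; -x 2, 0, x 0, 0; -x 1, x 0, 0, 0;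
      0, 0, 0, 0] := by
    refine Matrix.ext_iff_mulVec.mpr fun y => ?_
    rw [adMatrix_mulVec, bracket_dThree]
    ext k
    fin_cases k <;> simp [mulVec, dotProduct, Fin.sum_univ_four] <;> ring
  simp only [adOne, adTwo, adThree, h]
  refine ⟨?_, ?_, ?_⟩ <;> simp [Matrix.trace, Fin.sum_univ_four] <;> ring

theorem ad_dTwoStar (x : V) :
    adOne dTwoStar x = 0 ∧ adTwo dTwoStar x = 0 ∧ adThree dTwoStar x = 0 := by
  have h : adMatrix dTwoStar x = !![0, -x 3, 0, x 1; 0, 0, -x 3, x 2; 0, 0, 0, 0;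
      0, 0, 0, 0] := by
    refine Matrix.ext_iff_mulVec.mpr fun y => ?_
    rw [adMatrix_mulVec, bracket_dTwoStar]
    ext k
    fin_cases k <;> simp [mulVec, dotProduct, Fin.sum_univ_four] <;> ring
  simp only [adOne, adTwo, adThree, h]
  refine ⟨?_, ?_, ?_⟩ <;> simp [Matrix.trace, Fin.sum_univ_four]

theorem ad_dOne (x : V) :
    adOne dOne x = 0 ∧ adTwo dOne x = 0 ∧ adThree dOne x = 0 := by
  have h : adMatrix dOne x = !![0, -x 3, 0, x 1; 0, 0, 0, 0; 0, 0, 0, 0;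
      0, 0, 0, 0] := by
    refine Matrix.ext_iff_mulVec.mpr fun y => ?_
    rw [adMatrix_mulVec, bracket_dOne]
    ext k
    fin_cases k <;> simp [mulVec, dotProduct, Fin.sum_univ_four] <;> ring
  simp only [adOne, adTwo, adThree, h]
  refine ⟨?_, ?_, ?_⟩ <;> simp [Matrix.trace, Fin.sum_univ_four]

/-! Which standard forms satisfy the closed conditions. -/

theorem functional_apply (f : V →ₗ[ℂ] ℂ) (v : V) :
    f v = v 0 * f (Pi.single 0 1) + v 1 * f (Pi.single 1 1) + v 2 * f (Pi.single 2 1)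
      + v 3 * f (Pi.single 3 1) := by
  conv_lhs => rw [pi_eq_sum_univ' v]
  simp [Fin.sum_univ_four, Pi.single]

theorem metabelian_bigFamily (p : Fin 3 → ℂ) : Metabelian (bigFamily p) := by
  intro x y z w; ext k; fin_cases k <;> simp [bracket_bigFamily]

theorem metabelian_smallFamily (p : Fin 2 → ℂ) : Metabelian (smallFamily p) := by
  intro x y z w; ext k; fin_cases k <;> simp [bracket_smallFamily]

theorem metabelian_dTwoSharp : Metabelian dTwoSharp := by
  intro x y z w; ext k; fin_cases k <;> simp [bracket_dTwoSharp]

/-- All 2-forms `f ∘ d` are divisible by the fourth coordinate form, so their squares vanish. -/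
theorem isotropic_bigFamily (p : Fin 3 → ℂ) : Isotropic (bigFamily p) := by
  intro f x y z w
  rw [functional_apply f (bracket _ x y), functional_apply f (bracket _ z w),
    functional_apply f (bracket _ x z), functional_apply f (bracket _ y w),
    functional_apply f (bracket _ x w), functional_apply f (bracket _ y z)]
  simp only [bracket_bigFamily]
  simp; ring

theorem isotropic_smallFamily (p : Fin 2 → ℂ) : Isotropic (smallFamily p) := by
  intro f x y z w
  rw [functional_apply f (bracket _ x y), functional_apply f (bracket _ z w),
    functional_apply f (bracket _ x z), functional_apply f (bracket _ y w),
    functional_apply f (bracket _ x w), functional_apply f (bracket _ y z)]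
  simp only [bracket_smallFamily]
  simp; ring

/-- The derivation of the abelian ideal is annihilated by the quadratic polynomial `(T - p 0)(T - p
1)`, so it has no cyclic vector. -/
theorem quadratic_smallFamily (p : Fin 2 → ℂ) : Quadratic (smallFamily p) := by
  intro x y
  simp [bracket_smallFamily, det_succ_row_zero, Fin.sum_univ_succ, Fin.succAbove]
  ring

/-- Up to the scale `-x 3`, the operator `ad x` restricted to the Heisenberg ideal is annihilated by
`(T - 1)(T - 2)`. -/
theorem quadratic_dOneSharp : Quadratic dOneSharp := by
  intro x y
  simp [bracket_dOneSharp, det_succ_row_zero, Fin.sum_univ_succ, Fin.succAbove]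
  ring

theorem quadratic_dOne : Quadratic dOne := by
  intro x y
  simp [bracket_dOne, det_succ_row_zero, Fin.sum_univ_succ, Fin.succAbove]

/-- Here `[x, y] = y₄ x - x₄ y` lies in the span of `x` and `y`. -/
theorem planesClosed_dThreeStar : PlanesClosed dThreeStar := by
  intro f x y hx hy
  rw [functional_apply] at hx hy ⊢
  simp [bracket_dThreeStar]
  linear_combination y 3 * hx - x 3 * hy

/-- Brackets have zero fourth coordinate, and the spectrum of ad depends on that coordinate only. -/
theorem derivedTwo_heisFamily (p : Fin 2 → ℂ) : DerivedTwo (heisFamily p) := by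
  intro x y
  rw [(ad_heisFamily p _).2.1, bracket_heisFamily]
  simp

theorem adThreeZero_dTwoSharp : AdThreeZero dTwoSharp := by
  intro x
  rw [(ad_dTwoSharp _).2.2]
  simp [esymmThree]

theorem spectrumIn_bigFamily (p : Fin 3 → ℂ) : SpectrumIn p (bigFamily p) :=
  .of_adEigenvalues fun x => ⟨_, ad_bigFamily p x⟩

theorem spectrumIn_smallFamily (p : Fin 2 → ℂ) :
    SpectrumIn (smallSpectrum p) (smallFamily p) :=
  .of_adEigenvalues fun x => ⟨_, ad_smallFamily p x⟩

theorem spectrumIn_heisFamily (p : Fin 2 → ℂ) :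
    SpectrumIn (heisSpectrum p) (heisFamily p) :=
  .of_adEigenvalues fun x => ⟨_, ad_heisFamily p x⟩

theorem spectrumIn_dOneSharp : SpectrumIn ![1, 1, 2] dOneSharp :=
  .of_adEigenvalues fun x => ⟨_, ad_dOneSharp x⟩

theorem spectrumIn_dThree : SpectrumIn ![1, -1, 0] dThree := by
  intro x
  obtain ⟨h₁, h₂, h₃⟩ := ad_dThree x
  simp [h₁, h₃, esymmOne, esymmThree]

/-! Standard forms that violate the closed conditions. -/

theorem not_metabelian_dThree : ¬ Metabelian dThree := by
  intro h
  have := congrFun (h ![1, 0, 0, 0] ![0, 1, 0, 0] ![1, 0, 0, 0] ![0, 0, 1, 0]) 0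
  simp [bracket_dThree] at this

theorem not_metabelian_heisFamily {p : Fin 2 → ℂ} (h0 : p 0 ≠ 0) (h1 : p 1 ≠ 0) :
    ¬ Metabelian (heisFamily p) := by
  intro h
  have := congrFun (h ![0, 1, 0, 0] ![0, 0, 0, 1] ![0, 0, 1, 0] ![0, 0, 0, 1]) 0
  simp [bracket_heisFamily, h0, h1] at this

theorem not_isotropic_heisFamily {p : Fin 2 → ℂ} (hp : p 0 + p 1 ≠ 0) :
    ¬ Isotropic (heisFamily p) := by
  intro h
  have := h (LinearMap.proj 0) ![0, 1, 0, 0] ![0, 0, 1, 0] ![1, 0, 0, 0] ![0, 0, 0, 1]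
  simp [bracket_heisFamily, hp] at this

theorem not_isotropic_dOneSharp : ¬ Isotropic dOneSharp := by
  intro h
  have := h (LinearMap.proj 0) ![0, 1, 0, 0] ![0, 0, 1, 0] ![1, 0, 0, 0] ![0, 0, 0, 1]
  simp [bracket_dOneSharp] at this

theorem not_isotropic_dTwoSharp : ¬ Isotropic dTwoSharp := by
  intro h
  have := h (LinearMap.proj (R := ℂ) (φ := fun _ => ℂ) 0 + LinearMap.proj 2) ![1, 0, 0, 0] ![0, 1, 0, 0] ![0, 0, 1, 0]
    ![0, 0, 0, 1]
  simp [bracket_dTwoSharp] at this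

theorem not_quadratic_bigFamily (p : Fin 3 → ℂ) : ¬ Quadratic (bigFamily p) := by
  intro h
  have := h ![0, 0, 0, 1] ![0, 0, 1, 0]
  simp [bracket_bigFamily, det_succ_row_zero, Fin.sum_univ_succ, Fin.succAbove] at this

theorem not_quadratic_dTwoStar : ¬ Quadratic dTwoStar := by
  intro h
  have := h ![0, 0, 0, 1] ![0, 0, 1, 0]
  simp [bracket_dTwoStar, det_succ_row_zero, Fin.sum_univ_succ, Fin.succAbove] at this

theorem not_quadratic_heisFamily {p : Fin 2 → ℂ} (h0 : p 0 ≠ 0) (h1 : p 1 ≠ 0) :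
    ¬ Quadratic (heisFamily p) := by
  intro h
  -- `e₃` is cyclic for `e₄` on the span of `e₂, e₃`. So `e₁ + e₃` is cyclic on the whole ideal when
  -- the eigenvalue `p 0 + p 1` of `e₁` differs from `p 0` and `p 1`, that is, when `p 0 * p 1 ≠ 0`.
  have := h ![0, 0, 0, 1] ![1, 0, 1, 0]
  simp [bracket_heisFamily, det_succ_row_zero, Fin.sum_univ_succ, Fin.succAbove] at this
  have : p 0 * p 1 = 0 := by linear_combination this
  simp [h0, h1] at this

theorem not_derivedTwo_dThree : ¬ DerivedTwo dThree := by
  intro h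
  have := h ![1, 0, 0, 0] ![0, 1, 0, 0]
  rw [(ad_dThree _).2.1] at this
  simp [bracket_dThree] at this

theorem not_planesClosed {d : StructConst} {i j k : Fin 4} (hi : i ≠ k) (hj : j ≠ k)
    (h : d i j k ≠ 0) : ¬ PlanesClosed d := by
  intro hd
  have := hd (LinearMap.proj k) (Pi.single i 1) (Pi.single j 1) (by simp [hi.symm])
    (by simp [hj.symm])
  rw [bracket_single] at this
  exact h this

/-! The order of the points by degeneration. -/

/-- The six permutations are spelled out to turn comparisons of special spectra into elementary
algebra. -/
theorem Proportional.cases {p q : Fin 3 → ℂ} (h : Proportional p q) : ∃ c : ℂ, c ≠ 0 ∧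
    ((q 0 = c * p 0 ∧ q 1 = c * p 1 ∧ q 2 = c * p 2) ∨
     (q 0 = c * p 0 ∧ q 1 = c * p 2 ∧ q 2 = c * p 1) ∨
     (q 0 = c * p 1 ∧ q 1 = c * p 0 ∧ q 2 = c * p 2) ∨
     (q 0 = c * p 1 ∧ q 1 = c * p 2 ∧ q 2 = c * p 0) ∨
     (q 0 = c * p 2 ∧ q 1 = c * p 0 ∧ q 2 = c * p 1) ∨
     (q 0 = c * p 2 ∧ q 1 = c * p 1 ∧ q 2 = c * p 0)) := by
  obtain ⟨c, σ, hc, rfl⟩ := h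
  refine ⟨c, hc, ?_⟩
  have h01 : σ 0 ≠ σ 1 := fun h => by simpa using σ.injective h
  have h02 : σ 0 ≠ σ 2 := fun h => by simpa using σ.injective h
  have h12 : σ 1 ≠ σ 2 := fun h => by simpa using σ.injective h
  simp only [Pi.smul_apply, Function.comp, smul_eq_mul]
  generalize σ 0 = i at *
  generalize σ 1 = j at *
  generalize σ 2 = k at *
  fin_cases i <;> fin_cases j <;> fin_cases k <;> simp_all

theorem proportional_of_esymm_eq {p q : Fin 3 → ℂ} (c : ℂ) (hc : c ≠ 0)
    (h₁ : esymmOne q = c * esymmOne p) (h₂ : esymmTwo q = c ^ 2 * esymmTwo p)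
    (h₃ : esymmThree q = c ^ 3 * esymmThree p) : Proportional p q :=
  proportional_iff_esymm.mpr ⟨c, hc, h₁, h₂, h₃⟩

theorem pair_ne_zero {p : Fin 2 → ℂ} (hp : p ≠ 0) : p 0 ≠ 0 ∨ p 1 ≠ 0 := by
  by_contra! h
  exact hp (funext fun i => by fin_cases i <;> simp [h])

theorem smallSpectrum_ne_zero {p : Fin 2 → ℂ} (hp : p ≠ 0) : smallSpectrum p ≠ 0 := by
  intro h
  rcases pair_ne_zero hp with h' | h'
  · exact h' (by simpa [smallSpectrum] using congrFun h 0)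
  · exact h' (by simpa [smallSpectrum] using congrFun h 2)

theorem heisSpectrum_ne_zero {p : Fin 2 → ℂ} (hp : p ≠ 0) : heisSpectrum p ≠ 0 := by
  intro h
  rcases pair_ne_zero hp with h' | h'
  · exact h' (by simpa [heisSpectrum] using congrFun h 0)
  · exact h' (by simpa [heisSpectrum] using congrFun h 1)

theorem Proportional.of_smallSpectrum {p q : Fin 2 → ℂ}
    (h : Proportional (smallSpectrum p) (smallSpectrum q)) : ∃ c : ℂ, c ≠ 0 ∧ q = c • p := by
  obtain ⟨c, hc, h⟩ := h.cases
  refine ⟨c, hc, funext fun i => ?_⟩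
  simp [smallSpectrum] at h
  fin_cases i <;> simp <;> grind

theorem Proportional.of_heisSpectrum {p q : Fin 2 → ℂ}
    (h : Proportional (heisSpectrum p) (heisSpectrum q)) :
    ∃ (c : ℂ) (σ : Equiv.Perm (Fin 2)), c ≠ 0 ∧ q = c • (p ∘ σ) := by
  obtain ⟨c, hc, h⟩ := h.cases
  simp [heisSpectrum] at h
  have : (q 0 = c * p 0 ∧ q 1 = c * p 1) ∨ (q 0 = c * p 1 ∧ q 1 = c * p 0) := by grind
  rcases this with h | h
  · exact ⟨c, 1, hc, funext fun i => by fin_cases i <;> simp [h]⟩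
  · exact ⟨c, Equiv.swap 0 1, hc, funext fun i => by fin_cases i <;> simp [h]⟩

theorem Proportional.heisSpectrum_double {q : Fin 2 → ℂ}
    (h : Proportional (heisSpectrum q) ![1, 1, 2]) : q 0 = q 1 := by
  obtain ⟨c, hc, h⟩ := h.cases
  simp [heisSpectrum] at h
  grind

theorem not_proportional_heisSpectrum_scalar {q : Fin 2 → ℂ} :
    ¬ Proportional (heisSpectrum q) ![1, 1, 1] := by
  intro h
  obtain ⟨c, hc, h⟩ := h.cases
  simp [heisSpectrum] at h
  grind

theorem Proportional.smallSpectrum_double {q : Fin 2 → ℂ}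
    (h : Proportional ![1, 1, 2] (smallSpectrum q)) : q 1 = 2 * q 0 := by
  obtain ⟨c, hc, h⟩ := h.cases
  simp [smallSpectrum] at h
  grind

theorem Proportional.double_heisSpectrum {q : Fin 2 → ℂ}
    (h : Proportional ![1, 1, 2] (heisSpectrum q)) : q 0 = q 1 :=
  h.symm.heisSpectrum_double

theorem Proportional.smallSpectrum_scalar {q : Fin 2 → ℂ}
    (h : Proportional (smallSpectrum q) ![1, 1, 1]) : q 0 = q 1 := by
  obtain ⟨c, hc, h⟩ := h.cases
  simp [smallSpectrum] at h
  grind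

theorem Proportional.trace_zero_heisSpectrum {q : Fin 2 → ℂ}
    (h : Proportional ![1, -1, 0] (heisSpectrum q)) : q 0 + q 1 = 0 := by
  obtain ⟨c, hc, h⟩ := h.cases
  simp [heisSpectrum] at h
  grind

theorem not_proportional_trace_zero_smallSpectrum {q : Fin 2 → ℂ} :
    ¬ Proportional ![1, -1, 0] (smallSpectrum q) := by
  intro h
  obtain ⟨c, hc, h⟩ := h.cases
  simp [smallSpectrum] at h
  grind

theorem not_proportional_double_scalar : ¬ Proportional ![1, 1, 2] ![1, 1, 1] := by
  intro h
  obtain ⟨c, hc, h⟩ := h.cases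
  simp at h
  grind

theorem not_proportional_double_trace_zero : ¬ Proportional ![1, 1, 2] ![1, -1, 0] := by
  intro h
  obtain ⟨c, hc, h⟩ := h.cases
  simp at h
  grind

theorem not_proportional_trace_zero_scalar : ¬ Proportional ![1, -1, 0] ![1, 1, 1] := by
  intro h
  obtain ⟨c, hc, h⟩ := h.cases
  simp at h

theorem not_proportional_unit : ¬ Proportional ![1, 0, 0] ![1, 1, 0] := by
  intro h
  obtain ⟨c, hc, h⟩ := h.cases
  simp at h

/-! Spectra of limits. -/

section Spectrum

variable {p : Fin 3 → ℂ}

theorem vec_ne_zero {a b c : ℂ} (h : a ≠ 0) : (![a, b, c] : Fin 3 → ℂ) ≠ 0 :=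
  fun h' => h (by simpa using congrFun h' 0)

theorem SpectrumIn.bigFamily (hp : p ≠ 0) {q : Fin 3 → ℂ} (hq : q ≠ 0)
    (h : SpectrumIn p (bigFamily q)) : Proportional p q := by
  -- At `x = -e₄` the scale factor `-x 3` is 1, so the spectrum is `q` itself.
  obtain ⟨h₁, h₂, h₃⟩ := ad_bigFamily q ![0, 0, 0, -1]
  exact h.proportional hp hq (by simpa using h₁) (by simpa using h₂) (by simpa using h₃)

theorem SpectrumIn.smallFamily (hp : p ≠ 0) {q : Fin 2 → ℂ} (hq : q ≠ 0)
    (h : SpectrumIn p (smallFamily q)) : Proportional p (smallSpectrum q) := by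
  obtain ⟨h₁, h₂, h₃⟩ := ad_smallFamily q ![0, 0, 0, -1]
  exact h.proportional hp (smallSpectrum_ne_zero hq) (by simpa using h₁) (by simpa using h₂)
    (by simpa using h₃)

theorem SpectrumIn.heisFamily (hp : p ≠ 0) {q : Fin 2 → ℂ} (hq : q ≠ 0)
    (h : SpectrumIn p (heisFamily q)) : Proportional p (heisSpectrum q) := by
  obtain ⟨h₁, h₂, h₃⟩ := ad_heisFamily q ![0, 0, 0, -1]
  exact h.proportional hp (heisSpectrum_ne_zero hq) (by simpa using h₁) (by simpa using h₂)
    (by simpa using h₃)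

theorem SpectrumIn.dOneSharp (hp : p ≠ 0) (h : SpectrumIn p dOneSharp) :
    Proportional p ![1, 1, 2] := by
  obtain ⟨h₁, h₂, h₃⟩ := ad_dOneSharp ![0, 0, 0, -1]
  exact h.proportional hp (vec_ne_zero one_ne_zero) (by simpa using h₁) (by simpa using h₂)
    (by simpa using h₃)

theorem SpectrumIn.dThreeStar (hp : p ≠ 0) (h : SpectrumIn p dThreeStar) :
    Proportional p ![1, 1, 1] := by
  obtain ⟨h₁, h₂, h₃⟩ := ad_dThreeStar ![0, 0, 0, -1]
  exact h.proportional hp (vec_ne_zero one_ne_zero) (by simpa using h₁) (by simpa using h₂)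
    (by simpa using h₃)

theorem SpectrumIn.dThree (hp : p ≠ 0) (h : SpectrumIn p dThree) :
    Proportional p ![1, -1, 0] := by
  obtain ⟨h₁, h₂, h₃⟩ := ad_dThree ![1, 0, 0, 0]
  exact h.proportional hp (vec_ne_zero one_ne_zero) (by simpa [esymmOne] using h₁)
    (by simpa [esymmTwo] using h₂) (by simpa [esymmThree] using h₃)

/-- Two independent toral directions give the spectra `(1, 0, 0)` and `(1, 1, 0)`, which are not
proportional. -/
theorem not_spectrumIn_dTwoSharp (hp : p ≠ 0) : ¬ SpectrumIn p dTwoSharp := by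
  intro h
  obtain ⟨h₁, h₂, h₃⟩ := ad_dTwoSharp ![0, -1, 0, 0]
  have k := h.proportional (q := ![1, 0, 0]) hp (vec_ne_zero one_ne_zero)
    (by simpa using h₁) (by simpa using h₂) (by simpa using h₃)
  obtain ⟨h₁, h₂, h₃⟩ := ad_dTwoSharp ![0, -1, 0, -1]
  have k' := h.proportional (q := ![1, 1, 0]) hp (vec_ne_zero one_ne_zero)
    (by simpa using h₁) (by simpa using h₂) (by simpa using h₃)
  exact not_proportional_unit (k.symm.trans k')

end Spectrum

theorem not_adNilpotent_of_esymm {d : StructConst} {q : Fin 3 → ℂ} (hq : q ≠ 0) (x : V)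
    (h₁ : adOne d x = esymmOne q) (h₂ : adTwo d x = esymmTwo q)
    (h₃ : adThree d x = esymmThree q) : ¬ AdNilpotent d := by
  intro h
  obtain ⟨k₁, k₂, k₃⟩ := h x
  exact hq (esymm_eq_zero (h₁ ▸ k₁) (h₂ ▸ k₂) (h₃ ▸ k₃))

/-- `x.Below y`: the structure with label `x` has a jump deformation to the one with label `y`. -/
def Label.Below : Label → Label → Prop
  | .one, .big _ _ => True
  | .one, .small _ _ => True
  | .one, .heis _ _ => True
  | .one, .oneSharp => True
  | .one, .twoStar => True
  | .one, .twoSharp => True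
  | .one, .three => True
  | .twoStar, .big _ _ => True
  | .twoStar, .heis _ _ => True
  | .twoStar, .twoSharp => True
  | .twoStar, .three => True
  | .threeStar, .small q _ => q 0 = q 1
  | .threeStar, .big q _ => Proportional ![1, 1, 1] q
  | .small p _, .big q _ => Proportional (smallSpectrum p) q
  | .small p _, .oneSharp => p 1 = 2 * p 0
  | .small p _, .heis q _ => Proportional (smallSpectrum p) (heisSpectrum q)
  | .small p _, .twoSharp => p 0 * p 1 = 0
  | .big p _, .heis q _ => Proportional p (heisSpectrum q)
  | .big p _, .twoSharp => p 0 * p 1 * p 2 = 0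
  | .big p _, .three => Proportional p ![1, -1, 0]
  | .oneSharp, .heis q _ => q 0 = q 1
  | .heis p _, .twoSharp => p 0 * p 1 = 0
  | .heis p _, .three => p 0 + p 1 = 0
  | _, _ => False

/-- The structure belonging to a point, with `none` for the zero structure. -/
noncomputable def pointForm : Option Label → StructConst
  | none => 0
  | some x => x.form

/-- Equality of points. -/
def SamePoint : Option Label → Option Label → Prop
  | none, none => True
  | some x, some y => x.Same y
  | _, _ => False

/-- The strict degeneration order on points. -/
def BelowPoint : Option Label → Option Label → Prop
  | none, some _ => True
  | some x, some y => x.Below y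
  | _, _ => False

/-- The degeneration order on points. -/
def AtMost (x y : Option Label) : Prop := SamePoint x y ∨ BelowPoint x y

theorem atMost_none (y : Option Label) : AtMost none y := by
  cases y
  · exact .inl trivial
  · exact .inr trivial

/-- A function which is strictly increasing for the degeneration order. -/
def level : Option Label → ℕ
  | none => 0
  | some .one => 1
  | some .threeStar => 1
  | some .twoStar => 2
  | some (.small _ _) => 2
  | some (.big _ _) => 3
  | some .oneSharp => 3
  | some (.heis _ _) => 4
  | some .twoSharp => 5
  | some .three => 5

theorem BelowPoint.level_lt {x y : Option Label} (h : BelowPoint x y) : level x < level y := by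
  rcases x with _ | x <;> rcases y with _ | y
  · exact h.elim
  · cases y <;> simp [level]
  · exact h.elim
  · cases x <;> cases y <;> first | exact h.elim | simp [level]

theorem SamePoint.level_eq {x y : Option Label} (h : SamePoint x y) : level x = level y := by
  rcases x with _ | x <;> rcases y with _ | y
  · rfl
  · exact h.elim
  · exact h.elim
  · cases x <;> cases y <;> first | exact h.elim | rfl

/-- Antisymmetry: a strict relation in one direction raises the level, which excludes any relation
in the other. -/
theorem AtMost.samePoint {x y : Option Label} (h : AtMost x y) (h' : AtMost y x) :
    SamePoint x y := by
  rcases h with h | h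
  · exact h
  · rcases h' with h' | h'
    · have := h.level_lt; have := h'.level_eq; omega
    · have := h.level_lt; have := h'.level_lt; omega

theorem SamePoint.equivalent {x y : Option Label} (h : SamePoint x y) :
    Equivalent (pointForm x) (pointForm y) := by
  rcases x with _ | x <;> rcases y with _ | y
  · exact .refl _
  · exact h.elim
  · exact h.elim
  · exact Label.Same.equivalent h

/-! ### Upper bounds in the order obtained from closed conditions. -/

theorem atMost_big {p : Fin 3 → ℂ} (hp : p ≠ 0) {x : Option Label}
    (hS : SpectrumIn p (pointForm x)) (hM : Metabelian (pointForm x))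
    (hI : Isotropic (pointForm x)) : AtMost x (some (.big p hp)) := by
  rcases x with _ | x
  · exact atMost_none _
  cases x <;> simp only [pointForm, Label.form] at hS hM hI
  case big q hq => exact .inl (hS.bigFamily hp hq).symm
  case small q hq => exact .inr (hS.smallFamily hp hq).symm
  case heis q hq =>
    -- Isotropy excludes this family when the centre of the Heisenberg ideal has nonzero weight.
    -- When that weight vanishes, both parameters are nonzero and the algebra is not metabelian.
    by_cases h : q 0 + q 1 = 0
    · rcases pair_ne_zero hq with h' | h'
      · exact (not_metabelian_heisFamily h' (fun h1 => h' (by simpa [h1] using h)) hM).elim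
      · exact (not_metabelian_heisFamily (fun h1 => h' (by simpa [h1] using h)) h' hM).elim
    · exact (not_isotropic_heisFamily h hI).elim
  case one => exact .inr trivial
  case oneSharp => exact (not_isotropic_dOneSharp hI).elim
  case twoStar => exact .inr trivial
  case twoSharp => exact (not_isotropic_dTwoSharp hI).elim
  case three => exact (not_metabelian_dThree hM).elim
  case threeStar => exact .inr (hS.dThreeStar hp).symm

theorem atMost_small {p : Fin 2 → ℂ} (hp : p ≠ 0) {x : Option Label}
    (hS : SpectrumIn (smallSpectrum p) (pointForm x)) (hM : Metabelian (pointForm x))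
    (hI : Isotropic (pointForm x)) (hQ : Quadratic (pointForm x)) :
    AtMost x (some (.small p hp)) := by
  have hp' := smallSpectrum_ne_zero hp
  rcases x with _ | x
  · exact atMost_none _
  cases x <;> simp only [pointForm, Label.form] at hS hM hI hQ
  case big q hq => exact (not_quadratic_bigFamily _ hQ).elim
  case small q hq => exact .inl (hS.smallFamily hp' hq).symm.of_smallSpectrum
  case heis q hq =>
    by_cases h : q 0 + q 1 = 0
    · rcases pair_ne_zero hq with h' | h'
      · exact (not_metabelian_heisFamily h' (fun h1 => h' (by simpa [h1] using h)) hM).elim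
      · exact (not_metabelian_heisFamily (fun h1 => h' (by simpa [h1] using h)) h' hM).elim
    · exact (not_isotropic_heisFamily h hI).elim
  case one => exact .inr trivial
  case oneSharp => exact (not_isotropic_dOneSharp hI).elim
  case twoStar => exact (not_quadratic_dTwoStar hQ).elim
  case twoSharp => exact (not_isotropic_dTwoSharp hI).elim
  case three => exact (not_metabelian_dThree hM).elim
  case threeStar => exact .inr (hS.dThreeStar hp').smallSpectrum_scalar

/-- The spectrum decides almost everything. Only `dThree`, whose spectrum agrees with that of `d₁(1
: -1)`, requires the solvability condition. -/
theorem atMost_heis {p : Fin 2 → ℂ} (hp : p ≠ 0) {x : Option Label}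
    (hS : SpectrumIn (heisSpectrum p) (pointForm x)) (hD : DerivedTwo (pointForm x)) :
    AtMost x (some (.heis p hp)) := by
  have hp' := heisSpectrum_ne_zero hp
  rcases x with _ | x
  · exact atMost_none _
  cases x <;> simp only [pointForm, Label.form] at hS hD
  case big q hq => exact .inr (hS.bigFamily hp' hq).symm
  case small q hq => exact .inr (hS.smallFamily hp' hq).symm
  case heis q hq => exact .inl (hS.heisFamily hp' hq).symm.of_heisSpectrum
  case one => exact .inr trivial
  case oneSharp => exact .inr (hS.dOneSharp hp').heisSpectrum_double
  case twoStar => exact .inr trivial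
  case twoSharp => exact (not_spectrumIn_dTwoSharp hp' hS).elim
  case three => exact (not_derivedTwo_dThree hD).elim
  case threeStar => exact (not_proportional_heisSpectrum_scalar (hS.dThreeStar hp')).elim

theorem atMost_oneSharp {x : Option Label} (hS : SpectrumIn ![1, 1, 2] (pointForm x))
    (hQ : Quadratic (pointForm x)) : AtMost x (some .oneSharp) := by
  have hp : (![1, 1, 2] : Fin 3 → ℂ) ≠ 0 := vec_ne_zero one_ne_zero
  rcases x with _ | x
  · exact atMost_none _
  cases x <;> simp only [pointForm, Label.form] at hS hQ
  case big q hq => exact (not_quadratic_bigFamily _ hQ).elim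
  case small q hq => exact .inr (hS.smallFamily hp hq).smallSpectrum_double
  case heis q hq =>
    have h := (hS.heisFamily hp hq).double_heisSpectrum
    have h0 : q 0 ≠ 0 := fun h0 => (pair_ne_zero hq).elim (· h0) (· (h ▸ h0))
    exact (not_quadratic_heisFamily h0 (h ▸ h0) hQ).elim
  case one => exact .inr trivial
  case oneSharp => exact .inl trivial
  case twoStar => exact (not_quadratic_dTwoStar hQ).elim
  case twoSharp => exact (not_spectrumIn_dTwoSharp hp hS).elim
  case three => exact (not_proportional_double_trace_zero (hS.dThree hp)).elim
  case threeStar => exact (not_proportional_double_scalar (hS.dThreeStar hp)).elim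

theorem atMost_three {x : Option Label} (hS : SpectrumIn ![1, -1, 0] (pointForm x)) :
    AtMost x (some .three) := by
  have hp : (![1, -1, 0] : Fin 3 → ℂ) ≠ 0 := vec_ne_zero one_ne_zero
  rcases x with _ | x
  · exact atMost_none _
  cases x <;> simp only [pointForm, Label.form] at hS
  case big q hq => exact .inr (hS.bigFamily hp hq).symm
  case small q hq => exact (not_proportional_trace_zero_smallSpectrum (hS.smallFamily hp hq)).elim
  case heis q hq => exact .inr (hS.heisFamily hp hq).trace_zero_heisSpectrum
  case one => exact .inr trivial
  case oneSharp => exact (not_proportional_double_trace_zero (hS.dOneSharp hp).symm).elim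
  case twoStar => exact .inr trivial
  case twoSharp => exact (not_spectrumIn_dTwoSharp hp hS).elim
  case three => exact .inl trivial
  case threeStar => exact (not_proportional_trace_zero_scalar (hS.dThreeStar hp)).elim

theorem atMost_twoSharp {x : Option Label} (hM : Metabelian (pointForm x))
    (hT : AdThreeZero (pointForm x)) : AtMost x (some .twoSharp) := by
  rcases x with _ | x
  · exact atMost_none _
  cases x <;> simp only [pointForm, Label.form] at hM hT
  case big q hq =>
    refine .inr ?_
    have := hT ![0, 0, 0, -1]
    rw [(ad_bigFamily q _).2.2] at this
    simpa [esymmThree, BelowPoint, Label.Below] using this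
  case small q hq =>
    refine .inr ?_
    have := hT ![0, 0, 0, -1]
    rw [(ad_smallFamily q _).2.2] at this
    simp [esymmThree, smallSpectrum] at this
    simpa [BelowPoint, Label.Below] using this
  case heis q hq =>
    refine .inr ?_
    by_contra h
    simp [BelowPoint, Label.Below] at h
    exact not_metabelian_heisFamily h.1 h.2 hM
  case one => exact .inr trivial
  case oneSharp =>
    have := hT ![0, 0, 0, -1]
    rw [(ad_dOneSharp _).2.2] at this
    simp [esymmThree] at this
  case twoStar => exact .inr trivial
  case twoSharp => exact .inl trivial
  case three => exact (not_metabelian_dThree hM).elim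
  case threeStar =>
    have := hT ![0, 0, 0, -1]
    rw [(ad_dThreeStar _).2.2] at this
    simp [esymmThree] at this

theorem eq_of_adNilpotent {x : Option Label} (hN : AdNilpotent (pointForm x)) :
    x = none ∨ x = some .one ∨ x = some .twoStar := by
  rcases x with _ | x
  · exact .inl rfl
  refine .inr ?_
  cases x <;> simp only [pointForm, Label.form] at hN
  case big q hq =>
    obtain ⟨h₁, h₂, h₃⟩ := ad_bigFamily q ![0, 0, 0, -1]
    exact (not_adNilpotent_of_esymm hq _ (by simpa using h₁) (by simpa using h₂)
      (by simpa using h₃) hN).elim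
  case small q hq =>
    obtain ⟨h₁, h₂, h₃⟩ := ad_smallFamily q ![0, 0, 0, -1]
    exact (not_adNilpotent_of_esymm (smallSpectrum_ne_zero hq) _ (by simpa using h₁)
      (by simpa using h₂) (by simpa using h₃) hN).elim
  case heis q hq =>
    obtain ⟨h₁, h₂, h₃⟩ := ad_heisFamily q ![0, 0, 0, -1]
    exact (not_adNilpotent_of_esymm (heisSpectrum_ne_zero hq) _ (by simpa using h₁)
      (by simpa using h₂) (by simpa using h₃) hN).elim
  case one => exact .inl rfl
  case oneSharp =>
    obtain ⟨h₁, h₂, h₃⟩ := ad_dOneSharp ![0, 0, 0, -1]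
    exact (not_adNilpotent_of_esymm (vec_ne_zero one_ne_zero) _ (by simpa using h₁)
      (by simpa using h₂) (by simpa using h₃) hN).elim
  case twoStar => exact .inr rfl
  case twoSharp =>
    obtain ⟨h₁, h₂, h₃⟩ := ad_dTwoSharp ![0, -1, 0, 0]
    exact (not_adNilpotent_of_esymm (q := ![1, 0, 0]) (vec_ne_zero one_ne_zero) _
      (by simpa using h₁) (by simpa using h₂) (by simpa using h₃) hN).elim
  case three =>
    have := (hN ![1, 0, 0, 0]).2.1
    rw [(ad_dThree _).2.1] at this
    simp at this
  case threeStar =>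
    obtain ⟨h₁, h₂, h₃⟩ := ad_dThreeStar ![0, 0, 0, -1]
    exact (not_adNilpotent_of_esymm (vec_ne_zero one_ne_zero) _ (by simpa using h₁)
      (by simpa using h₂) (by simpa using h₃) hN).elim

theorem atMost_twoStar {x : Option Label} (hN : AdNilpotent (pointForm x)) :
    AtMost x (some .twoStar) := by
  rcases eq_of_adNilpotent hN with rfl | rfl | rfl
  · exact .inr trivial
  · exact .inr trivial
  · exact .inl trivial

theorem atMost_one {x : Option Label} (hN : AdNilpotent (pointForm x))
    (hQ : Quadratic (pointForm x)) : AtMost x (some .one) := by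
  rcases eq_of_adNilpotent hN with rfl | rfl | rfl
  · exact .inr trivial
  · exact .inl trivial
  · exact (not_quadratic_dTwoStar hQ).elim

theorem atMost_threeStar {x : Option Label} (hP : PlanesClosed (pointForm x)) :
    AtMost x (some .threeStar) := by
  rcases x with _ | x
  · exact atMost_none _
  cases x <;> simp only [pointForm, Label.form] at hP
  case big q hq =>
    exact (not_planesClosed (i := 1) (j := 3) (k := 0) (by decide) (by decide)
      (by simp [bigFamily, psi]) hP).elim
  case small q hq =>
    exact (not_planesClosed (i := 2) (j := 3) (k := 1) (by decide) (by decide)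
      (by simp [smallFamily, psi]) hP).elim
  case heis q hq =>
    exact (not_planesClosed (i := 2) (j := 3) (k := 1) (by decide) (by decide)
      (by simp [heisFamily, psi]) hP).elim
  case one =>
    exact (not_planesClosed (i := 1) (j := 3) (k := 0) (by decide) (by decide)
      (by simp [dOne, psi]) hP).elim
  case oneSharp =>
    exact (not_planesClosed (i := 1) (j := 2) (k := 0) (by decide) (by decide)
      (by simp [dOneSharp, psi]) hP).elim
  case twoStar =>
    exact (not_planesClosed (i := 1) (j := 3) (k := 0) (by decide) (by decide)
      (by simp [dTwoStar, psi]) hP).elim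
  case twoSharp =>
    have h := hP (LinearMap.proj (R := ℂ) (φ := fun _ => ℂ) 0 - LinearMap.proj 2)
      ![1, 0, 1, 0] ![0, 1, 0, 0] (by simp) (by simp)
    simp [bracket_dTwoSharp] at h
  case three =>
    exact (not_planesClosed (i := 1) (j := 2) (k := 0) (by decide) (by decide)
      (by simp [dThree, psi]) hP).elim
  case threeStar => exact .inl trivial

/-! Degenerations along analytic curves of matrices. -/

/-- Structure constants of the product `H [G x, G y]`. -/
def conjugate (H G : Matrix (Fin 4) (Fin 4) ℂ) (c : StructConst) : StructConst :=
  fun i j => H *ᵥ bracket c (G *ᵥ Pi.single i 1) (G *ᵥ Pi.single j 1)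

theorem bracket_conjugate (H G : Matrix (Fin 4) (Fin 4) ℂ) (c : StructConst) (x y : V) :
    bracket (conjugate H G c) x y = H *ᵥ bracket c (G *ᵥ x) (G *ᵥ y) := by
  have h : bracketHom (conjugate H G c) =
      ((bracketHom c).compl₁₂ (Matrix.toLin' G) (Matrix.toLin' G)).compr₂ (Matrix.toLin' H) := by
    refine LinearMap.ext_basis (Pi.basisFun ℂ (Fin 4)) (Pi.basisFun ℂ (Fin 4)) fun i j => ?_
    simp only [Pi.basisFun_apply, bracketHom_apply, bracket_single]
    simp [conjugate]
  simpa using LinearMap.congr_fun (LinearMap.congr_fun h x) y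

/-- `d` is a degeneration of `d'`: transporting `d'` by invertible matrices depending
analytically on `t ≠ 0` gives an analytic curve with value `d` at `0`. -/
def IsDegeneration (d d' : StructConst) : Prop :=
  ∃ (γ : ℂ → StructConst) (G : ℂ → Matrix (Fin 4) (Fin 4) ℂ),
    AnalyticAt ℂ γ 0 ∧ (∀ i j, AnalyticAt ℂ (fun t => G t i j) 0) ∧ γ 0 = d ∧
    ∀ᶠ t in 𝓝[≠] (0 : ℂ), (G t).det ≠ 0 ∧
      ∀ x y, G t *ᵥ bracket (γ t) x y = bracket d' (G t *ᵥ x) (G t *ᵥ y)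

theorem analyticAt_det {n : ℕ} {G : ℂ → Matrix (Fin n) (Fin n) ℂ} {z : ℂ}
    (hG : ∀ i j, AnalyticAt ℂ (fun t => G t i j) z) : AnalyticAt ℂ (fun t => (G t).det) z := by
  simp only [det_apply']
  refine Finset.analyticAt_fun_sum _ fun σ _ => ?_
  exact analyticAt_const.mul (Finset.analyticAt_fun_prod _ fun i _ => hG _ _)

theorem analyticAt_adjugate {n : ℕ} {G : ℂ → Matrix (Fin n) (Fin n) ℂ} {z : ℂ}
    (hG : ∀ i j, AnalyticAt ℂ (fun t => G t i j) z) (i j : Fin n) :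
    AnalyticAt ℂ (fun t => (G t).adjugate i j) z := by
  simp only [adjugate_apply]
  refine analyticAt_det fun k l => ?_
  by_cases h : k = j
  · subst h
    simpa using analyticAt_const
  · simpa [updateRow_ne h] using hG k l

theorem analyticAt_conjugate {H G : ℂ → Matrix (Fin 4) (Fin 4) ℂ} {c : ℂ → StructConst} {z : ℂ}
    (hH : ∀ i j, AnalyticAt ℂ (fun t => H t i j) z) (hG : ∀ i j, AnalyticAt ℂ (fun t => G t i j) z)
    (hc : AnalyticAt ℂ c z) : AnalyticAt ℂ (fun t => conjugate (H t) (G t) (c t)) z := by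
  have hc' : ∀ i j k, AnalyticAt ℂ (fun t => c t i j k) z := fun i j k =>
    (analyticAt_pi_iff.mp (analyticAt_pi_iff.mp (analyticAt_pi_iff.mp hc i) j) k)
  refine analyticAt_pi_iff.mpr fun i => analyticAt_pi_iff.mpr fun j =>
    analyticAt_pi_iff.mpr fun k => ?_
  simp only [conjugate, mulVec_single_one]
  simp only [mulVec, dotProduct]
  refine Finset.analyticAt_fun_sum _ fun l _ => (hH _ _).mul ?_
  refine Finset.analyticAt_fun_sum _ fun a _ => Finset.analyticAt_fun_sum _ fun b _ => ?_
  exact ((hc' _ _ _).mul (hG _ _)).mul (hG _ _)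

theorem analyticAt_dslope {E : Type*} [NormedAddCommGroup E] [NormedSpace ℂ E] {f : ℂ → E} {z : ℂ}
    (hf : AnalyticAt ℂ f z) : AnalyticAt ℂ (dslope f z) z := by
  obtain ⟨p, hp⟩ := hf
  exact ⟨_, hp.has_fpower_series_dslope_fslope⟩

theorem tendsto_pow_punctured {N : ℕ} (hN : N ≠ 0) :
    Tendsto (fun t : ℂ => t ^ N) (𝓝[≠] 0) (𝓝[≠] 0) := by
  refine tendsto_nhdsWithin_iff.mpr ⟨?_, ?_⟩
  · have : Tendsto (fun t : ℂ => t ^ N) (𝓝 0) (𝓝 (0 ^ N)) := (continuous_pow N).tendsto 0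
    rw [zero_pow hN] at this
    exact this.mono_left nhdsWithin_le_nhds
  · filter_upwards [self_mem_nhdsWithin] with t ht using pow_ne_zero N ht

/-- A curve through `d'` can be transported along a degeneration of `d'` to `d`. -/
theorem IsDegeneration.exists_curve {d d' : StructConst} (h : IsDegeneration d d') :
    ∃ (G : ℂ → Matrix (Fin 4) (Fin 4) ℂ) (N : ℕ), N ≠ 0 ∧
      (∀ i j, AnalyticAt ℂ (fun t => G t i j) 0) ∧
      ∀ γ' : ℂ → StructConst, AnalyticAt ℂ γ' 0 → γ' 0 = d' →
      ∃ γ : ℂ → StructConst, AnalyticAt ℂ γ 0 ∧ γ 0 = d ∧ ∀ᶠ t in 𝓝[≠] (0 : ℂ), (G t).det ≠ 0 ∧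
        ∀ x y, G t *ᵥ bracket (γ t) x y = bracket (γ' (t ^ N)) (G t *ᵥ x) (G t *ᵥ y) := by
  obtain ⟨γ, G, hγ, hG, rfl, hev⟩ := h
  have hdet := analyticAt_det hG
  -- The determinant is not identically zero near 0, hence equals `t ^ k` times an analytic function
  -- `g` with `g 0 ≠ 0`.
  have hnz : ¬ ∀ᶠ t in 𝓝 (0 : ℂ), (G t).det = 0 := by
    intro h0
    have h1 := h0.filter_mono (nhdsWithin_le_nhds (s := {0}ᶜ))
    obtain ⟨t, ht, ht'⟩ := (hev.and h1).exists
    exact ht.1 ht'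
  obtain ⟨k, g, hg, hg0, hk⟩ := hdet.exists_eventuallyEq_pow_smul_nonzero_iff.mpr hnz
  -- The exponent exceeds the order of the determinant by one: `k` powers of `t` compensate the pole
  -- of the inverse of `G t`, and the remaining one makes the correction vanish at 0.
  refine ⟨G, k + 1, by omega, hG, fun γ' hγ' hγ0 => ?_⟩
  have hη : AnalyticAt ℂ (fun t : ℂ => dslope γ' 0 (t ^ (k + 1))) 0 := by
    refine AnalyticAt.fun_comp (g := dslope γ' 0) ?_ (analyticAt_id.pow _)
    simpa using analyticAt_dslope hγ'
  -- Write `γ' s = d' + s • dslope γ' 0 s`. Transporting the second term by `(G t)⁻¹ = adj (G t) /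
  -- (t ^ k * g t)` with `s = t ^ (k + 1)` gives exactly this analytic correction.
  refine ⟨fun t => γ t + (t * (g t)⁻¹) • conjugate (G t).adjugate (G t) (dslope γ' 0 (t ^ (k + 1))),
    ?_, by simp, ?_⟩
  · exact hγ.add ((analyticAt_id.mul (hg.inv hg0)).smul
      (analyticAt_conjugate (analyticAt_adjugate hG) hG hη))
  · have hgne : ∀ᶠ t in 𝓝[≠] (0 : ℂ), g t ≠ 0 :=
      (hg.continuousAt.eventually_ne hg0).filter_mono nhdsWithin_le_nhds
    filter_upwards [hev, hk.filter_mono nhdsWithin_le_nhds, hgne] with t ht hkt hgt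
    refine ⟨ht.1, fun x y => ?_⟩
    rw [bracket_add_const, bracket_smul_const, bracket_conjugate, mulVec_add, ht.2, mulVec_smul,
      mulVec_mulVec, mul_adjugate, smul_mulVec, one_mulVec, smul_smul, hkt]
    have h1 : γ' (t ^ (k + 1)) = d' + (t ^ (k + 1)) • dslope γ' 0 (t ^ (k + 1)) := by
      have := sub_smul_dslope γ' 0 (t ^ (k + 1))
      rw [sub_zero, hγ0] at this
      rw [this]; abel
    rw [h1, bracket_add_const, bracket_smul_const]
    congr 2
    simp only [sub_zero, smul_eq_mul]
    field_simp
    ring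

/-- The curve realizing the second degeneration is pulled back along the first, and the transporting
matrices are multiplied. -/
theorem IsDegeneration.trans {d d' d'' : StructConst} (h : IsDegeneration d d')
    (h' : IsDegeneration d' d'') : IsDegeneration d d'' := by
  obtain ⟨G, N, hN, hG, hc⟩ := h.exists_curve
  obtain ⟨γ', G', hγ', hG', hγ0, hev'⟩ := h'
  obtain ⟨γ, hγ, hγ0', hev⟩ := hc γ' hγ' hγ0
  refine ⟨γ, fun t => G' (t ^ N) * G t, hγ, fun i j => ?_, hγ0', ?_⟩
  · simp only [Matrix.mul_apply]
    refine Finset.analyticAt_fun_sum _ fun k _ => AnalyticAt.mul ?_ (hG _ _)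
    refine AnalyticAt.fun_comp (g := fun s => G' s i k) ?_ (analyticAt_id.pow _)
    simpa [hN] using hG' i k
  · filter_upwards [hev, (tendsto_pow_punctured hN).eventually hev'] with t ht ht'
    refine ⟨by rw [det_mul]; exact mul_ne_zero ht'.1 ht.1, fun x y => ?_⟩
    rw [← mulVec_mulVec, ht.2, ht'.2, mulVec_mulVec, mulVec_mulVec]

theorem Equivalent.isDegeneration {d d' : StructConst} (h : Equivalent d d') :
    IsDegeneration d d' := by
  obtain ⟨G, hG, h⟩ := equivalent_iff_matrix.mp h.symm
  exact ⟨fun _ => d, fun _ => G, analyticAt_const, fun _ _ => analyticAt_const, rfl,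
    .of_forall fun _ => ⟨hG, h⟩⟩

theorem IsDegeneration.exists_deformation {d d' : StructConst} (h : IsDegeneration d d')
    (hd : IsLie d) {γ' : ℂ → StructConst} (hγ' : IsDeformation γ' d') :
    ∃ (γ : ℂ → StructConst) (N : ℕ), N ≠ 0 ∧ IsDeformation γ d ∧
      ∀ᶠ t in 𝓝[≠] (0 : ℂ), Equivalent (γ t) (γ' (t ^ N)) := by
  obtain ⟨G, N, hN, hG, hc⟩ := h.exists_curve
  obtain ⟨γ, hγ, hγ0, hev⟩ := hc γ' hγ'.1 hγ'.2.1
  have hE : ∀ᶠ t in 𝓝[≠] (0 : ℂ), Equivalent (γ t) (γ' (t ^ N)) := by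
    filter_upwards [hev] with t ht
    exact Equivalent.symm (equivalent_iff_matrix.mpr ⟨G t, ht.1, ht.2⟩)
  refine ⟨γ, N, hN, ⟨hγ, hγ0, ?_⟩, hE⟩
  have hL := (tendsto_pow_punctured hN).eventually (hγ'.2.2.filter_mono nhdsWithin_le_nhds)
  have hL' : ∀ᶠ t in 𝓝[≠] (0 : ℂ), IsLie (γ t) := by
    filter_upwards [hE, hL] with t ht ht' using ht.symm.isLie ht'
  rw [eventually_nhdsWithin_iff] at hL'
  filter_upwards [hL'] with t ht
  by_cases h0 : t = 0
  · rw [h0, hγ0]; exact hd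
  · exact ht h0

theorem IsDegeneration.jumps {d d' : StructConst} (h : IsDegeneration d d') (hd : IsLie d)
    (hd' : IsLie d') (hne : ¬ Equivalent d d') : Jumps d d' := by
  obtain ⟨γ, N, -, hγ, hE⟩ := h.exists_deformation hd (γ' := fun _ => d')
    ⟨analyticAt_const, rfl, .of_forall fun _ => hd'⟩
  exact ⟨hne, γ, hγ, hE⟩

/-! The degenerations between the standard forms. -/

theorem isDegeneration_zero (d : StructConst) : IsDegeneration 0 d := by
  refine ⟨fun t => t • d, fun t => t • (1 : Matrix (Fin 4) (Fin 4) ℂ), by fun_prop, fun i j => ?_,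
    by simp, ?_⟩
  · simp only [Matrix.smul_apply, smul_eq_mul]; fun_prop
  · filter_upwards [self_mem_nhdsWithin] with t ht
    refine ⟨by simpa [det_smul] using ht, fun x y => ?_⟩
    simp [bracket_smul_const, smul_mulVec, bracket_smul_left, bracket_smul_right]

theorem equivalent_dOne_smallFamily_zero : Equivalent dOne (smallFamily 0) := by
  refine equivalent_iff_matrix.mpr ⟨!![0, 1, 0, 0; 0, 0, 1, 0; 1, 0, 0, 0; 0, 0, 0, 1],
    ?_, fun x y => ?_⟩
  · simp [det_succ_row_zero, Fin.sum_univ_succ, Fin.succAbove]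
  · ext k
    fin_cases k <;> simp [bracket_smallFamily, bracket_dOne, mulVec, dotProduct, Fin.sum_univ_four]

/-- The parameters `t • p` and `p` are equivalent for `t ≠ 0`, whereas at `t = 0` only the nilpotent
part survives. The same holds for the big family and `dTwoStar`. -/
theorem isDegeneration_dOne_smallFamily (p : Fin 2 → ℂ) :
    IsDegeneration dOne (smallFamily p) := by
  refine equivalent_dOne_smallFamily_zero.isDegeneration.trans
    ⟨fun t => smallFamily (t • p), fun t => !![1, 0, 0, 0; 0, t, 0, 0; 0, 0, 1, 0; 0, 0, 0, t],
      ?_, fun i j => ?_, by simp, ?_⟩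
  · unfold smallFamily; simp only [Pi.smul_apply, smul_eq_mul]; fun_prop
  · fin_cases i <;> fin_cases j <;> simp <;> fun_prop
  · filter_upwards [self_mem_nhdsWithin] with t ht
    have ht : t ≠ 0 := ht
    refine ⟨by simp [det_succ_row_zero, Fin.sum_univ_succ, Fin.succAbove, ht], fun x y => ?_⟩
    ext k
    fin_cases k <;> simp [bracket_smallFamily, mulVec, dotProduct, Fin.sum_univ_four] <;> ring

theorem isDegeneration_dTwoStar_bigFamily (p : Fin 3 → ℂ) :
    IsDegeneration dTwoStar (bigFamily p) := by
  refine ⟨fun t => bigFamily (t • p),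
    fun t => !![t ^ 2, 0, 0, 0; 0, t, 0, 0; 0, 0, 1, 0; 0, 0, 0, t],
      ?_, fun i j => ?_, by simp [bigFamily, dTwoStar], ?_⟩
  · unfold bigFamily; simp only [Pi.smul_apply, smul_eq_mul]; fun_prop
  · fin_cases i <;> fin_cases j <;> simp <;> fun_prop
  · filter_upwards [self_mem_nhdsWithin] with t ht
    have ht : t ≠ 0 := ht
    refine ⟨by simp [det_succ_row_zero, Fin.sum_univ_succ, Fin.succAbove, ht], fun x y => ?_⟩
    ext k
    fin_cases k <;> simp [bracket_bigFamily, mulVec, dotProduct, Fin.sum_univ_four] <;> ring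

theorem isDegeneration_dOne_dTwoStar :
    IsDegeneration dOne dTwoStar := by
  have hc : ∀ x y, bracket (psi 3 4 2) x y = ![0, x 2 * y 3 - x 3 * y 2, 0, 0] := fun x y => by
    ext k
    fin_cases k <;> simp [bracket, Fin.sum_univ_four, psi] <;> ring
  refine ⟨fun t => dOne + t • (psi 3 4 2), fun t => !![1, 0, 0, 0; 0, 1, 0, 0; 0, 0, t, 0; 0, 0, 0, 1], by fun_prop, fun i j => ?_, by simp, ?_⟩
  · fin_cases i <;> fin_cases j <;> simp <;> fun_prop
  · filter_upwards [self_mem_nhdsWithin] with t ht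
    have ht : t ≠ 0 := ht
    refine ⟨?_, fun x y => ?_⟩
    · simp [det_succ_row_zero, Fin.sum_univ_succ, Fin.succAbove, ht]
    · rw [bracket_add_const, bracket_smul_const, hc]
      ext k
      fin_cases k <;> simp [bracket_dOne, bracket_dTwoStar, mulVec, dotProduct, Fin.sum_univ_four] <;> ring

theorem isDegeneration_smallFamily_bigFamily (p : Fin 2 → ℂ) :
    IsDegeneration (smallFamily p) (bigFamily (smallSpectrum p)) := by
  have hc : ∀ x y, bracket (psi 2 4 1) x y = ![x 1 * y 3 - x 3 * y 1, 0, 0, 0] := fun x y => by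
    ext k
    fin_cases k <;> simp [bracket, Fin.sum_univ_four, psi] <;> ring
  refine ⟨fun t => smallFamily p + t • (psi 2 4 1), fun t => !![1, 0, 0, 0; 0, t, 0, 0; 0, 0, t, 0; 0, 0, 0, 1], by fun_prop, fun i j => ?_, by simp, ?_⟩
  · fin_cases i <;> fin_cases j <;> simp <;> fun_prop
  · filter_upwards [self_mem_nhdsWithin] with t ht
    have ht : t ≠ 0 := ht
    refine ⟨?_, fun x y => ?_⟩
    · simp [det_succ_row_zero, Fin.sum_univ_succ, Fin.succAbove, ht]
    · rw [bracket_add_const, bracket_smul_const, hc]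
      ext k
      fin_cases k <;> simp [bracket_smallFamily, bracket_bigFamily, smallSpectrum, mulVec, dotProduct, Fin.sum_univ_four] <;> ring

theorem isDegeneration_dThreeStar_smallFamily :
    IsDegeneration dThreeStar (smallFamily ![1, 1]) := by
  have hc : ∀ x y, bracket (psi 3 4 2) x y = ![0, x 2 * y 3 - x 3 * y 2, 0, 0] := fun x y => by
    ext k
    fin_cases k <;> simp [bracket, Fin.sum_univ_four, psi] <;> ring
  refine ⟨fun t => dThreeStar + t • (psi 3 4 2), fun t => !![1, 0, 0, 0; 0, 1, 0, 0; 0, 0, t, 0; 0, 0, 0, 1], by fun_prop, fun i j => ?_, by simp, ?_⟩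
  · fin_cases i <;> fin_cases j <;> simp <;> fun_prop
  · filter_upwards [self_mem_nhdsWithin] with t ht
    have ht : t ≠ 0 := ht
    refine ⟨?_, fun x y => ?_⟩
    · simp [det_succ_row_zero, Fin.sum_univ_succ, Fin.succAbove, ht]
    · rw [bracket_add_const, bracket_smul_const, hc]
      ext k
      fin_cases k <;> simp [bracket_dThreeStar, bracket_smallFamily, mulVec, dotProduct, Fin.sum_univ_four] <;> ring

/-- The added term makes the ideal a Heisenberg algebra with centre `e₂ + e₃`, the eigenvector of
eigenvalue 2. This is compatible with the derivation because `2 = 1 + 1`. -/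
theorem isDegeneration_smallFamily_dOneSharp :
    IsDegeneration (smallFamily ![1, 2]) dOneSharp := by
  have hc : ∀ x y, bracket (psi 1 2 2 + psi 1 2 3 - psi 1 3 2 - psi 1 3 3) x y = ![0, x 0 * y 1 - x 1 * y 0 - (x 0 * y 2 - x 2 * y 0), x 0 * y 1 - x 1 * y 0 - (x 0 * y 2 - x 2 * y 0), 0] := fun x y => by
    ext k
    fin_cases k <;> simp [bracket, Fin.sum_univ_four, psi] <;> ring
  refine ⟨fun t => smallFamily ![1, 2] + t • (psi 1 2 2 + psi 1 2 3 - psi 1 3 2 - psi 1 3 3), fun t => !![0, 0, 1, 0; t, 0, 0, 0; 0, 1, -1, 0; 0, 0, 0, 1], by fun_prop, fun i j => ?_, by simp, ?_⟩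
  · fin_cases i <;> fin_cases j <;> simp <;> fun_prop
  · filter_upwards [self_mem_nhdsWithin] with t ht
    have ht : t ≠ 0 := ht
    refine ⟨?_, fun x y => ?_⟩
    · simp [det_succ_row_zero, Fin.sum_univ_succ, Fin.succAbove, ht]
    · rw [bracket_add_const, bracket_smul_const, hc]
      ext k
      fin_cases k <;> simp [bracket_smallFamily, bracket_dOneSharp, mulVec, dotProduct, Fin.sum_univ_four] <;> ring

/-- As `e₁` has weight `p 0 + p 1`, the bracket `[e₂, e₃] = t e₁` can be added. The entry `t` in the
last column sends `e₄` to `e₄ + t e₃`, so that the Heisenberg bracket produces the term `ψ^{24}_1`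
of the big family. -/
theorem isDegeneration_bigFamily_heisFamily (p : Fin 2 → ℂ) :
    IsDegeneration (bigFamily ![p 0 + p 1, p 0, p 1]) (heisFamily p) := by
  have hc : ∀ x y, bracket (psi 2 3 1) x y = ![x 1 * y 2 - x 2 * y 1, 0, 0, 0] := fun x y => by
    ext k
    fin_cases k <;> simp [bracket, Fin.sum_univ_four, psi] <;> ring
  refine ⟨fun t => bigFamily ![p 0 + p 1, p 0, p 1] + t • (psi 2 3 1), fun t => !![t ^ 3, 0, 0, 0; 0, t ^ 2, 0, 0; 0, 0, t ^ 2, t; 0, 0, 0, 1], by fun_prop, fun i j => ?_, by simp, ?_⟩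
  · fin_cases i <;> fin_cases j <;> simp <;> fun_prop
  · filter_upwards [self_mem_nhdsWithin] with t ht
    have ht : t ≠ 0 := ht
    refine ⟨?_, fun x y => ?_⟩
    · simp [det_succ_row_zero, Fin.sum_univ_succ, Fin.succAbove, ht]
    · rw [bracket_add_const, bracket_smul_const, hc]
      ext k
      fin_cases k <;> simp [bracket_bigFamily, bracket_heisFamily, mulVec, dotProduct, Fin.sum_univ_four] <;> ring

theorem isDegeneration_dOneSharp_heisFamily :
    IsDegeneration dOneSharp (heisFamily ![1, 1]) := by
  have hc : ∀ x y, bracket (psi 3 4 2) x y = ![0, x 2 * y 3 - x 3 * y 2, 0, 0] := fun x y => by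
    ext k
    fin_cases k <;> simp [bracket, Fin.sum_univ_four, psi] <;> ring
  refine ⟨fun t => dOneSharp + t • (psi 3 4 2), fun t => !![t, 0, 0, 0; 0, 1, 0, 0; 0, 0, t, 0; 0, 0, 0, 1], by fun_prop, fun i j => ?_, by simp, ?_⟩
  · fin_cases i <;> fin_cases j <;> simp <;> fun_prop
  · filter_upwards [self_mem_nhdsWithin] with t ht
    have ht : t ≠ 0 := ht
    refine ⟨?_, fun x y => ?_⟩
    · simp [det_succ_row_zero, Fin.sum_univ_succ, Fin.succAbove, ht]
    · rw [bracket_add_const, bracket_smul_const, hc]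
      ext k
      fin_cases k <;> simp [bracket_dOneSharp, bracket_heisFamily, mulVec, dotProduct, Fin.sum_univ_four] <;> ring

/-- The added term makes `e₃` act by a nonzero scalar on the span of `e₁, e₂`, where `e₄` is
diagonalizable with two distinct eigenvalues. The two actions then separate into `r₂ ⊕ r₂`. -/
theorem isDegeneration_bigFamily_dTwoSharp {a b : ℂ} (hab : a ≠ b) :
    IsDegeneration (bigFamily ![a, b, 0]) dTwoSharp := by
  have hc : ∀ x y, bracket (psi 1 3 1 + psi 2 3 2) x y = ![x 0 * y 2 - x 2 * y 0, x 1 * y 2 - x 2 * y 1, 0, 0] := fun x y => by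
    ext k
    fin_cases k <;> simp [bracket, Fin.sum_univ_four, psi] <;> ring
  refine ⟨fun t => bigFamily ![a, b, 0] + t • (psi 1 3 1 + psi 2 3 2), fun t => !![t * (a - b), t, 0, -1; 0, 0, t, a; 0, t, 0, -1; 0, 0, t, b], by fun_prop, fun i j => ?_, by simp, ?_⟩
  · fin_cases i <;> fin_cases j <;> simp <;> fun_prop
  · filter_upwards [self_mem_nhdsWithin] with t ht
    have ht : t ≠ 0 := ht
    refine ⟨?_, fun x y => ?_⟩
    · have : t * (a - b) * t * (t * (a - b)) ≠ 0 := by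
        have := sub_ne_zero.mpr hab
        positivity
      convert this using 1
      simp [det_succ_row_zero, Fin.sum_univ_succ, Fin.succAbove]
      ring
    · rw [bracket_add_const, bracket_smul_const, hc]
      ext k
      fin_cases k <;> simp [bracket_bigFamily, bracket_dTwoSharp, mulVec, dotProduct, Fin.sum_univ_four] <;> ring

/-- The added term gives `e₃` the distinct eigenvalues `0` and `-t` on the span of `e₁, e₂`, where
`e₄` acts as a scalar. This again yields two independent toral directions. -/
theorem isDegeneration_heisFamily_dTwoSharp :
    IsDegeneration (heisFamily ![1, 0]) dTwoSharp := by
  have hc : ∀ x y, bracket (psi 2 3 2) x y = ![0, x 1 * y 2 - x 2 * y 1, 0, 0] := fun x y => by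
    ext k
    fin_cases k <;> simp [bracket, Fin.sum_univ_four, psi] <;> ring
  refine ⟨fun t => heisFamily ![1, 0] + t • (psi 2 3 2), fun t => !![-t, 1, 1, 0; 0, 0, 0, 1; 0, 1, 1, 0; 0, 0, t, 1], by fun_prop, fun i j => ?_, by simp, ?_⟩
  · fin_cases i <;> fin_cases j <;> simp <;> fun_prop
  · filter_upwards [self_mem_nhdsWithin] with t ht
    have ht : t ≠ 0 := ht
    refine ⟨?_, fun x y => ?_⟩
    · simp [det_succ_row_zero, Fin.sum_univ_succ, Fin.succAbove, ht]
    · rw [bracket_add_const, bracket_smul_const, hc]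
      ext k
      fin_cases k <;> simp [bracket_heisFamily, bracket_dTwoSharp, mulVec, dotProduct, Fin.sum_univ_four] <;> ring

/-- After the deformation `e₁` acts on the span of `e₂, e₃` as `2 t e₄` does. Hence `e₁ - 2 t e₄` is
central and `e₁, e₂, e₃` span a copy of `sl₂` with `e₁` toral. -/
theorem isDegeneration_heisFamily_dThree :
    IsDegeneration (heisFamily ![1, -1]) dThree := by
  have hc : ∀ x y, bracket ((2 : ℂ) • psi 1 3 3 - (2 : ℂ) • psi 1 2 2 - (2 : ℂ) • psi 1 3 2) x y = ![0, -2 * (x 0 * y 1 - x 1 * y 0) - 2 * (x 0 * y 2 - x 2 * y 0), 2 * (x 0 * y 2 - x 2 * y 0), 0] := fun x y => by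
    ext k
    fin_cases k <;> simp [bracket, Fin.sum_univ_four, psi] <;> ring
  refine ⟨fun t => heisFamily ![1, -1] + t • ((2 : ℂ) • psi 1 3 3 - (2 : ℂ) • psi 1 2 2 - (2 : ℂ) • psi 1 3 2), fun t => !![-2 * t, 0, 0, -1; 0, t, 1 + t / 2, 0; 0, t, -1 + t / 2, 0; 0, 0, 0, 1], by fun_prop, fun i j => ?_, by simp, ?_⟩
  · fin_cases i <;> fin_cases j <;> simp <;> fun_prop
  · filter_upwards [self_mem_nhdsWithin] with t ht
    have ht : t ≠ 0 := ht
    refine ⟨?_, fun x y => ?_⟩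
    · have : (4 : ℂ) * t ^ 2 ≠ 0 := by simpa using ht
      convert this using 1
      simp [det_succ_row_zero, Fin.sum_univ_succ, Fin.succAbove]
      ring
    · rw [bracket_add_const, bracket_smul_const, hc]
      ext k
      fin_cases k <;> simp [bracket_heisFamily, bracket_dThree, mulVec, dotProduct, Fin.sum_univ_four] <;> ring


theorem Proportional.isDegeneration {p q : Fin 3 → ℂ} (h : Proportional p q) :
    IsDegeneration (bigFamily p) (bigFamily q) :=
  h.equivalent.isDegeneration

theorem isDegeneration_bigFamily_heisFamily_of_proportional {p : Fin 3 → ℂ} {q : Fin 2 → ℂ}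
    (h : Proportional p (heisSpectrum q)) : IsDegeneration (bigFamily p) (heisFamily q) := by
  have h' : Proportional p ![q 0 + q 1, q 0, q 1] :=
    h.trans (proportional_of_esymm_eq 1 one_ne_zero (by simp [esymmOne, heisSpectrum]; ring)
      (by simp [esymmTwo, heisSpectrum]; ring) (by simp [esymmThree, heisSpectrum]; ring))
  exact h'.isDegeneration.trans (isDegeneration_bigFamily_heisFamily q)

theorem equivalent_heisFamily_of_mul {p : Fin 2 → ℂ} (hp : p ≠ 0) (h : p 0 * p 1 = 0) :
    Equivalent (heisFamily p) (heisFamily ![1, 0]) := by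
  rcases mul_eq_zero.mp h with h | h
  · have h1 : p 1 ≠ 0 := (pair_ne_zero hp).resolve_left (fun h' => h' h)
    have : ![p 1, p 0] = p 1 • (![1, 0] : Fin 2 → ℂ) := by
      funext i; fin_cases i <;> simp [h]
    refine (equivalent_heisFamily_swap (q := ![p 1, p 0]) rfl rfl).trans ?_
    rw [this]
    exact (equivalent_heisFamily_smul _ h1).symm
  · have h0 : p 0 ≠ 0 := (pair_ne_zero hp).resolve_right (fun h' => h' h)
    have : p = p 0 • (![1, 0] : Fin 2 → ℂ) := by
      funext i; fin_cases i <;> simp [h]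
    rw [this]
    exact (equivalent_heisFamily_smul _ h0).symm

theorem isDegeneration_heisFamily_dTwoSharp_of_mul {p : Fin 2 → ℂ} (hp : p ≠ 0)
    (h : p 0 * p 1 = 0) : IsDegeneration (heisFamily p) dTwoSharp :=
  (equivalent_heisFamily_of_mul hp h).isDegeneration.trans isDegeneration_heisFamily_dTwoSharp

theorem isDegeneration_heisFamily_dThree_of_add {p : Fin 2 → ℂ} (hp : p ≠ 0)
    (h : p 0 + p 1 = 0) : IsDegeneration (heisFamily p) dThree := by
  refine IsDegeneration.trans (Equivalent.isDegeneration ?_) isDegeneration_heisFamily_dThree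
  have h1 : p 1 = -p 0 := by linear_combination h
  have h0 : p 0 ≠ 0 := by
    intro h0
    rcases pair_ne_zero hp with h' | h'
    · exact h' h0
    · exact h' (by rw [h1, h0, neg_zero])
  have : p = p 0 • (![1, -1] : Fin 2 → ℂ) := by
    funext i; fin_cases i <;> simp [h1]
  rw [this]
  exact (equivalent_heisFamily_smul _ h0).symm

theorem isDegeneration_bigFamily_dTwoSharp_of_mul {p : Fin 3 → ℂ} (hp : p ≠ 0)
    (h : p 0 * p 1 * p 2 = 0) : IsDegeneration (bigFamily p) dTwoSharp := by
  obtain ⟨a, b, hab⟩ : ∃ a b, Proportional p ![a, b, 0] := by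
    rcases mul_eq_zero.mp h with h | h
    · rcases mul_eq_zero.mp h with h | h
      · exact ⟨p 1, p 2, proportional_of_esymm_eq 1 one_ne_zero (by simp [esymmOne, h])
          (by simp [esymmTwo, h]) (by simp [esymmThree, h])⟩
      · exact ⟨p 0, p 2, proportional_of_esymm_eq 1 one_ne_zero (by simp [esymmOne, h])
          (by simp [esymmTwo, h]) (by simp [esymmThree, h])⟩
    · exact ⟨p 0, p 1, proportional_of_esymm_eq 1 one_ne_zero (by simp [esymmOne, h])
          (by simp [esymmTwo, h]) (by simp [esymmThree, h])⟩
  -- For a double eigenvalue the direct construction fails, but `(a, a, 0)` is the spectrum of `d₁(a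
  -- : 0)`, through which the degeneration passes.
  by_cases hne : a = b
  · subst hne
    have ha : a ≠ 0 := by
      rintro rfl
      obtain ⟨c, hc, h⟩ := hab.symm.cases
      apply hp
      funext i
      simp at h
      fin_cases i <;> simp [h]
    have h1 : Proportional p (heisSpectrum ![a, 0]) :=
      hab.trans (proportional_of_esymm_eq 1 one_ne_zero (by simp [esymmOne, heisSpectrum])
        (by simp [esymmTwo, heisSpectrum]) (by simp [esymmThree, heisSpectrum]))
    refine (isDegeneration_bigFamily_heisFamily_of_proportional h1).trans
      (isDegeneration_heisFamily_dTwoSharp_of_mul ?_ (by simp))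
    exact fun h => ha (by simpa using congrFun h 0)
  · exact hab.isDegeneration.trans (isDegeneration_bigFamily_dTwoSharp hne)

theorem isDegeneration_bigFamily_dThree {p : Fin 3 → ℂ} (h : Proportional p ![1, -1, 0]) :
    IsDegeneration (bigFamily p) dThree :=
  (isDegeneration_bigFamily_heisFamily_of_proportional (q := ![1, -1])
    (by simpa [heisSpectrum] using h)).trans isDegeneration_heisFamily_dThree

theorem equivalent_smallFamily_of_eq {q : Fin 2 → ℂ} (hq : q ≠ 0) (h : q 0 = q 1) :
    Equivalent (smallFamily ![1, 1]) (smallFamily q) := by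
  have h0 : q 0 ≠ 0 := (pair_ne_zero hq).elim id fun h' => h ▸ h'
  have : q = q 0 • (![1, 1] : Fin 2 → ℂ) := by
    funext i; fin_cases i <;> simp [h]
  rw [this]
  exact equivalent_smallFamily_smul _ h0

theorem isDegeneration_dThreeStar_smallFamily_of_eq {q : Fin 2 → ℂ} (hq : q ≠ 0)
    (h : q 0 = q 1) : IsDegeneration dThreeStar (smallFamily q) :=
  isDegeneration_dThreeStar_smallFamily.trans (equivalent_smallFamily_of_eq hq h).isDegeneration

theorem isDegeneration_smallFamily_dOneSharp_of_eq {p : Fin 2 → ℂ} (hp : p ≠ 0)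
    (h : p 1 = 2 * p 0) : IsDegeneration (smallFamily p) dOneSharp := by
  refine IsDegeneration.trans (Equivalent.isDegeneration ?_) isDegeneration_smallFamily_dOneSharp
  have h0 : p 0 ≠ 0 := (pair_ne_zero hp).elim id fun h' h0 => h' (by simp [h, h0])
  have : p = p 0 • (![1, 2] : Fin 2 → ℂ) := by
    funext i; fin_cases i <;> simp [h, mul_comm]
  rw [this]
  exact (equivalent_smallFamily_smul _ h0).symm

theorem equivalent_heisFamily_of_eq {q : Fin 2 → ℂ} (hq : q ≠ 0) (h : q 0 = q 1) :
    Equivalent (heisFamily ![1, 1]) (heisFamily q) := by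
  have h0 : q 0 ≠ 0 := (pair_ne_zero hq).elim id fun h' => h ▸ h'
  have : q = q 0 • (![1, 1] : Fin 2 → ℂ) := by
    funext i; fin_cases i <;> simp [h]
  rw [this]
  exact equivalent_heisFamily_smul _ h0

theorem isDegeneration_dOneSharp_heisFamily_of_eq {q : Fin 2 → ℂ} (hq : q ≠ 0)
    (h : q 0 = q 1) : IsDegeneration dOneSharp (heisFamily q) :=
  isDegeneration_dOneSharp_heisFamily.trans (equivalent_heisFamily_of_eq hq h).isDegeneration

/-- All relations follow from the explicit degenerations by composition. Beyond those curves, only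
proportionality of spectra has to be matched. -/
theorem Label.Below.isDegeneration {x y : Label} (h : x.Below y) :
    IsDegeneration x.form y.form := by
  have hbig := isDegeneration_dTwoStar_bigFamily
  have hheis : ∀ q, IsDegeneration dTwoStar (heisFamily q) := fun q =>
    (hbig _).trans (isDegeneration_bigFamily_heisFamily q)
  have h2 : IsDegeneration dTwoStar dTwoSharp :=
    (hbig _).trans (isDegeneration_bigFamily_dTwoSharp (zero_ne_one (α := ℂ)))
  have h3 : IsDegeneration dTwoStar dThree :=
    (hheis _).trans isDegeneration_heisFamily_dThree
  have h1 := isDegeneration_dOne_dTwoStar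
  cases x <;> cases y <;> simp only [Label.Below] at h
  all_goals simp only [Label.form]
  case big.heis => exact isDegeneration_bigFamily_heisFamily_of_proportional h
  case big.twoSharp p hp => exact isDegeneration_bigFamily_dTwoSharp_of_mul hp h
  case big.three => exact isDegeneration_bigFamily_dThree h
  case small.big => exact (isDegeneration_smallFamily_bigFamily _).trans h.isDegeneration
  case small.heis =>
    exact (isDegeneration_smallFamily_bigFamily _).trans
      (isDegeneration_bigFamily_heisFamily_of_proportional h)
  case small.oneSharp p hp => exact isDegeneration_smallFamily_dOneSharp_of_eq hp h
  case small.twoSharp p hp =>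
    refine (isDegeneration_smallFamily_bigFamily _).trans
      (isDegeneration_bigFamily_dTwoSharp_of_mul (smallSpectrum_ne_zero hp) ?_)
    change p 0 * p 0 * p 1 = 0
    linear_combination p 0 * h
  case heis.twoSharp p hp => exact isDegeneration_heisFamily_dTwoSharp_of_mul hp h
  case heis.three p hp => exact isDegeneration_heisFamily_dThree_of_add hp h
  case one.big => exact h1.trans (hbig _)
  case one.small => exact isDegeneration_dOne_smallFamily _
  case one.heis => exact h1.trans (hheis _)
  case one.oneSharp =>
    exact (isDegeneration_dOne_smallFamily _).trans isDegeneration_smallFamily_dOneSharp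
  case one.twoStar => exact h1
  case one.twoSharp => exact h1.trans h2
  case one.three => exact h1.trans h3
  case oneSharp.heis q hq => exact isDegeneration_dOneSharp_heisFamily_of_eq hq h
  case twoStar.big => exact hbig _
  case twoStar.heis => exact hheis _
  case twoStar.twoSharp => exact h2
  case twoStar.three => exact h3
  case threeStar.big =>
    refine isDegeneration_dThreeStar_smallFamily.trans
      ((isDegeneration_smallFamily_bigFamily _).trans (Proportional.isDegeneration ?_))
    simpa [smallSpectrum] using h
  case threeStar.small q hq => exact isDegeneration_dThreeStar_smallFamily_of_eq hq h

theorem AtMost.isDegeneration {x y : Option Label} (h : AtMost x y) :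
    IsDegeneration (pointForm x) (pointForm y) := by
  rcases h with h | h
  · exact h.equivalent.isDegeneration
  · rcases x with _ | x
    · exact isDegeneration_zero _
    · rcases y with _ | y
      · exact h.elim
      · exact Label.Below.isDegeneration h

/-! Normal forms of small matrices under similarity. -/

/-- Similarity of matrices. -/
def Similar {n : ℕ} (A B : Matrix (Fin n) (Fin n) ℂ) : Prop :=
  ∃ P : Matrix (Fin n) (Fin n) ℂ, P.det ≠ 0 ∧ A * P = P * B

theorem Similar.trans {n : ℕ} {A B C : Matrix (Fin n) (Fin n) ℂ} (h : Similar A B)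
    (h' : Similar B C) : Similar A C := by
  obtain ⟨P, hP, h⟩ := h
  obtain ⟨Q, hQ, h'⟩ := h'
  refine ⟨P * Q, by rw [det_mul]; exact mul_ne_zero hP hQ, ?_⟩
  rw [← Matrix.mul_assoc, h, Matrix.mul_assoc, h', Matrix.mul_assoc]

theorem exists_factorization_two (M : Matrix (Fin 2) (Fin 2) ℂ) : ∃ a b : ℂ,
    a + b = M 0 0 + M 1 1 ∧ a * b = M 0 0 * M 1 1 - M 0 1 * M 1 0 := by
  obtain ⟨s, hs⟩ := IsAlgClosed.exists_pow_nat_eq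
    ((M 0 0 + M 1 1) ^ 2 - 4 * (M 0 0 * M 1 1 - M 0 1 * M 1 0)) (n := 2) (by norm_num)
  refine ⟨(M 0 0 + M 1 1 + s) / 2, (M 0 0 + M 1 1 - s) / 2, by ring, ?_⟩
  linear_combination -hs / 4

theorem exists_charpoly_factorization_three (A : Matrix (Fin 3) (Fin 3) ℂ) : ∃ a b c : ℂ,
    (A - a • 1) * ((A - b • 1) * (A - c • 1)) = 0 := by
  have hs : A.charpoly.Splits := IsAlgClosed.splits _
  have hm := A.charpoly_monic
  have hcard : A.charpoly.roots.card = 3 := by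
    rw [← hs.natDegree_eq_card_roots, charpoly_natDegree_eq_dim]; simp
  obtain ⟨a, b, c, habc⟩ := Multiset.card_eq_three.mp hcard
  refine ⟨a, b, c, ?_⟩
  have h := aeval_self_charpoly A
  rw [hs.eq_prod_roots_of_monic hm, habc] at h
  simpa [Algebra.algebraMap_eq_smul_one] using h

/-- Either every vector is an eigenvector, or some `v` is cyclic and `(M - b) v, v` is the desired
basis, for `a, b` the eigenvalues. -/
theorem eq_smul_one_or_exists_two (M : Matrix (Fin 2) (Fin 2) ℂ) :
    (∃ a : ℂ, M = a • 1) ∨ ∃ a b : ℂ, Similar M !![a, 1; 0, b] := by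
  by_cases h : ∃ v : Fin 2 → ℂ, v 0 * (M 1 0 * v 0 + M 1 1 * v 1)
      - v 1 * (M 0 0 * v 0 + M 0 1 * v 1) ≠ 0
  · obtain ⟨v, hv⟩ := h
    obtain ⟨a, b, hab, hab'⟩ := exists_factorization_two M
    refine .inr ⟨a, b, !![M 0 0 * v 0 + M 0 1 * v 1 - b * v 0, v 0;
      M 1 0 * v 0 + M 1 1 * v 1 - b * v 1, v 1], ?_, ?_⟩
    · rw [det_fin_two_of]
      intro h
      exact hv (by linear_combination -h)
    · ext i j
      fin_cases i <;> fin_cases j <;> simp [Matrix.mul_apply, Fin.sum_univ_two]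
      · linear_combination -(M 0 0 * v 0 + M 0 1 * v 1) * hab + v 0 * hab'
      · ring
      · linear_combination -(M 1 0 * v 0 + M 1 1 * v 1) * hab + v 1 * hab'
      · ring
  · push Not at h
    have h1 := h ![1, 0]
    have h2 := h ![0, 1]
    have h3 := h ![1, 1]
    simp at h1 h2 h3
    refine .inl ⟨M 0 0, ?_⟩
    ext i j
    fin_cases i <;> fin_cases j <;> simp [h1, h2]
    linear_combination h3 - h1 + h2

/-- A matrix with a cyclic vector is similar to a bidiagonal matrix. -/
theorem exists_similar_of_cyclic {A : Matrix (Fin 3) (Fin 3) ℂ} (v : Fin 3 → ℂ)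
    (h : (Matrix.of ![v, A *ᵥ v, A *ᵥ A *ᵥ v]).det ≠ 0) :
    ∃ a b c : ℂ, Similar A !![a, 1, 0; 0, b, 1; 0, 0, c] := by
  obtain ⟨a, b, c, hA⟩ := exists_charpoly_factorization_three A
  -- The basis is `(A - b)(A - c) v`, `(A - c) v`, `v`. Cayley–Hamilton makes its first vector an
  -- eigenvector for `a`.
  set f₂ := A *ᵥ v - c • v with hf₂
  set f₁ := A *ᵥ f₂ - b • f₂ with hf₁
  have h₁ : A *ᵥ f₁ = a • f₁ := by
    have h0 := congrArg (fun B : Matrix (Fin 3) (Fin 3) ℂ => B *ᵥ v) hA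
    simp only [← mulVec_mulVec, sub_mulVec, smul_mulVec, one_mulVec, zero_mulVec] at h0
    exact sub_eq_zero.mp h0
  have h₂ : A *ᵥ f₂ = f₁ + b • f₂ := by rw [hf₁]; abel
  have h₃ : A *ᵥ v = f₂ + c • v := by rw [hf₂]; abel
  refine ⟨a, b, c, (Matrix.of ![f₁, f₂, v])ᵀ, ?_, ?_⟩
  · rw [det_transpose]
    intro h0
    apply h
    have hu : Matrix.of ![v, A *ᵥ v, A *ᵥ A *ᵥ v]
        = !![0, 0, 1; 0, 1, c; 1, b + c, c ^ 2] * Matrix.of ![f₁, f₂, v] := by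
      have h₄ : A *ᵥ A *ᵥ v = f₁ + (b + c) • f₂ + c ^ 2 • v := by
        rw [h₃, mulVec_add, mulVec_smul, h₂, h₃]; module
      rw [h₄, h₃]
      ext i j
      fin_cases i <;> simp [Matrix.mul_apply, Fin.sum_univ_three]
    rw [hu, det_mul, h0, mul_zero]
  · ext i j
    have e₁ := congrFun h₁ i
    have e₂ := congrFun h₂ i
    have e₃ := congrFun h₃ i
    simp only [mulVec, dotProduct, Fin.sum_univ_three, Pi.add_apply, Pi.smul_apply,
      smul_eq_mul] at e₁ e₂ e₃
    fin_cases j <;> simp [Matrix.mul_apply, Fin.sum_univ_three]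
    · linear_combination e₁
    · linear_combination e₂
    · linear_combination e₃

/-- The vectors `(0, t, 1)` are tested for cyclicity. The determinant is, up to sign, the product of
two affine functions of `t` below, so if none of these vectors is cyclic, one factor vanishes
identically. -/
theorem exists_similar_of_invariant_plane (a b k p q : ℂ) :
    (∃ v : Fin 3 → ℂ, (Matrix.of ![v, !![a, 1, p; 0, b, q; 0, 0, k] *ᵥ v,
      !![a, 1, p; 0, b, q; 0, 0, k] *ᵥ !![a, 1, p; 0, b, q; 0, 0, k] *ᵥ v]).det ≠ 0) ∨
    ∃ c e : ℂ, Similar !![a, 1, p; 0, b, q; 0, 0, k] !![c, 0, 0; 0, c, 1; 0, 0, e] := by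
  by_cases h : ∃ t : ℂ, (q + t * (b - k)) * ((b - a) * (p + t) - q - t * (b - k)) ≠ 0
  · obtain ⟨t, ht⟩ := h
    refine .inl ⟨![0, t, 1], fun h => ht ?_⟩
    have e₁ : !![a, 1, p; 0, b, q; 0, 0, k] *ᵥ ![0, t, 1] = ![t + p, b * t + q, k] := by
      ext i; fin_cases i <;> simp [mulVec, dotProduct, Fin.sum_univ_three]
    have e₂ : !![a, 1, p; 0, b, q; 0, 0, k] *ᵥ ![t + p, b * t + q, k]
        = ![a * (t + p) + (b * t + q) + p * k, b * (b * t + q) + q * k, k * k] := by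
      ext i; fin_cases i <;> simp [mulVec, dotProduct, Fin.sum_univ_three, add_assoc]
    rw [e₁, e₂] at h
    simp [det_fin_three] at h
    linear_combination h
  · push Not at h
    right
    -- A polynomial of degree at most two with the three zeros `0, 1, -1` vanishes, and so does one
    -- of its affine factors.
    have h0 := h 0
    have h1 := h 1
    have h2 := h (-1)
    have : (q = 0 ∧ k = b) ∨ (k = a ∧ q = (b - a) * p) := by grind
    rcases this with ⟨rfl, rfl⟩ | ⟨rfl, rfl⟩
    · refine ⟨k, a, !![0, 1, 0; -p, k - a, 1; 1, 0, 0], ?_, ?_⟩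
      · simp [det_fin_three]
      · ext i j
        fin_cases i <;> fin_cases j <;> simp [Matrix.mul_apply, Fin.sum_univ_three] <;> ring
    · refine ⟨k, b, !![0, 1, 0; -p, 0, 1; 1, 0, 0], ?_, ?_⟩
      · simp [det_fin_three]
      · ext i j
        fin_cases i <;> fin_cases j <;> simp [Matrix.mul_apply, Fin.sum_univ_three] <;> ring

theorem det_conjugate_cyclic {A B P : Matrix (Fin 3) (Fin 3) ℂ} (h : A * P = P * B)
    (v : Fin 3 → ℂ) : (Matrix.of ![P *ᵥ v, A *ᵥ P *ᵥ v, A *ᵥ A *ᵥ P *ᵥ v]).det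
      = (Matrix.of ![v, B *ᵥ v, B *ᵥ B *ᵥ v]).det * P.det := by
  have h1 : ∀ w, A *ᵥ P *ᵥ w = P *ᵥ B *ᵥ w := fun w => by
    rw [mulVec_mulVec, h, ← mulVec_mulVec]
  rw [h1, h1, ← det_transpose P, ← det_mul]
  congr 1
  ext i j
  have hrow : ∀ w, (P *ᵥ w) j = ∑ k, w k * Pᵀ k j := fun w => by
    simp only [mulVec, dotProduct, transpose_apply, mul_comm]
  rw [Matrix.mul_apply]
  fin_cases i
  · exact hrow v
  · exact hrow (B *ᵥ v)
  · exact hrow (B *ᵥ B *ᵥ v)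

theorem exists_completion {u v : Fin 3 → ℂ} (h : u 0 * v 1 - u 1 * v 0 ≠ 0 ∨
    u 0 * v 2 - u 2 * v 0 ≠ 0 ∨ u 1 * v 2 - u 2 * v 1 ≠ 0) :
    ∃ w, (Matrix.of ![u, v, w]).det ≠ 0 := by
  rcases h with h | h | h
  · exact ⟨![0, 0, 1], by simpa [det_fin_three] using h⟩
  · refine ⟨![0, 1, 0], fun h' => h ?_⟩
    simp [det_fin_three] at h'
    linear_combination -h'
  · refine ⟨![1, 0, 0], fun h' => h ?_⟩
    simp [det_fin_three] at h'
    linear_combination h'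

/-- The three forms correspond to minimal polynomials of degree 1, 3 and 2. Degree 3 is detected by
a cyclic vector, degree 1 by every vector being an eigenvector. -/
theorem normal_form_three (A : Matrix (Fin 3) (Fin 3) ℂ) :
    (∃ a : ℂ, A = a • 1) ∨ (∃ a b c : ℂ, Similar A !![a, 1, 0; 0, b, 1; 0, 0, c]) ∨
      ∃ a b : ℂ, Similar A !![a, 0, 0; 0, a, 1; 0, 0, b] := by
  by_cases hc : ∃ v : Fin 3 → ℂ, (Matrix.of ![v, A *ᵥ v, A *ᵥ A *ᵥ v]).det ≠ 0
  · obtain ⟨v, hv⟩ := hc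
    exact .inr (.inl (exists_similar_of_cyclic v hv))
  push Not at hc
  by_cases hs : ∃ v w : Fin 3 → ℂ, (Matrix.of ![v, A *ᵥ v, w]).det ≠ 0
  · obtain ⟨v, w, hdet⟩ := hs
    right; right
    set P := (Matrix.of ![v, A *ᵥ v, w])ᵀ with hP
    have hPdet : P.det ≠ 0 := by rw [hP, det_transpose]; exact hdet
    have hPu : IsUnit P.det := isUnit_iff_ne_zero.mpr hPdet
    set B := P⁻¹ * A * P with hB
    have hAP : A * P = P * B := by
      rw [hB, Matrix.mul_assoc, ← Matrix.mul_assoc, Matrix.mul_nonsing_inv _ hPu, Matrix.one_mul]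
    have hv : P *ᵥ ![1, 0, 0] = v := by
      ext i; simp [hP, mulVec, dotProduct, Fin.sum_univ_three]
    have hAv : P *ᵥ ![0, 1, 0] = A *ᵥ v := by
      ext i; simp [hP, mulVec, dotProduct, Fin.sum_univ_three]
    have hcol : B *ᵥ ![1, 0, 0] = ![0, 1, 0] := by
      have : P *ᵥ (B *ᵥ ![1, 0, 0]) = P *ᵥ ![0, 1, 0] := by
        rw [mulVec_mulVec, ← hAP, ← mulVec_mulVec, hv, hAv]
      exact (mulVec_injective_iff_isUnit.mpr ((isUnit_iff_isUnit_det P).mpr hPu)) this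
    have h00 : B 0 0 = 0 := by
      simpa [mulVec, dotProduct, Fin.sum_univ_three] using congrFun hcol 0
    have h10 : B 1 0 = 1 := by
      simpa [mulVec, dotProduct, Fin.sum_univ_three] using congrFun hcol 1
    have h20 : B 2 0 = 0 := by
      simpa [mulVec, dotProduct, Fin.sum_univ_three] using congrFun hcol 2
    have hcB : ∀ u, (Matrix.of ![u, B *ᵥ u, B *ᵥ B *ᵥ u]).det = 0 := fun u => by
      have := det_conjugate_cyclic hAP u
      rw [hc] at this
      exact (mul_eq_zero.mp this.symm).resolve_right hPdet
    -- The plane of `v` and `A v` is invariant, since otherwise `v` would be cyclic.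
    have h21 : B 2 1 = 0 := by
      have := hcB ![1, 0, 0]
      rw [hcol] at this
      simpa [det_fin_three, mulVec, dotProduct, Fin.sum_univ_three] using this
    -- `a` and `b` are the eigenvalues on the invariant plane, and `(B - b) e₁, e₁` is a basis
    -- making that block upper triangular.
    obtain ⟨a, b, hab, hab'⟩ := exists_factorization_two !![0, B 0 1; 1, B 1 1]
    simp at hab hab'
    set C : Matrix (Fin 3) (Fin 3) ℂ := !![a, 1, B 1 2; 0, b, B 0 2 + b * B 1 2; 0, 0, B 2 2]
      with hC
    have hBC : B * !![-b, 1, 0; 1, 0, 0; 0, 0, 1] = !![-b, 1, 0; 1, 0, 0; 0, 0, 1] * C := by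
      ext i j
      fin_cases i <;> fin_cases j <;>
        simp [hC, Matrix.mul_apply, Fin.sum_univ_three, h00, h10, h20, h21]
      · linear_combination hab'
      · linear_combination -hab
    have hR : (!![-b, 1, 0; 1, 0, 0; 0, 0, 1] : Matrix (Fin 3) (Fin 3) ℂ).det ≠ 0 := by
      simp [det_fin_three]
    have hAB : Similar A B := ⟨P, hPdet, hAP⟩
    have hBCs : Similar B C := ⟨_, hR, hBC⟩
    rcases exists_similar_of_invariant_plane a b (B 2 2) (B 1 2) (B 0 2 + b * B 1 2)
      with ⟨u, hu⟩ | ⟨c, e, h⟩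
    · refine (hu ?_).elim
      have := det_conjugate_cyclic hBC u
      rw [hcB] at this
      exact (mul_eq_zero.mp this.symm).resolve_right hR
    · exact ⟨c, e, (hAB.trans hBCs).trans h⟩
  · push Not at hs
    left
    have key : ∀ v : Fin 3 → ℂ, v 0 * (A *ᵥ v) 1 - v 1 * (A *ᵥ v) 0 = 0 ∧
        v 0 * (A *ᵥ v) 2 - v 2 * (A *ᵥ v) 0 = 0 ∧ v 1 * (A *ᵥ v) 2 - v 2 * (A *ᵥ v) 1 = 0 := by
      intro v
      by_contra h
      obtain ⟨w, hw⟩ := exists_completion (u := v) (v := A *ᵥ v) (by tauto)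
      exact hw (hs v w)
    have k0 := key ![1, 0, 0]
    have k1 := key ![0, 1, 0]
    have k2 := key ![0, 0, 1]
    have k3 := key ![1, 1, 0]
    have k4 := key ![1, 0, 1]
    simp [mulVec, dotProduct, Fin.sum_univ_three] at k0 k1 k2 k3 k4
    refine ⟨A 0 0, ?_⟩
    ext i j
    fin_cases i <;> fin_cases j <;> simp <;> grind

/-! Algebras with an abelian or Heisenberg ideal of codimension one. -/

/-- The extension of the abelian algebra `ℂ³` by the derivation `A`. -/
noncomputable def abelExt (A : Matrix (Fin 3) (Fin 3) ℂ) : StructConst :=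
  A 0 0 • psi 1 4 1 + A 1 0 • psi 1 4 2 + A 2 0 • psi 1 4 3 +
  A 0 1 • psi 2 4 1 + A 1 1 • psi 2 4 2 + A 2 1 • psi 2 4 3 +
  A 0 2 • psi 3 4 1 + A 1 2 • psi 3 4 2 + A 2 2 • psi 3 4 3

/-- The extension of the Heisenberg algebra by the derivation inducing `M` on the abelian
quotient. -/
noncomputable def heisExt (M : Matrix (Fin 2) (Fin 2) ℂ) : StructConst :=
  psi 2 3 1 + (M 0 0 + M 1 1) • psi 1 4 1 +
  M 0 0 • psi 2 4 2 + M 1 0 • psi 2 4 3 + M 0 1 • psi 3 4 2 + M 1 1 • psi 3 4 3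

theorem bracket_abelExt (A : Matrix (Fin 3) (Fin 3) ℂ) (x y : V) : bracket (abelExt A) x y =
    ![A 0 0 * (x 0 * y 3 - x 3 * y 0) + A 0 1 * (x 1 * y 3 - x 3 * y 1)
        + A 0 2 * (x 2 * y 3 - x 3 * y 2),
      A 1 0 * (x 0 * y 3 - x 3 * y 0) + A 1 1 * (x 1 * y 3 - x 3 * y 1)
        + A 1 2 * (x 2 * y 3 - x 3 * y 2),
      A 2 0 * (x 0 * y 3 - x 3 * y 0) + A 2 1 * (x 1 * y 3 - x 3 * y 1)
        + A 2 2 * (x 2 * y 3 - x 3 * y 2), 0] := by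
  ext k
  fin_cases k <;> simp [bracket, Fin.sum_univ_four, abelExt, psi] <;> ring

theorem bracket_heisExt (M : Matrix (Fin 2) (Fin 2) ℂ) (x y : V) : bracket (heisExt M) x y =
    ![(x 1 * y 2 - x 2 * y 1) + (M 0 0 + M 1 1) * (x 0 * y 3 - x 3 * y 0),
      M 0 0 * (x 1 * y 3 - x 3 * y 1) + M 0 1 * (x 2 * y 3 - x 3 * y 2),
      M 1 0 * (x 1 * y 3 - x 3 * y 1) + M 1 1 * (x 2 * y 3 - x 3 * y 2), 0] := by
  ext k
  fin_cases k <;> simp [bracket, Fin.sum_univ_four, heisExt, psi] <;> ring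

theorem isLie_abelExt (A : Matrix (Fin 3) (Fin 3) ℂ) : IsLie (abelExt A) := by
  constructor
  · intro x; ext k; fin_cases k <;> simp [bracket_abelExt, mul_comm]
  · intro x y z; ext k; fin_cases k <;> simp [bracket_abelExt] <;> ring

theorem isLie_heisExt (M : Matrix (Fin 2) (Fin 2) ℂ) : IsLie (heisExt M) := by
  constructor
  · intro x; ext k; fin_cases k <;> simp [bracket_heisExt, mul_comm]
  · intro x y z; ext k; fin_cases k <;> simp [bracket_heisExt] <;> ring

theorem Similar.abelExt {A B : Matrix (Fin 3) (Fin 3) ℂ} (h : Similar A B) :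
    Equivalent (abelExt A) (abelExt B) := by
  obtain ⟨P, hP, h⟩ := h
  have e : ∀ i j, A i 0 * P 0 j + A i 1 * P 1 j + A i 2 * P 2 j
      = P i 0 * B 0 j + P i 1 * B 1 j + P i 2 * B 2 j := fun i j => by
    simpa [Matrix.mul_apply, Fin.sum_univ_three] using congrFun (congrFun h i) j
  refine equivalent_iff_matrix.mpr ⟨!![P 0 0, P 0 1, P 0 2, 0; P 1 0, P 1 1, P 1 2, 0;
    P 2 0, P 2 1, P 2 2, 0; 0, 0, 0, 1], ?_, fun x y => ?_⟩
  · intro h0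
    apply hP
    simp [det_succ_row_zero, Fin.sum_univ_succ, Fin.succAbove] at h0
    rw [det_fin_three]
    linear_combination h0
  · ext k
    fin_cases k <;> simp [bracket_abelExt, mulVec, dotProduct, Fin.sum_univ_four]
    · linear_combination -(x 0 * y 3 - x 3 * y 0) * e 0 0 - (x 1 * y 3 - x 3 * y 1) * e 0 1
        - (x 2 * y 3 - x 3 * y 2) * e 0 2
    · linear_combination -(x 0 * y 3 - x 3 * y 0) * e 1 0 - (x 1 * y 3 - x 3 * y 1) * e 1 1
        - (x 2 * y 3 - x 3 * y 2) * e 1 2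
    · linear_combination -(x 0 * y 3 - x 3 * y 0) * e 2 0 - (x 1 * y 3 - x 3 * y 1) * e 2 1
        - (x 2 * y 3 - x 3 * y 2) * e 2 2

theorem Similar.trace_eq {n : ℕ} {A B : Matrix (Fin n) (Fin n) ℂ} (h : Similar A B) :
    A.trace = B.trace := by
  obtain ⟨P, hP, h⟩ := h
  have hu := isUnit_iff_ne_zero.mpr hP
  have : A = P * B * P⁻¹ := by rw [← h, Matrix.mul_assoc, Matrix.mul_nonsing_inv _ hu, Matrix.mul_one]
  rw [this, trace_mul_comm, ← Matrix.mul_assoc, Matrix.nonsing_inv_mul _ hu, Matrix.one_mul]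

theorem Similar.heisExt {A B : Matrix (Fin 2) (Fin 2) ℂ} (h : Similar A B) :
    Equivalent (heisExt A) (heisExt B) := by
  have ht := h.trace_eq
  simp only [trace_fin_two] at ht
  obtain ⟨P, hP, h⟩ := h
  have e : ∀ i j, A i 0 * P 0 j + A i 1 * P 1 j = P i 0 * B 0 j + P i 1 * B 1 j := fun i j => by
    simpa [Matrix.mul_apply, Fin.sum_univ_two] using congrFun (congrFun h i) j
  -- The centre is spanned by the bracket of two lifts from the quotient, so it is scaled by `det
  -- P`.
  refine equivalent_iff_matrix.mpr ⟨!![P 0 0 * P 1 1 - P 0 1 * P 1 0, 0, 0, 0;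
    0, P 0 0, P 0 1, 0; 0, P 1 0, P 1 1, 0; 0, 0, 0, 1], ?_, fun x y => ?_⟩
  · rw [det_fin_two] at hP
    simp [det_succ_row_zero, Fin.sum_univ_succ, Fin.succAbove]
    exact ⟨hP, fun h0 => hP (by linear_combination h0)⟩
  · ext k
    fin_cases k <;> simp [bracket_heisExt, mulVec, dotProduct, Fin.sum_univ_four]
    · linear_combination -(P 0 0 * P 1 1 - P 0 1 * P 1 0) * (x 0 * y 3 - x 3 * y 0) * ht
    · linear_combination -(x 1 * y 3 - x 3 * y 1) * e 0 0 - (x 2 * y 3 - x 3 * y 2) * e 0 1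
    · linear_combination -(x 1 * y 3 - x 3 * y 1) * e 1 0 - (x 2 * y 3 - x 3 * y 2) * e 1 1

/-- `d` is equivalent to a standard form or zero. -/
def IsClassified (d : StructConst) : Prop := ∃ x : Option Label, Equivalent d (pointForm x)

theorem IsClassified.of_equivalent {d d' : StructConst} (h : Equivalent d d')
    (h' : IsClassified d') : IsClassified d := by
  obtain ⟨x, hx⟩ := h'
  exact ⟨x, h.trans hx⟩

theorem isClassified_bigFamily (p : Fin 3 → ℂ) : IsClassified (bigFamily p) := by
  by_cases hp : p = 0
  · subst hp
    refine ⟨some .twoStar, ?_⟩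
    have : bigFamily 0 = dTwoStar := by simp [bigFamily, dTwoStar]
    rw [this]
    exact .refl _
  · exact ⟨some (.big p hp), .refl _⟩

theorem isClassified_smallFamily (p : Fin 2 → ℂ) : IsClassified (smallFamily p) := by
  by_cases hp : p = 0
  · subst hp
    exact ⟨some .one, equivalent_dOne_smallFamily_zero.symm⟩
  · exact ⟨some (.small p hp), .refl _⟩

theorem isClassified_heisFamily (p : Fin 2 → ℂ) : IsClassified (heisFamily p) := by
  by_cases hp : p = 0
  · subst hp
    -- At zero parameters the brackets `[e₂, e₃] = e₁` and `[e₃, e₄] = e₂` remain. This is `n₄` with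
    -- `e₃` and `e₄` exchanged, up to signs.
    refine ⟨some .twoStar, equivalent_iff_matrix.mpr ⟨!![-1, 0, 0, 0; 0, -1, 0, 0; 0, 0, 0, 1;
      0, 0, 1, 0], ?_, fun x y => ?_⟩⟩
    · simp [det_succ_row_zero, Fin.sum_univ_succ, Fin.succAbove]
    · ext k
      fin_cases k <;> simp [pointForm, Label.form, bracket_heisFamily, bracket_dTwoStar, mulVec,
        dotProduct, Fin.sum_univ_four]
      ring
  · exact ⟨some (.heis p hp), .refl _⟩

theorem isClassified_abelExt (A : Matrix (Fin 3) (Fin 3) ℂ) : IsClassified (abelExt A) := by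
  rcases normal_form_three A with ⟨a, rfl⟩ | ⟨a, b, c, h⟩ | ⟨a, b, h⟩
  · by_cases ha : a = 0
    · subst ha
      exact ⟨none, by simp [abelExt, pointForm, Equivalent.refl]⟩
    · refine ⟨some .threeStar, equivalent_iff_matrix.mpr ⟨!![1, 0, 0, 0; 0, 1, 0, 0; 0, 0, 1, 0;
        0, 0, 0, a⁻¹], ?_, fun x y => ?_⟩⟩
      · simp [det_succ_row_zero, Fin.sum_univ_succ, Fin.succAbove, ha]
      · ext k
        fin_cases k <;> simp [pointForm, Label.form, bracket_abelExt, bracket_dThreeStar, mulVec,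
          dotProduct, Fin.sum_univ_four] <;> field_simp
  · refine .of_equivalent h.abelExt ?_
    convert isClassified_bigFamily ![a, b, c] using 1
    refine bracket_injective fun x y => ?_
    simp [bracket_abelExt, bracket_bigFamily]
  · refine .of_equivalent h.abelExt ?_
    convert isClassified_smallFamily ![a, b] using 1
    refine bracket_injective fun x y => ?_
    simp [bracket_abelExt, bracket_smallFamily]

theorem isClassified_heisExt (M : Matrix (Fin 2) (Fin 2) ℂ) : IsClassified (heisExt M) := by
  rcases eq_smul_one_or_exists_two M with ⟨a, rfl⟩ | ⟨a, b, h⟩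
  · by_cases ha : a = 0
    · subst ha
      refine ⟨some .one, equivalent_iff_matrix.mpr ⟨!![1, 0, 0, 0; 0, 1, 0, 0; 0, 0, 0, 1;
        0, 0, 1, 0], ?_, fun x y => ?_⟩⟩
      · simp [det_succ_row_zero, Fin.sum_univ_succ, Fin.succAbove]
      · ext k
        fin_cases k <;> simp [pointForm, Label.form, bracket_heisExt, bracket_dOne, mulVec,
          dotProduct, Fin.sum_univ_four]
    · refine ⟨some .oneSharp, equivalent_iff_matrix.mpr ⟨!![1, 0, 0, 0; 0, 1, 0, 0; 0, 0, 1, 0;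
        0, 0, 0, a⁻¹], ?_, fun x y => ?_⟩⟩
      · simp [det_succ_row_zero, Fin.sum_univ_succ, Fin.succAbove, ha]
      · ext k
        fin_cases k <;> simp [pointForm, Label.form, bracket_heisExt, bracket_dOneSharp, mulVec,
          dotProduct, Fin.sum_univ_four] <;> field_simp
        ring
  · refine .of_equivalent h.heisExt ?_
    convert isClassified_heisFamily ![a, b] using 1
    refine bracket_injective fun x y => ?_
    simp [bracket_heisExt, bracket_heisFamily]

/-! A hyperplane containing the derived algebra on which the adjoint trace vanishes. -/

theorem IsLie.leibniz {d : StructConst} (h : IsLie d) (x y z : V) :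
    bracket d x (bracket d y z) = bracket d (bracket d x y) z + bracket d y (bracket d x z) := by
  have := h.2 x y z
  rw [h.skew x (bracket d y z), h.skew y (bracket d z x), h.skew x z, ← bracketHom_apply d y (-_),
    map_neg, neg_neg, bracketHom_apply] at this
  linear_combination (exp := 1) -this

/-- The trace of the adjoint action. -/
noncomputable def adTrace (d : StructConst) : V →ₗ[ℂ] ℂ := LinearMap.trace ℂ V ∘ₗ bracketHom d

theorem adTrace_bracket {d : StructConst} (h : IsLie d) (x y : V) :
    adTrace d (bracket d x y) = 0 := by
  have : bracketHom d (bracket d x y) = bracketHom d x * bracketHom d y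
      - bracketHom d y * bracketHom d x := by
    refine LinearMap.ext fun z => ?_
    simp [h.leibniz x y z]
  rw [adTrace, LinearMap.comp_apply, this, map_sub, LinearMap.trace_mul_comm, sub_self]

theorem adTrace_single (d : StructConst) (i : Fin 4) :
    adTrace d (Pi.single i 1) = ∑ k, d i k k := by
  rw [adTrace, LinearMap.comp_apply, LinearMap.trace_eq_matrix_trace ℂ (Pi.basisFun ℂ (Fin 4)),
    Matrix.trace]
  simp [bracket_single]

theorem IsLie.jacobi_const {d : StructConst} (h : IsLie d) (i j k l : Fin 4) :
    ∑ m, (d i j m * d m k l + d j k m * d m i l + d k i m * d m j l) = 0 := by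
  have := congrFun (h.2 (Pi.single i 1) (Pi.single j 1) (Pi.single k 1)) l
  simp only [bracket_single, Pi.add_apply, Pi.zero_apply] at this
  have hb : ∀ (u : V) (k : Fin 4), bracket d u (Pi.single k 1) l = ∑ m, u m * d m k l := by
    intro u k
    simp [bracket, Pi.single_apply, mul_comm]
  rw [hb, hb, hb] at this
  rw [← this, Finset.sum_add_distrib, Finset.sum_add_distrib]

theorem IsLie.skew_const {d : StructConst} (h : IsLie d) (i j : Fin 4) : d j i = -d i j := by
  rw [← bracket_single d i j, ← bracket_single d j i, h.skew]

theorem IsLie.self_const {d : StructConst} (h : IsLie d) (i : Fin 4) : d i i = 0 := by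
  rw [← bracket_single d i i, h.1]

/-- In the unimodular case the 2-forms `f ∘ d` have zero square. -/
theorem isotropic_of_unimodular {d : StructConst} (h : IsLie d) (ht : adTrace d = 0)
    (F : Fin 4 → ℂ) : (∑ k, d 0 1 k * F k) * (∑ k, d 2 3 k * F k)
      - (∑ k, d 0 2 k * F k) * (∑ k, d 1 3 k * F k)
      + (∑ k, d 0 3 k * F k) * (∑ k, d 1 2 k * F k) = 0 := by
  have T : ∀ i, ∑ k, d i k k = 0 := fun i => by rw [← adTrace_single, ht]; rfl
  have J : ∀ i j k, ∑ l, F l *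
      ∑ m, (d i j m * d m k l + d j k m * d m i l + d k i m * d m j l) = 0 := fun i j k =>
    Finset.sum_eq_zero fun l _ => by rw [h.jacobi_const, mul_zero]
  have T0 := T 0
  have T1 := T 1
  have T2 := T 2
  have T3 := T 3
  have J0 := J 1 2 3
  have J1 := J 0 2 3
  have J2 := J 0 1 3
  have J3 := J 0 1 2
  simp only [Fin.sum_univ_four, h.self_const, h.skew_const 0 1, h.skew_const 0 2,
    h.skew_const 0 3, h.skew_const 1 2, h.skew_const 1 3, h.skew_const 2 3, Pi.neg_apply,
    Pi.zero_apply] at T0 T1 T2 T3 J0 J1 J2 J3 ⊢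
  generalize d 0 1 = c01 at *
  generalize d 0 2 = c02 at *
  generalize d 0 3 = c03 at *
  generalize d 1 2 = c12 at *
  generalize d 1 3 = c13 at *
  generalize d 2 3 = c23 at *
  let b : (Fin 4 → ℂ) → ℂ := fun c => c 0 * F 0 + c 1 * F 1 + c 2 * F 2 + c 3 * F 3
  -- In Chevalley–Eilenberg terms this is `df ∧ df = d(f ∧ df)` for `f = F`: the Jacobi terms
  -- express `d² f = 0`, and the trace terms the vanishing of the differential on 3-forms of a
  -- unimodular algebra.
  linear_combination (1 / 2 : ℂ) * (T0 * (F 1 * b c23 - F 2 * b c13 + F 3 * b c12)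
    - T1 * (F 0 * b c23 - F 2 * b c03 + F 3 * b c02)
    + T2 * (F 0 * b c13 - F 1 * b c03 + F 3 * b c01)
    - T3 * (F 0 * b c12 - F 1 * b c02 + F 2 * b c01)
    - (F 3 * J3 - F 2 * J2 + F 1 * J1 - F 0 * J0))

/-- A nonzero functional that vanishes on the derived algebra, and on whose kernel the adjoint
trace vanishes. -/
structure IsUnimodularFunctional (d : StructConst) (φ : V →ₗ[ℂ] ℂ) : Prop where
  ne_zero : φ ≠ 0
  bracket : ∀ x y, φ (bracket d x y) = 0
  trace : ∀ x, φ x = 0 → adTrace d x = 0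

/-- If the adjoint trace is nonzero it serves itself. Otherwise the forms `f ∘ d` make up a totally
isotropic subspace of the wedge form on the six-dimensional space of 2-forms. Such a subspace has
dimension at most 3, so some nonzero `f` has `f ∘ d = 0`. -/
theorem exists_isUnimodularFunctional {d : StructConst} (h : IsLie d) :
    ∃ φ, IsUnimodularFunctional d φ := by
  by_cases ht : adTrace d = 0
  · suffices ∃ g : Fin 4 → ℂ, g ≠ 0 ∧ ∀ i j, ∑ k, g k * d i j k = 0 by
      obtain ⟨g, hg, hgd⟩ := this
      refine ⟨∑ k, g k • LinearMap.proj k, fun h0 => hg ?_, fun x y => ?_, fun x _ => by simp [ht]⟩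
      · funext k
        simpa [Pi.single_apply] using LinearMap.congr_fun h0 (Pi.single k 1)
      · have : ∑ k, g k * bracket d x y k = ∑ i, ∑ j, (∑ k, g k * d i j k) * x i * y j := by
          simp only [FourDimLie.bracket, Finset.mul_sum, Finset.sum_mul]
          rw [Finset.sum_comm]
          refine Finset.sum_congr rfl fun i _ => ?_
          rw [Finset.sum_comm]
          exact Finset.sum_congr rfl fun j _ => Finset.sum_congr rfl fun k _ => by ring
        simp [LinearMap.sum_apply, this, hgd]
    by_contra hno
    have hno : ∀ g : Fin 4 → ℂ, (∀ i j, i < j → ∑ k, g k * d i j k = 0) → g = 0 := by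
      intro g hg
      by_contra hg0
      refine hno ⟨g, hg0, fun i j => ?_⟩
      rcases lt_trichotomy i j with hij | rfl | hij
      · exact hg i j hij
      · simp [h.self_const]
      · simpa [h.skew_const j i] using hg j i hij
    set M : Matrix (Fin 4) (Fin 6) ℂ := Matrix.of fun k =>
      ![d 0 1 k, d 0 2 k, d 0 3 k, d 1 2 k, d 1 3 k, d 2 3 k] with hM
    set N : Matrix (Fin 4) (Fin 6) ℂ := Matrix.of fun k =>
      ![d 2 3 k, -d 1 3 k, d 1 2 k, d 0 3 k, -d 0 2 k, d 0 1 k] with hN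
    -- The rows of `N` are the Hodge duals of those of `M`, so these entries are the polarization of
    -- the quadratic form.
    have hMN : M * Nᵀ = 0 := by
      ext k l
      have q := isotropic_of_unimodular h ht
      have h1 := q (Pi.single k 1)
      have h2 := q (Pi.single l 1)
      have h3 := q (Pi.single k 1 + Pi.single l 1)
      simp only [Pi.add_apply, mul_add, Finset.sum_add_distrib] at h3
      simp [Pi.single_apply] at h1 h2 h3
      simp [hM, hN, Matrix.mul_apply, Fin.sum_univ_six]
      linear_combination h3 - h1 - h2
    have hMr : LinearIndependent ℂ M.row := by
      rw [Fintype.linearIndependent_iff]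
      intro g hg
      have := hno g (fun i j hij => ?_)
      · intro i; rw [this]; rfl
      have e := fun a => congrFun hg a
      simp [hM, Finset.sum_apply, Matrix.row] at e
      fin_cases i <;> fin_cases j <;> first | exact absurd hij (by decide) | skip
      · exact e 0
      · exact e 1
      · exact e 2
      · exact e 3
      · exact e 4
      · exact e 5
    have hNr : LinearIndependent ℂ N.row := by
      rw [Fintype.linearIndependent_iff]
      intro g hg
      have := hno g (fun i j hij => ?_)
      · intro i; rw [this]; rfl
      have e := fun a => congrFun hg a
      simp [hN, Finset.sum_apply, Matrix.row] at e
      fin_cases i <;> fin_cases j <;> first | exact absurd hij (by decide) | skip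
      · exact e 5
      · simpa using e 4
      · exact e 3
      · exact e 2
      · simpa using e 1
      · exact e 0
    -- Both matrices would have rank 4, but the ranks add up to at most 6.
    have hr := Matrix.rank_add_rank_le_card_of_mul_eq_zero hMN
    rw [rank_transpose, hMr.rank_matrix, hNr.rank_matrix] at hr
    simp at hr
  · exact ⟨adTrace d, ht, fun x y => adTrace_bracket h x y, fun x hx => hx⟩

/-! Adapted bases. -/

theorem linearIndependent_four {φ : V →ₗ[ℂ] ℂ} {a b c x : V} (ha : φ a = 0) (hb : φ b = 0)
    (hc : φ c = 0) (hx : φ x = 1)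
    (h : ∀ α β γ : ℂ, α • a + β • b + γ • c = 0 → α = 0 ∧ β = 0 ∧ γ = 0) :
    LinearIndependent ℂ ![a, b, c, x] := by
  rw [Fintype.linearIndependent_iff]
  intro g hg
  simp [Fin.sum_univ_four] at hg
  have h3 : g 3 = 0 := by simpa [ha, hb, hc, hx] using congrArg φ hg
  rw [h3, zero_smul, add_zero] at hg
  obtain ⟨h0, h1, h2⟩ := h _ _ _ hg
  intro i
  fin_cases i <;> assumption

theorem exists_coordinates {φ : V →ₗ[ℂ] ℂ} {a b c x : V} (ha : φ a = 0) (hb : φ b = 0)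
    (hc : φ c = 0) (hx : φ x = 1) (hi : LinearIndependent ℂ ![a, b, c, x]) {v : V} (hv : φ v = 0) :
    ∃ α β γ : ℂ, v = α • a + β • b + γ • c := by
  have hs := hi.span_eq_top_of_card_eq_finrank' (by simp)
  have : v ∈ Submodule.span ℂ (Set.range ![a, b, c, x]) := hs ▸ Submodule.mem_top
  obtain ⟨g, hg⟩ := (Submodule.mem_span_range_iff_exists_fun ℂ).mp this
  simp [Fin.sum_univ_four] at hg
  have h3 : g 3 = 0 := by simpa [ha, hb, hc, hx, hv] using congrArg φ hg
  exact ⟨g 0, g 1, g 2, by rw [← hg, h3]; simp⟩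

theorem coordinates_unique {a b c x : V} (hi : LinearIndependent ℂ ![a, b, c, x])
    {α β γ : ℂ} (h : α • a + β • b + γ • c = 0) : α = 0 ∧ β = 0 ∧ γ = 0 := by
  rw [Fintype.linearIndependent_iff] at hi
  have := hi ![α, β, γ, 0] (by simpa [Fin.sum_univ_four] using h)
  exact ⟨this 0, this 1, this 2⟩

theorem trace_of_basis {f : V →ₗ[ℂ] V} {b : Fin 4 → V} (hb : LinearIndependent ℂ b)
    (m : Matrix (Fin 4) (Fin 4) ℂ) (h : ∀ j, f (b j) = ∑ k, m k j • b k) :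
    LinearMap.trace ℂ V f = ∑ j, m j j := by
  let B : Module.Basis (Fin 4) ℂ V := basisOfLinearIndependentOfCardEqFinrank hb (by simp)
  have hB : ⇑B = b := by simp [B]
  rw [LinearMap.trace_eq_matrix_trace ℂ B, Matrix.trace]
  refine Finset.sum_congr rfl fun j _ => ?_
  rw [Matrix.diag_apply, LinearMap.toMatrix_apply, hB, h, ← hB]
  simp [Finsupp.single_apply]

theorem finrank_ker {φ : V →ₗ[ℂ] ℂ} (hφ : φ ≠ 0) : Module.finrank ℂ φ.ker = 3 := by
  have h1 := LinearMap.finrank_range_add_finrank_ker φ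
  have h2 : Module.finrank ℂ φ.range = 1 := by
    rw [LinearMap.range_eq_top.mpr (LinearMap.surjective hφ)]; simp
  simp [h2] at h1
  omega

/-- The kernel has dimension 3, so it is not contained in the span of `a` and `b`. -/
theorem exists_third {φ : V →ₗ[ℂ] ℂ} (hφ : φ ≠ 0) {a b : V}
    (h : ∀ α β : ℂ, α • a + β • b = 0 → α = 0 ∧ β = 0) :
    ∃ c, φ c = 0 ∧ ∀ α β γ : ℂ, α • a + β • b + γ • c = 0 → α = 0 ∧ β = 0 ∧ γ = 0 := by
  have hex : ∃ c, φ c = 0 ∧ c ∉ Submodule.span ℂ {a, b} := by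
    by_contra! hc
    have hle : φ.ker ≤ Submodule.span ℂ {a, b} := fun c hc' => hc c hc'
    have h1 := Submodule.finrank_mono hle
    rw [finrank_ker hφ] at h1
    have h2 : Module.finrank ℂ (Submodule.span ℂ ({a, b} : Set V)) ≤ 2 := by
      have := finrank_span_finset_le_card (R := ℂ) ({a, b} : Finset V)
      simp only [Finset.coe_insert, Finset.coe_singleton] at this
      exact this.trans Finset.card_le_two
    omega
  obtain ⟨c, hc, hc'⟩ := hex
  refine ⟨c, hc, fun α β γ h0 => ?_⟩
  have hγ : γ = 0 := by
    by_contra hγ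
    apply hc'
    rw [Submodule.mem_span_pair]
    refine ⟨-(γ⁻¹ * α), -(γ⁻¹ * β), ?_⟩
    have : γ • c = -(α • a + β • b) := by rw [eq_neg_iff_add_eq_zero, ← h0]; abel
    rw [← inv_smul_smul₀ hγ c, this]
    module
  subst hγ
  simp only [zero_smul, add_zero] at h0
  exact ⟨(h _ _ h0).1, (h _ _ h0).2, rfl⟩

theorem equivalent_of_vectors {d d' : StructConst} (hd : IsLie d) (hd' : IsLie d') {a b c x : V}
    (hi : LinearIndependent ℂ ![a, b, c, x])
    (h01 : bracket d a b = d' 0 1 0 • a + d' 0 1 1 • b + d' 0 1 2 • c + d' 0 1 3 • x)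
    (h02 : bracket d a c = d' 0 2 0 • a + d' 0 2 1 • b + d' 0 2 2 • c + d' 0 2 3 • x)
    (h03 : bracket d a x = d' 0 3 0 • a + d' 0 3 1 • b + d' 0 3 2 • c + d' 0 3 3 • x)
    (h12 : bracket d b c = d' 1 2 0 • a + d' 1 2 1 • b + d' 1 2 2 • c + d' 1 2 3 • x)
    (h13 : bracket d b x = d' 1 3 0 • a + d' 1 3 1 • b + d' 1 3 2 • c + d' 1 3 3 • x)
    (h23 : bracket d c x = d' 2 3 0 • a + d' 2 3 1 • b + d' 2 3 2 • c + d' 2 3 3 • x) :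
    Equivalent d d' := by
  refine equivalent_of_basis_lt hd hd' _ hi fun i j hij => ?_
  rw [Fin.sum_univ_four]
  fin_cases i <;> fin_cases j <;> first | exact absurd hij (by decide) | assumption

/-! The classification. -/

theorem isClassified_of_abelian {d : StructConst} (hd : IsLie d) {φ : V →ₗ[ℂ] ℂ}
    (hφ : IsUnimodularFunctional d φ) {a b c x : V} (ha : φ a = 0) (hb : φ b = 0)
    (hc : φ c = 0) (hx : φ x = 1) (hi : LinearIndependent ℂ ![a, b, c, x])
    (hab : bracket d a b = 0) (hac : bracket d a c = 0) (hbc : bracket d b c = 0) :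
    IsClassified d := by
  obtain ⟨a0, a1, a2, hax⟩ := exists_coordinates ha hb hc hx hi (hφ.bracket a x)
  obtain ⟨b0, b1, b2, hbx⟩ := exists_coordinates ha hb hc hx hi (hφ.bracket b x)
  obtain ⟨c0, c1, c2, hcx⟩ := exists_coordinates ha hb hc hx hi (hφ.bracket c x)
  refine .of_equivalent ?_ (isClassified_abelExt !![a0, b0, c0; a1, b1, c1; a2, b2, c2])
  refine equivalent_of_vectors hd (isLie_abelExt _) hi ?_ ?_ ?_ ?_ ?_ ?_
  · simp [hab, abelExt, psi]
  · simp [hac, abelExt, psi]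
  · simp [hax, abelExt, psi]
  · simp [hbc, abelExt, psi]
  · simp [hbx, abelExt, psi]
  · simp [hcx, abelExt, psi]

/-- A derivation of the Heisenberg algebra acts on the centre by its trace on the quotient. Its
components from the quotient into the centre are inner and can be removed. -/
theorem isClassified_of_heisenberg {d : StructConst} (hd : IsLie d) {φ : V →ₗ[ℂ] ℂ}
    (hφ : IsUnimodularFunctional d φ) {z a b x : V} (hz : φ z = 0) (ha : φ a = 0) (hb : φ b = 0)
    (hx : φ x = 1) (hi : LinearIndependent ℂ ![z, a, b, x])
    (hza : bracket d z a = 0) (hzb : bracket d z b = 0) (hab : bracket d a b = z) :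
    IsClassified d := by
  obtain ⟨r, a1, a2, hax⟩ := exists_coordinates hz ha hb hx hi (hφ.bracket a x)
  obtain ⟨s, b1, b2, hbx⟩ := exists_coordinates hz ha hb hx hi (hφ.bracket b x)
  have hba : bracket d b a = -z := by rw [hd.skew, hab]
  have hzx : bracket d z x = (a1 + b2) • z := by
    have h1 := hd.leibniz x a b
    rw [hab, hd.skew z x, hd.skew a x, hd.skew b x, hax, hbx] at h1
    simp only [← bracketHom_apply, map_neg, map_add, map_smul, LinearMap.neg_apply,
      LinearMap.add_apply, LinearMap.smul_apply] at h1
    simp only [bracketHom_apply, hzb, hab, hd.1, hd.skew z a, hza] at h1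
    rw [← neg_inj, h1]
    module
  -- Subtracting `r b` cancels the `z`-component of `[a, x]`, and adding `s a` cancels that of `[b,
  -- x]`.
  have hx' : φ (x + s • a - r • b) = 1 := by simp [ha, hb, hx]
  have hi' : LinearIndependent ℂ ![z, a, b, x + s • a - r • b] :=
    linearIndependent_four hz ha hb hx' fun α β γ => coordinates_unique hi
  have e : ∀ w, bracket d w (x + s • a - r • b)
      = bracket d w x + s • bracket d w a - r • bracket d w b := fun w => by
    simp only [← bracketHom_apply, map_add, map_sub, map_smul]
  refine .of_equivalent ?_ (isClassified_heisExt !![a1, b1; a2, b2])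
  refine equivalent_of_vectors hd (isLie_heisExt _) hi' ?_ ?_ ?_ ?_ ?_ ?_
  · simp [hza, heisExt, psi]
  · simp [hzb, heisExt, psi]
  · simp [e, hzx, hza, hzb, heisExt, psi]
  · simp [hab, heisExt, psi]
  · simp [e, hax, hd.1, hab, heisExt, psi]
    module
  · simp [e, hbx, hd.1, hba, heisExt, psi]
    module

theorem adTrace_eq_of_vectors {d : StructConst} {φ : V →ₗ[ℂ] ℂ}
    (hφ : IsUnimodularFunctional d φ) {a b c x w : V} (ha : φ a = 0) (hb : φ b = 0)
    (hc : φ c = 0) (hx : φ x = 1) (hi : LinearIndependent ℂ ![a, b, c, x])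
    {α₀ α₁ α₂ β₀ β₁ β₂ γ₀ γ₁ γ₂ : ℂ}
    (h0 : bracket d w a = α₀ • a + α₁ • b + α₂ • c)
    (h1 : bracket d w b = β₀ • a + β₁ • b + β₂ • c)
    (h2 : bracket d w c = γ₀ • a + γ₁ • b + γ₂ • c) : adTrace d w = α₀ + β₁ + γ₂ := by
  obtain ⟨x0, x1, x2, h3⟩ := exists_coordinates ha hb hc hx hi (hφ.bracket w x)
  have := trace_of_basis (f := bracketHom d w) hi
    !![α₀, β₀, γ₀, x0; α₁, β₁, γ₁, x1; α₂, β₂, γ₂, x2; 0, 0, 0, 0] (fun j => ?_)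
  · rw [adTrace, LinearMap.comp_apply, this, Fin.sum_univ_four]
    simp
  · fin_cases j <;> simp [Fin.sum_univ_four, h0, h1, h2, h3]

/-- An element of the kernel with a nonzero eigenvalue. -/
theorem exists_toral_basis {d : StructConst} (hd : IsLie d) {φ : V →ₗ[ℂ] ℂ}
    (hφ : IsUnimodularFunctional d φ) {h u x : V} {a : ℂ} (hx : φ x = 1) (hh : φ h = 0)
    (ha : a ≠ 0) (hu0 : u ≠ 0) (hu : bracket d h u = a • u) :
    ∃ h v x : V, φ h = 0 ∧ φ u = 0 ∧ φ v = 0 ∧ φ x = 1 ∧ LinearIndependent ℂ ![h, u, v, x] ∧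
      bracket d h u = u ∧ bracket d h v = -v ∧ ∃ α : ℂ, bracket d h x = α • h := by
  have hφu : φ u = 0 := by
    have := hφ.bracket h u
    rw [hu, map_smul, smul_eq_mul] at this
    exact (mul_eq_zero.mp this).resolve_left ha
  have hhu : ∀ α β : ℂ, α • h + β • u = 0 → α = 0 ∧ β = 0 := by
    intro α β h0
    have h1 := congrArg (bracketHom d h) h0
    simp only [map_add, map_smul, bracketHom_apply, hd.1, hu, smul_zero, zero_add, map_zero,
      smul_smul] at h1
    have hβ : β = 0 := by
      have := (smul_eq_zero.mp h1).resolve_right hu0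
      exact (mul_eq_zero.mp this).resolve_right ha
    subst hβ
    simp only [zero_smul, add_zero] at h0
    refine ⟨(smul_eq_zero.mp h0).resolve_right ?_, rfl⟩
    rintro rfl
    have h2 : bracket d 0 u = 0 := LinearMap.map_zero₂ (bracketHom d) u
    rw [h2] at hu
    exact (smul_ne_zero ha hu0) hu.symm
  obtain ⟨w, hw, hi3⟩ := exists_third hφ.ne_zero hhu
  have hi := linearIndependent_four hh hφu hw hx hi3
  obtain ⟨p, q, r, hhw⟩ := exists_coordinates hh hφu hw hx hi (hφ.bracket h w)
  have htr := adTrace_eq_of_vectors hφ hh hφu hw hx hi (w := h) (α₀ := 0) (α₁ := 0) (α₂ := 0)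
    (β₀ := 0) (β₁ := a) (β₂ := 0) (by simp [hd.1]) (by simp [hu]) hhw
  rw [hφ.trace h hh] at htr
  -- The trace of `ad h` vanishes on the kernel and its eigenvalues there include `0` and `a`. The
  -- third one is therefore `-a`.
  have hr : r = -a := by linear_combination -htr
  subst hr
  obtain ⟨x0, x1, x2, hhx⟩ := exists_coordinates hh hφu hw hx hi (hφ.bracket h x)
  -- The coefficients divide by the differences `2a` and `a` between the eigenvalues of `u`, `h` and
  -- `-a`, so that `v` is an eigenvector.
  set v := w - (q / (2 * a)) • u - (p / a) • h with hv
  have hwv : w = v + (q / (2 * a)) • u + (p / a) • h := by rw [hv]; abel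
  have hhv : bracket d h v = -a • v := by
    rw [hv]
    simp only [← bracketHom_apply, map_sub, map_smul]
    simp only [bracketHom_apply, hhw, hu, hd.1]
    match_scalars <;> field_simp
    ring
  have hφv : φ v = 0 := by simp [hv, hw, hφu, hh]
  -- This modification of `x` removes the `u`- and `v`-components of `[h, x]`.
  have hx' : φ (x - (x1 / a + x2 * q / (2 * a ^ 2)) • u + (x2 / a) • v) = 1 := by
    simp [hx, hφu, hφv]
  refine ⟨a⁻¹ • h, v, x - (x1 / a + x2 * q / (2 * a ^ 2)) • u + (x2 / a) • v, by simp [hh], hφu,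
    hφv, hx', ?_, ?_, ?_, x0 + x2 * p / a, ?_⟩
  · refine linearIndependent_four (by simp [hh]) hφu hφv hx' fun α β γ h0 => ?_
    rw [hv] at h0
    have h1 := hi3 (α * a⁻¹ - γ * (p / a)) (β - γ * (q / (2 * a))) γ (by
      rw [← h0]; module)
    obtain ⟨k1, k2, rfl⟩ := h1
    refine ⟨?_, by simpa using k2, rfl⟩
    simpa [ha] using k1
  · rw [bracket_smul_left, hu, inv_smul_smul₀ ha]
  · rw [bracket_smul_left, hhv, neg_smul, smul_neg, inv_smul_smul₀ ha]
  · rw [bracket_smul_left]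
    simp only [← bracketHom_apply, map_sub, map_add, map_smul]
    simp only [bracketHom_apply, hhx, hu, hhv]
    rw [hwv]
    match_scalars <;> field_simp <;> ring

/-- The Jacobi identity for the weights `0, 1, -1` of `h` forces `[h, x] = 0`, `[u, v] = c h`, `[u,
x] = p u`, `[v, x] = q v` and `(p + q) c = 0`. The cases are `p + q = c = 0` (an abelian ideal), `p
+ q = 0 ≠ c` (`sl₂ ⊕ ℂ`) and `p + q ≠ 0` (`r₂ ⊕ r₂`). -/
theorem isClassified_of_toral {d : StructConst} (hd : IsLie d) {φ : V →ₗ[ℂ] ℂ}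
    (hφ : IsUnimodularFunctional d φ) {h u v x : V} (hh : φ h = 0) (hu : φ u = 0) (hv : φ v = 0)
    (hx : φ x = 1) (hi : LinearIndependent ℂ ![h, u, v, x]) (hhu : bracket d h u = u)
    (hhv : bracket d h v = -v) {α : ℂ} (hhx : bracket d h x = α • h) : IsClassified d := by
  have huh : bracket d u h = -u := by rw [hd.skew, hhu]
  have hvh : bracket d v h = v := by rw [hd.skew, hhv, neg_neg]
  obtain ⟨c, c1, c2, huv⟩ := exists_coordinates hh hu hv hx hi (hφ.bracket u v)
  obtain ⟨p0, p, p2, hux⟩ := exists_coordinates hh hu hv hx hi (hφ.bracket u x)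
  obtain ⟨q0, q1, q, hvx⟩ := exists_coordinates hh hu hv hx hi (hφ.bracket v x)
  have j1 := hd.leibniz h u v
  have j2 := hd.leibniz h u x
  have j3 := hd.leibniz h v x
  have j4 := hd.leibniz x u v
  rw [hhu, hhv, huv] at j1
  rw [hhu, hhx, hux] at j2
  rw [hhv, hhx, hvx] at j3
  simp only [← bracketHom_apply, map_neg, map_add, map_smul, LinearMap.neg_apply] at j1 j2 j3
  simp only [bracketHom_apply, hd.1, hhu, hhv, huv, hvx, huh, hvh] at j1 j2 j3
  obtain ⟨-, k1, k2⟩ := coordinates_unique hi (α := 0) (β := c1) (γ := -c2) (by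
    linear_combination (norm := module) j1)
  obtain ⟨l0, l1, l2⟩ := coordinates_unique hi (α := -p0) (β := α) (γ := -2 * p2) (by
    linear_combination (norm := module) j2)
  obtain ⟨m0, m1, -⟩ := coordinates_unique hi (α := q0) (β := 2 * q1) (γ := -α) (by
    linear_combination (norm := module) j3)
  have hc1 : c1 = 0 := k1
  have hc2 : c2 = 0 := by simpa using k2
  have hp0 : p0 = 0 := by simpa using l0
  have hp2 : p2 = 0 := by simpa using l2
  have hq1 : q1 = 0 := by simpa using m1
  subst hc1 hc2 hp0 hp2 hq1 l1 m0
  simp only [zero_smul, add_zero, zero_add] at huv hux hvx hhx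
  have hxu : bracket d x u = -(p • u) := by rw [hd.skew, hux]
  have hxv : bracket d x v = -(q • v) := by rw [hd.skew, hvx]
  have hxh : bracket d x h = 0 := by rw [hd.skew, hhx, neg_zero]
  rw [huv, hxu, hxv] at j4
  simp only [← bracketHom_apply, map_neg, map_smul, LinearMap.neg_apply,
    LinearMap.smul_apply] at j4
  simp only [bracketHom_apply, hxh, huv] at j4
  -- Here `ad x` kills `h`, hence also `[u, v] = c h`, on which it acts by the weight `-(p + q)`.
  obtain ⟨n0, -, -⟩ := coordinates_unique hi (α := (p + q) * c) (β := 0) (γ := 0) (by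
    linear_combination (norm := module) j4)
  have hcent : p + q = 0 → ∀ w ∈ ({h, u, v} : Set V), bracket d w (x + p • h) = 0 := by
    intro hpq w hw
    have hq : q = -p := by linear_combination hpq
    subst hq
    rw [bracket_add_right, bracket_smul_right]
    rcases hw with rfl | rfl | rfl
    · simp [hhx, hd.1]
    · simp [hux, huh]
    · simp [hvx, hvh]
  by_cases hpq : p + q = 0
  · have z1 := hcent hpq h (by simp)
    have z2 := hcent hpq u (by simp)
    have z3 := hcent hpq v (by simp)
    have hxp : φ (x + p • h) = 1 := by simp [hx, hh]
    by_cases hc : c = 0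
    · subst hc
      -- The central element `x + p h` together with `u` and `v` spans an abelian ideal on which `h`
      -- acts diagonally.
      refine .of_equivalent ?_ (isClassified_abelExt !![0, 0, 0; 0, -1, 0; 0, 0, 1])
      have hi' : LinearIndependent ℂ ![x + p • h, u, v, h] := by
        rw [Fintype.linearIndependent_iff] at hi ⊢
        intro g hg
        simp [Fin.sum_univ_four] at hg
        have h1 := hi ![g 3 + p * g 0, g 1, g 2, g 0] (by
          simp [Fin.sum_univ_four]
          rw [← hg]; module)
        have e0 : g 0 = 0 := h1 3
        have e1 : g 1 = 0 := h1 1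
        have e2 : g 2 = 0 := h1 2
        have e3 : g 3 = 0 := by simpa [e0] using h1 0
        intro i; fin_cases i <;> assumption
      refine equivalent_of_vectors hd (isLie_abelExt _) hi' ?_ ?_ ?_ ?_ ?_ ?_
      · rw [hd.skew, z2]; simp [abelExt, psi]
      · rw [hd.skew, z3]; simp [abelExt, psi]
      · rw [hd.skew, z1]; simp [abelExt, psi]
      · simp [huv, abelExt, psi]
      · simp [huh, abelExt, psi]
      · simp [hvh, abelExt, psi]
    · refine ⟨some .three, (?_ : Equivalent d dThree)⟩
      -- The vectors `u ∓ v / (2c)` are exchanged by `ad h`, and the factor `1 / (2c)` makes their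
      -- bracket equal to `h`.
      have hv1 : bracket d h (u - (1 / (2 * c)) • v) = u + (1 / (2 * c)) • v := by
        simp only [← bracketHom_apply, map_sub, map_smul]
        simp only [bracketHom_apply, hhu, hhv]
        module
      have zl : ∀ s : ℂ, bracket d (u + s • v) (x + p • h) = 0 := fun s => by
        rw [bracket_add_left, bracket_smul_left, z2, z3, smul_zero, add_zero]
      have hi' : LinearIndependent ℂ
          ![h, u - (1 / (2 * c)) • v, u + (1 / (2 * c)) • v, x + p • h] := by
        refine linearIndependent_four hh (by simp [hu, hv]) (by simp [hu, hv]) hxp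
          fun α β γ h0 => ?_
        obtain ⟨e0, e1, e2⟩ := coordinates_unique hi (α := α) (β := β + γ)
          (γ := (γ - β) * (1 / (2 * c))) (by rw [← h0]; module)
        have : γ - β = 0 := by simpa [hc] using e2
        exact ⟨e0, by linear_combination (1 / 2 : ℂ) * e1 - (1 / 2 : ℂ) * this,
          by linear_combination (1 / 2 : ℂ) * e1 + (1 / 2 : ℂ) * this⟩
      refine equivalent_of_vectors hd isLie_dThree hi' ?_ ?_ ?_ ?_ ?_ ?_
      · rw [hv1]; simp [dThree, psi]
      · simp only [← bracketHom_apply, map_add, map_smul]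
        simp only [bracketHom_apply, hhu, hhv]
        simp [dThree, psi]
        abel
      · simp [z1, dThree, psi]
      · simp only [← bracketHom_apply, map_add, map_sub, map_smul, LinearMap.sub_apply,
          LinearMap.smul_apply]
        simp only [bracketHom_apply, huv, hd.1, hd.skew u v]
        simp [dThree, psi]
        match_scalars
        field_simp
        norm_num
      · rw [sub_eq_add_neg, ← neg_smul, zl]; simp [dThree, psi]
      · rw [zl]; simp [dThree, psi]
  · have hc : c = 0 := (mul_eq_zero.mp n0).resolve_left hpq
    subst hc
    rw [zero_smul] at huv
    refine ⟨some .twoSharp, (?_ : Equivalent d dTwoSharp)⟩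
    -- The combination `x - q h` commutes with `v` and `x + p h` commutes with `u`, which decouples
    -- the two summands.
    have hi' : LinearIndependent ℂ ![u, (p + q)⁻¹ • (x - q • h), v, (p + q)⁻¹ • (x + p • h)] := by
      rw [Fintype.linearIndependent_iff] at hi ⊢
      intro g hg
      simp [Fin.sum_univ_four] at hg
      have h1 := hi ![(p + q)⁻¹ * (g 3 * p - g 1 * q), g 0, g 2, (p + q)⁻¹ * (g 1 + g 3)] (by
        simp only [Fin.sum_univ_four]
        simp
        rw [← hg]; module)
      have e0 : g 0 = 0 := h1 1
      have e2 : g 2 = 0 := h1 2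
      have e3 := h1 3
      have e4 := h1 0
      simp [hpq] at e3 e4
      have : g 3 = 0 := by
        have : (p + q) * g 3 = 0 := by linear_combination e4 + q * e3
        exact (mul_eq_zero.mp this).resolve_left hpq
      have e1 : g 1 = 0 := by linear_combination e3 - this
      intro i; fin_cases i <;> assumption
    have r1 : ∀ w (s : ℂ), bracket d w ((p + q)⁻¹ • (x + s • h))
        = (p + q)⁻¹ • (bracket d w x + s • bracket d w h) := fun w s => by
      rw [bracket_smul_right, bracket_add_right, bracket_smul_right]
    have r2 : ∀ w (s : ℂ), bracket d w ((p + q)⁻¹ • (x - s • h))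
        = (p + q)⁻¹ • (bracket d w x - s • bracket d w h) := fun w s => by
      rw [← bracketHom_apply, map_smul, map_sub, map_smul]; rfl
    refine equivalent_of_vectors hd isLie_dTwoSharp hi' ?_ ?_ ?_ ?_ ?_ ?_
    · rw [r2, hux, huh]
      simp [dTwoSharp, psi]
      match_scalars
      field_simp
    · simp [huv, dTwoSharp, psi]
    · rw [r1, hux, huh]
      simp [dTwoSharp, psi]
    · rw [hd.skew, r2, hvx, hvh]
      simp [dTwoSharp, psi]
    · rw [r1, hd.skew x, hd.skew h, r2, r2, hd.1, hd.1, hhx, hxh]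
      simp [dTwoSharp, psi]
    · rw [r1, hvx, hvh]
      simp [dTwoSharp, psi]
      match_scalars
      field_simp
      ring

/-- In a kernel without nonzero eigenvalues, a nonzero bracket is central. -/
theorem bracket_eq_zero_of_no_eigenvalue {d : StructConst} (hd : IsLie d) {φ : V →ₗ[ℂ] ℂ}
    (hφ : IsUnimodularFunctional d φ) {a b z x : V} (ha : φ a = 0) (hb : φ b = 0) (hz : φ z = 0)
    (hx : φ x = 1) (hi : LinearIndependent ℂ ![a, b, z, x]) (hab : bracket d a b = z)
    (hno : ∀ (h u : V) (s : ℂ), φ h = 0 → u ≠ 0 → bracket d h u = s • u → s = 0) :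
    bracket d a z = 0 := by
  obtain ⟨δ, γ, β, haz⟩ := exists_coordinates ha hb hz hx hi (hφ.bracket a z)
  have htr := adTrace_eq_of_vectors hφ ha hb hz hx hi (w := a) (α₀ := 0) (α₁ := 0) (α₂ := 0)
    (β₀ := 0) (β₁ := 0) (β₂ := 1) (by simp [hd.1]) (by simp [hab]) haz
  rw [hφ.trace a ha] at htr
  have hβ : β = 0 := by linear_combination -htr
  subst hβ
  have hγ : γ = 0 := by
    obtain ⟨s, hs⟩ := IsAlgClosed.exists_pow_nat_eq γ (n := 2) (by norm_num)
    by_contra hγ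
    have hs0 : s ≠ 0 := by
      rintro rfl
      exact hγ (by simpa using hs.symm)
    -- Since `[a, b] = z` and `[a, z] = δ a + γ b`, a square root `s` of `γ` is an eigenvalue of `ad
    -- a` with this eigenvector.
    refine hs0 (hno a ((δ / s) • a + s • b + z) s ha ?_ ?_)
    · intro h0
      exact one_ne_zero (coordinates_unique hi (α := δ / s) (β := s) (γ := (1 : ℂ))
        (by simpa using h0)).2.2
    · simp only [← bracketHom_apply, map_add, map_smul]
      simp only [bracketHom_apply, hd.1, hab, haz, ← hs]
      match_scalars <;> field_simp; simp
  subst hγ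
  -- What remains is `[a, z] = δ a`, so `a` is an eigenvector of `ad z`.
  have hδ : -δ = 0 := by
    refine hno z a (-δ) hz ?_ ?_
    · rintro rfl
      exact one_ne_zero (coordinates_unique hi (α := (1 : ℂ)) (β := 0) (γ := 0) (by simp)).1
    · rw [hd.skew, haz]
      module
  rw [haz, neg_eq_zero.mp hδ]
  simp

/-- The cases distinguish whether some element of the unimodular kernel has a nonzero ad-eigenvalue.
If none has, the kernel is abelian or any nonzero bracket in it is central in it, which makes it
Heisenberg. -/
theorem isClassified_of_isLie {d : StructConst} (hd : IsLie d) : IsClassified d := by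
  obtain ⟨φ, hφ⟩ := exists_isUnimodularFunctional hd
  obtain ⟨x, hx⟩ := LinearMap.surjective hφ.ne_zero 1
  by_cases hno : ∀ (h u : V) (s : ℂ), φ h = 0 → u ≠ 0 → bracket d h u = s • u → s = 0
  · by_cases hab : ∃ a b, φ a = 0 ∧ φ b = 0 ∧ bracket d a b ≠ 0
    · obtain ⟨a, b, ha, hb, hab⟩ := hab
      have hab2 : ∀ α β : ℂ, α • a + β • b = 0 → α = 0 ∧ β = 0 := by
        intro α β h0
        have h1 := congrArg (bracketHom d a) h0
        have h2 := congrArg (bracketHom d b) h0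
        simp only [map_add, map_smul, bracketHom_apply, hd.1, hd.skew a b, smul_zero, zero_add,
          add_zero, map_zero, smul_neg, neg_eq_zero] at h1 h2
        exact ⟨(smul_eq_zero.mp h2).resolve_right hab, (smul_eq_zero.mp h1).resolve_right hab⟩
      have hz : φ (bracket d a b) = 0 := hφ.bracket a b
      have hi3 : ∀ α β γ : ℂ, α • a + β • b + γ • bracket d a b = 0 → α = 0 ∧ β = 0 ∧ γ = 0 := by
        intro α β γ h0
        -- If `[a, b]` were in the span of `a` and `b`, it would be an eigenvector of `ad a` and `ad
        -- b`. With both eigenvalues zero, it would vanish.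
        have hγ : γ = 0 := by
          by_contra hγ
          have e : bracket d a b = (-(α / γ)) • a + (-(β / γ)) • b := by
            have : γ • bracket d a b = -(α • a + β • b) := by
              rw [eq_neg_iff_add_eq_zero, ← h0]; abel
            rw [← inv_smul_smul₀ hγ (bracket d a b), this]
            match_scalars <;> field_simp
          have e1 : bracket d a (bracket d a b) = (-(β / γ)) • bracket d a b := by
            conv_lhs => rw [e]
            rw [bracket_add_right, bracket_smul_right, bracket_smul_right, hd.1, smul_zero,
              zero_add]
          have e2 : bracket d b (bracket d a b) = (α / γ) • bracket d a b := by
            conv_lhs => rw [e]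
            rw [bracket_add_right, bracket_smul_right, bracket_smul_right, hd.1, hd.skew a b]
            module
          have k1 := hno a _ _ ha hab e1
          have k2 := hno b _ _ hb hab e2
          rw [k1, k2] at e
          simp at e
          exact hab e
        subst hγ
        rw [zero_smul, add_zero] at h0
        exact ⟨(hab2 _ _ h0).1, (hab2 _ _ h0).2, rfl⟩
      have hi := linearIndependent_four ha hb hz hx hi3
      have haz := bracket_eq_zero_of_no_eigenvalue hd hφ ha hb hz hx hi rfl hno
      have hz' : φ (-bracket d a b) = 0 := by rw [map_neg, hz, neg_zero]
      have hi' : LinearIndependent ℂ ![b, a, -bracket d a b, x] :=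
        linearIndependent_four hb ha hz' hx fun α β γ h0 => by
          obtain ⟨k1, k2, k3⟩ := hi3 β α (-γ) (by rw [← h0]; module)
          exact ⟨k2, k1, neg_eq_zero.mp k3⟩
      have hbz := bracket_eq_zero_of_no_eigenvalue hd hφ hb ha hz' hx hi' (hd.skew a b) hno
      refine isClassified_of_heisenberg hd hφ hz ha hb hx ?_ ?_ ?_ rfl
      · exact linearIndependent_four hz ha hb hx fun α β γ h0 => by
          obtain ⟨k1, k2, k3⟩ := hi3 β γ α (by rw [← h0]; module)
          exact ⟨k3, k1, k2⟩
      · rw [hd.skew, haz, neg_zero]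
      · rw [hd.skew, ← bracketHom_apply, ← map_neg, bracketHom_apply, hbz]
    · push Not at hab
      let B := Module.finBasisOfFinrankEq ℂ φ.ker (finrank_ker hφ.ne_zero)
      have hB : ∀ i, φ (B i) = 0 := fun i => (B i).2
      refine isClassified_of_abelian hd hφ (hB 0) (hB 1) (hB 2) hx ?_ (hab _ _ (hB 0) (hB 1))
        (hab _ _ (hB 0) (hB 2)) (hab _ _ (hB 1) (hB 2))
      refine linearIndependent_four (hB 0) (hB 1) (hB 2) hx fun α β γ h0 => ?_
      have hl := Fintype.linearIndependent_iff.mp B.linearIndependent ![α, β, γ] (by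
        apply Subtype.ext
        simpa [Fin.sum_univ_three] using h0)
      exact ⟨hl 0, hl 1, hl 2⟩
  · push Not at hno
    obtain ⟨h, u, s, hh, hu0, hu, hs⟩ := hno
    obtain ⟨h, v, x, hh, hu, hv, hx, hi, hhu, hhv, α, hhx⟩ :=
      exists_toral_basis hd hφ hx hh hs hu0 hu
    exact isClassified_of_toral hd hφ hh hu hv hx hi hhu hhv hhx

/-! Closures of orbits, and the comparison of the degeneration order with jumps. -/

theorem IsInvariant.of_mem_closure {P : StructConst → Prop} (hi : IsInvariant P)
    (hc : IsClosed {d | P d}) {d e e' : StructConst} (he : P e) (hd : Equivalent d e')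
    (h : d ∈ closure {d' | Equivalent d' e}) : P e' :=
  hi _ _ hd (closure_minimal (fun _ h' => hi _ _ h'.symm he) hc h)

/-- The pairs of a parameter value and a structure equivalent to that member of the family. -/
def memberGraph {n : ℕ} (F : (Fin n → ℂ) → StructConst) : Set ((Fin n → ℂ) × StructConst) :=
  {a | Equivalent a.2 (F a.1)}

theorem IsInvariant.of_mem_closure_memberGraph {n : ℕ} {F : (Fin n → ℂ) → StructConst}
    {P : StructConst → Prop} (hi : IsInvariant P) (hc : IsClosed {d | P d}) (hF : ∀ q, P (F q))
    {p : Fin n → ℂ} {d e : StructConst} (hd : Equivalent d e)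
    (h : (p, d) ∈ closure (memberGraph F)) : P e :=
  hi _ _ hd (closure_minimal (t := {a : (Fin n → ℂ) × StructConst | P a.2})
    (fun a (h' : Equivalent a.2 (F a.1)) => hi _ _ h'.symm (hF _))
    (hc.preimage continuous_snd) h)

theorem isClosed_setOf_spectrumIn_comp {n : ℕ} {S : (Fin n → ℂ) → Fin 3 → ℂ}
    (hS : Continuous S) :
    IsClosed {a : (Fin n → ℂ) × StructConst | SpectrumIn (S a.1) a.2} := by
  have h : Continuous fun a : (Fin n → ℂ) × StructConst => (S a.1, a.2) := by fun_prop
  exact isClosed_spectrumIn.preimage h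

theorem memberGraph_subset_spectrumIn {n : ℕ} {F : (Fin n → ℂ) → StructConst}
    {S : (Fin n → ℂ) → Fin 3 → ℂ} (hF : ∀ q, SpectrumIn (S q) (F q)) :
    memberGraph F ⊆ {a | SpectrumIn (S a.1) a.2} :=
  fun a h => isInvariant_spectrumIn (S a.1) (F a.1) a.2 (Equivalent.symm h) (hF a.1)

theorem spectrumIn_of_mem_closure_memberGraph {n : ℕ} {F : (Fin n → ℂ) → StructConst}
    {S : (Fin n → ℂ) → Fin 3 → ℂ} (hS : Continuous S) (hF : ∀ q, SpectrumIn (S q) (F q))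
    {p : Fin n → ℂ} {d e : StructConst} (hd : Equivalent d e)
    (h : (p, d) ∈ closure (memberGraph F)) : SpectrumIn (S p) e := by
  have h' := closure_minimal (memberGraph_subset_spectrumIn hF)
    (isClosed_setOf_spectrumIn_comp hS) h
  exact isInvariant_spectrumIn (S p) d e hd h'

theorem mem_closure_memberGraph {n : ℕ} {F : (Fin n → ℂ) → StructConst} {p : Fin n → ℂ}
    {d : StructConst} (h : d ∈ closure {d' | Equivalent d' (F p)}) :
    (p, d) ∈ closure (memberGraph F) :=
  map_mem_closure (f := fun d => (p, d)) (by fun_prop) h fun _ h' => h'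

theorem continuous_smallSpectrum : Continuous smallSpectrum :=
  continuous_pi fun i => by fin_cases i <;> simp [smallSpectrum] <;> fun_prop

theorem continuous_heisSpectrum : Continuous heisSpectrum :=
  continuous_pi fun i => by fin_cases i <;> simp [heisSpectrum] <;> fun_prop

theorem Label.form_ne_zero (x : Label) : x.form ≠ 0 := by
  intro h
  have h1 := fun i j k => congrFun (congrFun (congrFun h i) j) k
  cases x with
  | big p hp => simpa [Label.form, bigFamily, psi] using h1 1 3 0
  | small p hp => simpa [Label.form, smallFamily, psi] using h1 2 3 1
  | heis p hp => simpa [Label.form, heisFamily, psi] using h1 2 3 1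
  | one => simpa [Label.form, dOne, psi] using h1 1 3 0
  | oneSharp => simpa [Label.form, dOneSharp, psi] using h1 1 3 1
  | twoStar => simpa [Label.form, dTwoStar, psi] using h1 1 3 0
  | twoSharp => simpa [Label.form, dTwoSharp, psi] using h1 0 1 0
  | three => simpa [Label.form, dThree, psi] using h1 0 1 2
  | threeStar => simpa [Label.form, dThreeStar, psi] using h1 0 3 0

theorem atMost_big_of_mem_closure {d : StructConst} {x : Option Label}
    (hd : Equivalent d (pointForm x)) {p : Fin 3 → ℂ} (hp : p ≠ 0)
    (h : (p, d) ∈ closure (memberGraph bigFamily)) : AtMost x (some (.big p hp)) :=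
  atMost_big hp (spectrumIn_of_mem_closure_memberGraph continuous_id spectrumIn_bigFamily hd h)
    (isInvariant_metabelian.of_mem_closure_memberGraph isClosed_metabelian
      metabelian_bigFamily hd h)
    (isInvariant_isotropic.of_mem_closure_memberGraph isClosed_isotropic isotropic_bigFamily hd h)

theorem atMost_small_of_mem_closure {d : StructConst} {x : Option Label}
    (hd : Equivalent d (pointForm x)) {p : Fin 2 → ℂ} (hp : p ≠ 0)
    (h : (p, d) ∈ closure (memberGraph smallFamily)) : AtMost x (some (.small p hp)) :=
  atMost_small hp
    (spectrumIn_of_mem_closure_memberGraph continuous_smallSpectrum spectrumIn_smallFamily hd h)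
    (isInvariant_metabelian.of_mem_closure_memberGraph isClosed_metabelian
      metabelian_smallFamily hd h)
    (isInvariant_isotropic.of_mem_closure_memberGraph isClosed_isotropic
      isotropic_smallFamily hd h)
    (isInvariant_quadratic.of_mem_closure_memberGraph isClosed_quadratic
      quadratic_smallFamily hd h)

theorem atMost_heis_of_mem_closure {d : StructConst} {x : Option Label}
    (hd : Equivalent d (pointForm x)) {p : Fin 2 → ℂ} (hp : p ≠ 0)
    (h : (p, d) ∈ closure (memberGraph heisFamily)) : AtMost x (some (.heis p hp)) :=
  atMost_heis hp
    (spectrumIn_of_mem_closure_memberGraph continuous_heisSpectrum spectrumIn_heisFamily hd h)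
    (isInvariant_derivedTwo.of_mem_closure_memberGraph isClosed_derivedTwo
      derivedTwo_heisFamily hd h)

/-- `d` inherits the closed invariant conditions that hold for the point `y`, and these leave only
points at most `y`. -/
theorem atMost_of_mem_closure {d : StructConst} {x y : Option Label}
    (hd : Equivalent d (pointForm x))
    (h : d ∈ closure {d' | Equivalent d' (pointForm y)}) : AtMost x y := by
  have hS : ∀ p : Fin 3 → ℂ, IsClosed {d | SpectrumIn p d} := fun p =>
    isClosed_spectrumIn.preimage (f := fun d => (p, d)) (by fun_prop)
  rcases y with _ | y
  · have h0 : {d' : StructConst | Equivalent d' (pointForm none)} = {0} :=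
      Set.ext fun d' => equivalent_zero_iff
    rw [h0, closure_singleton, Set.mem_singleton_iff] at h
    subst h
    have hx := equivalent_zero_iff.mp hd.symm
    rcases x with _ | x
    · exact atMost_none _
    · exact (x.form_ne_zero hx).elim
  cases y with
  | big p hp => exact atMost_big_of_mem_closure hd hp (mem_closure_memberGraph h)
  | small p hp => exact atMost_small_of_mem_closure hd hp (mem_closure_memberGraph h)
  | heis p hp => exact atMost_heis_of_mem_closure hd hp (mem_closure_memberGraph h)
  | one =>
    exact atMost_one
      (isInvariant_adNilpotent.of_mem_closure isClosed_adNilpotent ad_dOne hd h)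
      (isInvariant_quadratic.of_mem_closure isClosed_quadratic quadratic_dOne hd h)
  | oneSharp =>
    exact atMost_oneSharp
      ((isInvariant_spectrumIn _).of_mem_closure (hS _) spectrumIn_dOneSharp hd h)
      (isInvariant_quadratic.of_mem_closure isClosed_quadratic quadratic_dOneSharp hd h)
  | twoStar =>
    exact atMost_twoStar
      (isInvariant_adNilpotent.of_mem_closure isClosed_adNilpotent ad_dTwoStar hd h)
  | twoSharp =>
    exact atMost_twoSharp
      (isInvariant_metabelian.of_mem_closure isClosed_metabelian metabelian_dTwoSharp hd h)
      (isInvariant_adThreeZero.of_mem_closure isClosed_adThreeZero adThreeZero_dTwoSharp hd h)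
  | three =>
    exact atMost_three
      ((isInvariant_spectrumIn _).of_mem_closure (hS _) spectrumIn_dThree hd h)
  | threeStar =>
    exact atMost_threeStar
      (isInvariant_planesClosed.of_mem_closure isClosed_planesClosed planesClosed_dThreeStar hd h)

theorem isLie_form (x : Label) : IsLie x.form := by
  cases x with
  | big p hp => exact isLie_bigFamily p
  | small p hp => exact isLie_smallFamily p
  | heis p hp => exact isLie_heisFamily p
  | one => exact isLie_dOne
  | oneSharp => exact isLie_dOneSharp
  | twoStar => exact isLie_dTwoStar
  | twoSharp => exact isLie_dTwoSharp
  | three => exact isLie_dThree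
  | threeStar => exact isLie_dThreeStar

theorem isLie_pointForm (x : Option Label) : IsLie (pointForm x) := by
  cases x with
  | none => exact isLie_zero
  | some x => exact isLie_form x

/-- Equivalent structures lie in the closures of each other's orbits, so antisymmetry of the order
separates the classes. -/
theorem samePoint_of_equivalent {x y : Option Label}
    (h : Equivalent (pointForm x) (pointForm y)) : SamePoint x y :=
  (atMost_of_mem_closure (.refl _) (subset_closure h)).samePoint
    (atMost_of_mem_closure (.refl _) (subset_closure h.symm))

theorem Jumps.isLie_left {d d' : StructConst} (h : Jumps d d') : IsLie d := by
  obtain ⟨-, γ, ⟨-, rfl, hL⟩, -⟩ := h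
  exact hL.self_of_nhds

theorem Jumps.isLie_right {d d' : StructConst} (h : Jumps d d') : IsLie d' := by
  obtain ⟨-, γ, ⟨-, -, hL⟩, hE⟩ := h
  obtain ⟨t, h1, h2⟩ := ((hL.filter_mono nhdsWithin_le_nhds).and hE).exists
  exact h2.isLie h1

theorem Jumps.mem_closure {d d' : StructConst} (h : Jumps d d') :
    d ∈ closure {e | Equivalent e d'} := by
  obtain ⟨-, γ, ⟨hγ, rfl, -⟩, hE⟩ := h
  exact mem_closure_of_tendsto (hγ.continuousAt.tendsto.mono_left nhdsWithin_le_nhds) hE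

/-- Topological closure yields an analytic curve of matrices because the two bounds on the order
agree: the classification locates `d`, and the explicit degenerations reach every point above it. -/
theorem isDegeneration_of_mem_closure {d : StructConst} (hd : IsLie d) {y : Option Label}
    (h : d ∈ closure {d' | Equivalent d' (pointForm y)}) : IsDegeneration d (pointForm y) := by
  obtain ⟨x, hx⟩ := isClassified_of_isLie hd
  exact hx.isDegeneration.trans (atMost_of_mem_closure hx h).isDegeneration

theorem Jumps.isDegeneration {d d' : StructConst} (h : Jumps d d') : IsDegeneration d d' := by
  obtain ⟨y, hy⟩ := isClassified_of_isLie h.isLie_right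
  refine (isDegeneration_of_mem_closure h.isLie_left ?_).trans hy.symm.isDegeneration
  exact closure_mono (fun e he => Equivalent.trans he hy) h.mem_closure

theorem Jumps.congr_right {d d' d'' : StructConst} (h : Jumps d d') (h' : Equivalent d'' d') :
    Jumps d d'' :=
  ⟨fun h2 => h.1 (h2.trans h'), h.2.imp fun _ h3 => ⟨h3.1, h3.2.mono fun _ h4 => h4.trans h'.symm⟩⟩

theorem jumps_iff_of_equivalent {d d' : StructConst} {x y : Option Label}
    (hx : Equivalent d (pointForm x)) (hy : Equivalent d' (pointForm y)) :
    Jumps d d' ↔ BelowPoint x y := by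
  constructor
  · intro h
    have h1 : d ∈ closure {e | Equivalent e (pointForm y)} :=
      closure_mono (fun e he => Equivalent.trans he hy) h.mem_closure
    refine (atMost_of_mem_closure hx h1).resolve_left fun h2 => h.1 ?_
    exact (hx.trans h2.equivalent).trans hy.symm
  · intro h
    have h1 : IsDegeneration d d' :=
      (hx.isDegeneration.trans (AtMost.isDegeneration (.inr h))).trans hy.symm.isDegeneration
    refine h1.jumps (hx.symm.isLie (isLie_pointForm x)) (hy.symm.isLie (isLie_pointForm y)) ?_
    intro h2
    have h3 := (samePoint_of_equivalent ((hx.symm.trans h2).trans hy)).level_eq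
    exact h.level_lt.ne h3

theorem jumps_pointForm_iff {x : Option Label} {d' : StructConst} :
    Jumps (pointForm x) d' ↔ ∃ y, BelowPoint x y ∧ Equivalent d' (pointForm y) := by
  constructor
  · intro h
    obtain ⟨y, hy⟩ := isClassified_of_isLie h.isLie_right
    exact ⟨y, (jumps_iff_of_equivalent (.refl _) hy).mp h, hy⟩
  · rintro ⟨y, h, hy⟩
    exact (jumps_iff_of_equivalent (.refl _) hy).mpr h

theorem IsDegeneration.equivalent_or_jumps {d d' : StructConst} (h : IsDegeneration d d')
    (hd : IsLie d) (hd' : IsLie d') : Equivalent d d' ∨ Jumps d d' :=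
  or_iff_not_imp_left.mpr (h.jumps hd hd')

/-- Degenerations compose, and the strict growth of the level rules out a return to the class of
`d`. -/
theorem Jumps.trans {d d' d'' : StructConst} (h : Jumps d d') (h' : Jumps d' d'') :
    Jumps d d'' := by
  obtain ⟨x, hx⟩ := isClassified_of_isLie h.isLie_left
  obtain ⟨y, hy⟩ := isClassified_of_isLie h.isLie_right
  obtain ⟨z, hz⟩ := isClassified_of_isLie h'.isLie_right
  refine (h.isDegeneration.trans h'.isDegeneration).jumps h.isLie_left h'.isLie_right fun h1 => ?_
  have h2 := ((jumps_iff_of_equivalent hx hy).mp h).level_lt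
  have h3 := ((jumps_iff_of_equivalent hy hz).mp h').level_lt
  have h4 := (samePoint_of_equivalent ((hx.symm.trans h1).trans hz)).level_eq
  omega

/-- Away from the structures to which `d` jumps, a point has no structures near `d`. -/
theorem eventually_jumps_of_equivalent {d : StructConst} (hd : IsLie d) (y : Option Label) :
    ∀ᶠ d' in 𝓝 d, Equivalent d' (pointForm y) → Equivalent d' d ∨ Jumps d d' := by
  by_cases h : d ∈ closure {d' | Equivalent d' (pointForm y)}
  · refine .of_forall fun d' h' => ?_
    rcases (isDegeneration_of_mem_closure hd h).equivalent_or_jumps hd (isLie_pointForm y) with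
      h1 | h1
    · exact .inl (h'.trans h1.symm)
    · exact .inr (h1.congr_right h')
  · filter_upwards [isClosed_closure.isOpen_compl.mem_nhds h] with d' h1 h2
    exact (h1 (subset_closure h2)).elim

/-! Deformations along a family. -/

/-- What the deformation theory uses about the families: the members are Lie structures depending
analytically on the parameter, equivalent exactly when the parameters agree up to scaling and
permutations, and a limit of members is a degeneration of the limit member. -/
structure IsModuliFamily {n : ℕ} (F : (Fin n → ℂ) → StructConst) : Prop where
  isLie : ∀ p, IsLie (F p)
  analyticAt : ∀ p, AnalyticAt ℂ F p
  smul : ∀ (p : Fin n → ℂ) {c : ℂ}, c ≠ 0 → Equivalent (F p) (F (c • p))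
  same : ∀ {p q : Fin n → ℂ}, p ≠ 0 → q ≠ 0 → Equivalent (F p) (F q) →
    ∃ (c : ℂ) (σ : Equiv.Perm (Fin n)), q = c • (p ∘ σ)
  isDegeneration : ∀ {d : StructConst} {p : Fin n → ℂ}, IsLie d → p ≠ 0 →
    (p, d) ∈ closure (memberGraph F) → IsDegeneration d (F p)

/-- Provides a direction in which the parameter leaves its line through the origin. -/
theorem exists_independent {n : ℕ} [Nontrivial (Fin n)] {p : Fin n → ℂ} (hp : p ≠ 0) :
    ∃ q : Fin n → ℂ, ∀ α β : ℂ, α • p + β • q = 0 → α = 0 ∧ β = 0 := by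
  obtain ⟨i, hi⟩ := Function.ne_iff.mp hp
  obtain ⟨j, hj⟩ := exists_ne i
  refine ⟨Pi.single j 1, fun α β h => ?_⟩
  have hα : α = 0 := by
    have := congrFun h i
    simp [hj.symm] at this
    exact this.resolve_right hi
  subst hα
  simpa using congrFun h j

theorem finite_setOf_pow_eq {N : ℕ} (hN : N ≠ 0) (s : ℂ) : {t : ℂ | t ^ N = s}.Finite := by
  refine (Polynomial.nthRoots N s).toFinset.finite_toSet.subset fun t ht => ?_
  simpa [Polynomial.mem_nthRoots (Nat.pos_of_ne_zero hN)] using ht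

/-- A line that misses the origin meets each line through the origin at most once. -/
theorem finite_setOf_line {n N : ℕ} (hN : N ≠ 0) {p q : Fin n → ℂ}
    (hpq : ∀ α β : ℂ, α • p + β • q = 0 → α = 0 ∧ β = 0) (w : Fin n → ℂ) :
    {t : ℂ | ∃ c : ℂ, p + t ^ N • q = c • w}.Finite := by
  by_cases h : ∃ t₀ : ℂ, ∃ c : ℂ, p + t₀ ^ N • q = c • w
  · obtain ⟨t₀, c₀, h₀⟩ := h
    refine (finite_setOf_pow_eq hN (t₀ ^ N)).subset ?_
    rintro t ⟨c, hc⟩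
    have h1 : (c - c₀) • p + (c * t₀ ^ N - c₀ * t ^ N) • q = 0 := by
      have h2 : c • (p + t₀ ^ N • q) = c₀ • (p + t ^ N • q) := by
        rw [h₀, hc, smul_comm]
      rw [← sub_eq_zero] at h2
      rw [← h2]
      module
    obtain ⟨h2, h3⟩ := hpq _ _ h1
    have h4 : c = c₀ := by linear_combination h2
    subst h4
    have hc0 : c ≠ 0 := by
      rintro rfl
      exact one_ne_zero (hpq 1 (t ^ N) (by simpa using hc)).1
    have h5 : c * (t₀ ^ N - t ^ N) = 0 := by linear_combination h3
    have h6 := (mul_eq_zero.mp h5).resolve_left hc0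
    exact (sub_eq_zero.mp h6).symm
  · convert Set.finite_empty (α := ℂ)
    ext t
    simp only [Set.mem_ofPred_eq, Set.mem_empty_iff_false, iff_false]
    exact fun h1 => h ⟨t, h1⟩

theorem equivalent_conjugate {H G : Matrix (Fin 4) (Fin 4) ℂ} (hG : G * H = 1)
    (c : StructConst) : Equivalent c (conjugate H G c) := by
  refine equivalent_iff_matrix.mpr ⟨G, fun h => ?_, fun x y => ?_⟩
  · have := congrArg det hG
    simp [det_mul, h] at this
  · rw [bracket_conjugate, mulVec_mulVec, hG, one_mulVec]

theorem Equivalent.exists_conjugate {d d' : StructConst} (h : Equivalent d d') :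
    ∃ H G : Matrix (Fin 4) (Fin 4) ℂ, G * H = 1 ∧ d' = conjugate H G d := by
  obtain ⟨G, hG, h⟩ := equivalent_iff_matrix.mp h
  refine ⟨G⁻¹, G, mul_nonsing_inv _ hG.isUnit, bracket_injective fun x y => ?_⟩
  rw [bracket_conjugate, ← h, mulVec_mulVec, nonsing_inv_mul _ hG.isUnit, one_mulVec]

theorem continuous_conjugate (H G : Matrix (Fin 4) (Fin 4) ℂ) : Continuous (conjugate H G) := by
  refine continuous_pi fun i => continuous_pi fun j => ?_
  exact Continuous.matrix_mulVec continuous_const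
    (continuous_bracket continuous_id continuous_const continuous_const)

section

variable {n : ℕ} {F : (Fin n → ℂ) → StructConst} {p : Fin n → ℂ} {d : StructConst}

theorem DeformsAlong.mem_closure (h : DeformsAlong F p d) : (p, d) ∈ closure (memberGraph F) := by
  obtain ⟨γ, v, ⟨hγ, rfl, -⟩, hv, rfl, hE, -⟩ := h
  exact mem_closure_of_tendsto (f := fun t => (v t, γ t))
    ((hv.continuousAt.tendsto.prodMk_nhds hγ.continuousAt.tendsto).mono_left nhdsWithin_le_nhds) hE

theorem DeformsAlong.isLie (h : DeformsAlong F p d) : IsLie d := by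
  obtain ⟨γ, v, ⟨-, rfl, hL⟩, -⟩ := h
  exact hL.self_of_nhds

/-- A line through `p` missing the origin is pulled back along the degeneration. A class of members
is a finite union of lines through the origin, apart from the origin itself, so the pulled-back
curve meets it finitely often. -/
theorem IsModuliFamily.deformsAlong [Nontrivial (Fin n)] (hF : IsModuliFamily F) (hp : p ≠ 0)
    (hd : IsLie d) (h : IsDegeneration d (F p)) : DeformsAlong F p d := by
  obtain ⟨q, hq⟩ := exists_independent hp
  have hline : AnalyticAt ℂ (fun s : ℂ => p + s • q) 0 := by fun_prop
  obtain ⟨γ, N, hN, hγ, hE⟩ := h.exists_deformation hd (γ' := fun s => F (p + s • q))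
    ⟨AnalyticAt.fun_comp (hF.analyticAt _) hline, by simp, .of_forall fun s => hF.isLie _⟩
  have hne : ∀ t : ℂ, p + t ^ N • q ≠ 0 := fun t h0 =>
    one_ne_zero (hq 1 (t ^ N) (by simpa using h0)).1
  refine ⟨γ, fun t => p + t ^ N • q, hγ, by fun_prop, by simp [hN], hE, ?_⟩
  obtain ⟨r, hr, hball⟩ := Metric.mem_nhdsWithin_iff.mp hE
  refine ⟨r, hr, fun s _ => ?_⟩
  -- The value at `0` is `d`, which need not be a member of the family. So a class attained at some
  -- nonzero `t₀` is compared with the member there, and any other class is attained at most at `0`.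
  by_cases hs : ∃ t₀ ∈ Metric.ball (0 : ℂ) r, t₀ ≠ 0 ∧ Equivalent (γ t₀) (γ s)
  · obtain ⟨t₀, ht₀, ht₀', h₀⟩ := hs
    refine ((Set.finite_singleton (0 : ℂ)).union (Set.finite_iUnion fun σ : Equiv.Perm (Fin n) =>
      finite_setOf_line hN hq ((p + t₀ ^ N • q) ∘ σ))).subset ?_
    rintro t ⟨ht, h1⟩
    by_cases h0 : t = 0
    · exact .inl h0
    · have e₀ : Equivalent (γ t₀) (F (p + t₀ ^ N • q)) := hball ⟨ht₀, ht₀'⟩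
      have e : Equivalent (γ t) (F (p + t ^ N • q)) := hball ⟨ht, h0⟩
      obtain ⟨c, σ, h2⟩ := hF.same (hne _) (hne _) ((e₀.symm.trans (h₀.trans h1.symm)).trans e)
      exact .inr (Set.mem_iUnion.mpr ⟨σ, c, h2⟩)
  · refine (Set.finite_singleton (0 : ℂ)).subset ?_
    rintro t ⟨ht, h1⟩
    by_contra h0
    exact hs ⟨t, ht, h0, h1⟩

theorem IsModuliFamily.deformsAlong_iff [Nontrivial (Fin n)] (hF : IsModuliFamily F) (hp : p ≠ 0)
    (hd : IsLie d) : DeformsAlong F p d ↔ IsDegeneration d (F p) :=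
  ⟨fun h => hF.isDegeneration hd hp h.mem_closure, hF.deformsAlong hp hd⟩

theorem isDegeneration_iff {d' : StructConst} (hd : IsLie d) (hd' : IsLie d') :
    IsDegeneration d d' ↔ Equivalent d d' ∨ Jumps d d' :=
  ⟨fun h => h.equivalent_or_jumps hd hd', fun h =>
    h.elim Equivalent.isDegeneration Jumps.isDegeneration⟩

theorem IsDegeneration.exists_mem {d' : StructConst} (h : IsDegeneration d d')
    {U : Set StructConst} (hU : U ∈ 𝓝 d) : ∃ e, Equivalent d' e ∧ U ∈ 𝓝 e := by
  obtain ⟨γ, G, hγ, -, rfl, hE⟩ := h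
  have h1 : ∀ᶠ t in 𝓝 (0 : ℂ), U ∈ 𝓝 (γ t) :=
    hγ.continuousAt.tendsto.eventually (eventually_mem_nhds_iff.mpr hU)
  obtain ⟨t, h2, h3, h4⟩ := ((h1.filter_mono nhdsWithin_le_nhds).and hE).exists
  exact ⟨γ t, equivalent_iff_matrix.mpr ⟨G t, h3, h4⟩, h2⟩

/-- One fixed change of basis brings `F p` into `U`. By continuity the same change of basis works
for all nearby parameters. -/
theorem IsModuliFamily.eventually_exists_mem (hF : IsModuliFamily F)
    (h : IsDegeneration d (F p)) {U : Set StructConst} (hU : U ∈ 𝓝 d) :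
    ∀ᶠ q in 𝓝 p, ∃ d' ∈ U, IsLie d' ∧ Equivalent d' (F q) := by
  obtain ⟨e, he, hUe⟩ := h.exists_mem hU
  obtain ⟨H, G, hHG, rfl⟩ := he.exists_conjugate
  have hc : ContinuousAt (fun q => conjugate H G (F q)) p :=
    (continuous_conjugate H G).continuousAt.comp (hF.analyticAt p).continuousAt
  filter_upwards [hc.tendsto.eventually hUe] with q hq
  have h1 := equivalent_conjugate hHG (F q)
  exact ⟨_, hq, h1.isLie (hF.isLie q), h1.symm⟩

theorem IsModuliFamily.familyRule [Nontrivial (Fin n)] (hF : IsModuliFamily F) (hd : IsLie d) :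
    FamilyRule F d := fun p hp => by
  rw [hF.deformsAlong_iff hp hd]
  exact ⟨isDegeneration_iff hd (hF.isLie p), fun h U hU => hF.eventually_exists_mem h hU⟩

theorem IsModuliFamily.deformsAlong_of_jumps [Nontrivial (Fin n)] (hF : IsModuliFamily F)
    {d' : StructConst} (h : Jumps d d') (hp : p ≠ 0) (h' : DeformsAlong F p d') :
    DeformsAlong F p d :=
  hF.deformsAlong hp h.isLie_left
    (h.isDegeneration.trans ((hF.deformsAlong_iff hp h'.isLie).mp h'))

/-- At each `p` of the unit sphere, either `d` is a limit of members with parameters tending to `p`,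
and then deforms along `F` there, or a neighbourhood of `(p, d)` contains no members. Compactness of
the sphere makes the neighbourhood of `d` uniform. -/
theorem IsModuliFamily.eventually_nearAlong [Nontrivial (Fin n)] (hF : IsModuliFamily F)
    (hd : IsLie d) {ε : ℝ} (hε : 0 < ε) :
    ∀ᶠ d' in 𝓝 d, ∀ q : Fin n → ℂ, q ≠ 0 → Equivalent d' (F q) → NearAlong F ε d d' := by
  have key : ∀ᶠ d' in 𝓝 d, ∀ q ∈ Metric.sphere (0 : Fin n → ℂ) 1,
      Equivalent d' (F q) → NearAlong F ε d d' := by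
    refine (isCompact_sphere 0 1).eventually_forall_of_forall_eventually fun p hp => ?_
    have hp1 : ‖p‖ = 1 := by simpa using hp
    have hp0 : p ≠ 0 := norm_ne_zero_iff.mp (by rw [hp1]; exact one_ne_zero)
    by_cases h : (p, d) ∈ closure (memberGraph F)
    · have hda := hF.deformsAlong hp0 hd (hF.isDegeneration hd hp0 h)
      have h1 : ∀ᶠ q in 𝓝 p, q ≠ 0 ∧ ‖q - p‖ < ε := by
        refine (isOpen_ne.eventually_mem hp0).and ?_
        filter_upwards [Metric.ball_mem_nhds p hε] with q hq
        rwa [← dist_eq_norm]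
      have h2 : Tendsto (fun z : StructConst × (Fin n → ℂ) => z.2) (𝓝 (d, p)) (𝓝 p) :=
        continuous_snd.tendsto _
      filter_upwards [h2.eventually h1] with z hz hE
      exact ⟨p, z.2, hp1, hda, hz.1, hz.2, hE⟩
    · have h2 : Tendsto (fun z : StructConst × (Fin n → ℂ) => (z.2, z.1)) (𝓝 (d, p)) (𝓝 (p, d)) :=
        continuous_swap.tendsto _
      filter_upwards [h2.eventually (isClosed_closure.isOpen_compl.mem_nhds h)] with z hz hE
      exact (hz (subset_closure hE)).elim
  -- Scaling a parameter does not change the class, so it may be normalized.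
  filter_upwards [key] with d' h q hq hE
  have hq' : ‖q‖ ≠ 0 := norm_ne_zero_iff.mpr hq
  have hc : (‖q‖ : ℂ)⁻¹ ≠ 0 := inv_ne_zero (by exact_mod_cast hq')
  refine h ((‖q‖ : ℂ)⁻¹ • q) ?_ (hE.trans (hF.smul q hc))
  simp [norm_smul, hq']

end

/-! ### The three families as instances of the deformation theory. -/

theorem analyticAt_coord {n : ℕ} (p : Fin n → ℂ) (i : Fin n) :
    AnalyticAt ℂ (fun q : Fin n → ℂ => q i) p :=
  (ContinuousLinearMap.proj (R := ℂ) (φ := fun _ : Fin n => ℂ) i).analyticAt p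

theorem isModuliFamily_bigFamily : IsModuliFamily bigFamily where
  isLie := isLie_bigFamily
  analyticAt p := ((((((analyticAt_coord p 0).smul analyticAt_const).add analyticAt_const).add
    ((analyticAt_coord p 1).smul analyticAt_const)).add analyticAt_const).add
    ((analyticAt_coord p 2).smul analyticAt_const))
  smul p _ hc := equivalent_bigFamily_smul p hc
  same {p q} hp hq h := by
    obtain ⟨c, σ, -, h1⟩ : (Label.big p hp).Same (.big q hq) :=
      samePoint_of_equivalent (x := some (.big p hp)) (y := some (.big q hq)) h
    exact ⟨c, σ, h1⟩
  isDegeneration {d p} hd hp h := by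
    obtain ⟨x, hx⟩ := isClassified_of_isLie hd
    exact hx.isDegeneration.trans (atMost_big_of_mem_closure hx hp h).isDegeneration

theorem isModuliFamily_smallFamily : IsModuliFamily smallFamily where
  isLie := isLie_smallFamily
  analyticAt p := (((((analyticAt_coord p 0).smul analyticAt_const).add
    ((analyticAt_coord p 0).smul analyticAt_const)).add analyticAt_const).add
    ((analyticAt_coord p 1).smul analyticAt_const))
  smul p _ hc := equivalent_smallFamily_smul p hc
  same {p q} hp hq h := by
    obtain ⟨c, -, h1⟩ : (Label.small p hp).Same (.small q hq) :=
      samePoint_of_equivalent (x := some (.small p hp)) (y := some (.small q hq)) h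
    exact ⟨c, 1, h1⟩
  isDegeneration {d p} hd hp h := by
    obtain ⟨x, hx⟩ := isClassified_of_isLie hd
    exact hx.isDegeneration.trans (atMost_small_of_mem_closure hx hp h).isDegeneration

theorem isModuliFamily_heisFamily : IsModuliFamily heisFamily where
  isLie := isLie_heisFamily
  analyticAt p := ((((analyticAt_const.add
    (((analyticAt_coord p 0).add (analyticAt_coord p 1)).smul analyticAt_const)).add
    ((analyticAt_coord p 0).smul analyticAt_const)).add analyticAt_const).add
    ((analyticAt_coord p 1).smul analyticAt_const))
  smul p _ hc := equivalent_heisFamily_smul p hc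
  same {p q} hp hq h := by
    obtain ⟨c, σ, -, h1⟩ : (Label.heis p hp).Same (.heis q hq) :=
      samePoint_of_equivalent (x := some (.heis p hp)) (y := some (.heis q hq)) h
    exact ⟨c, σ, h1⟩
  isDegeneration {d p} hd hp h := by
    obtain ⟨x, hx⟩ := isClassified_of_isLie hd
    exact hx.isDegeneration.trans (atMost_heis_of_mem_closure hx hp h).isDegeneration

/-! The jump deformations of the standard forms. -/

theorem pair_ne_zero_of_or {a b : ℂ} (h : a ≠ 0 ∨ b ≠ 0) : (![a, b] : Fin 2 → ℂ) ≠ 0 := by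
  intro h0
  rcases h with h | h
  · exact h (by simpa using congrFun h0 0)
  · exact h (by simpa using congrFun h0 1)

theorem not_jumps_dThree (d' : StructConst) : ¬ Jumps dThree d' := by
  intro h
  obtain ⟨y, h, -⟩ := (jumps_pointForm_iff (x := some .three)).mp h
  rcases y with _ | y
  · exact h
  · cases y <;> exact h

theorem not_jumps_dTwoSharp (d' : StructConst) : ¬ Jumps dTwoSharp d' := by
  intro h
  obtain ⟨y, h, -⟩ := (jumps_pointForm_iff (x := some .twoSharp)).mp h
  rcases y with _ | y
  · exact h
  · cases y <;> exact h

theorem jumps_heisFamily_iff {p : Fin 2 → ℂ} (hp : p ≠ 0) (d' : StructConst) :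
    Jumps (heisFamily p) d' ↔
      (p 0 + p 1 = 0 ∧ Equivalent d' dThree) ∨ (p 0 * p 1 = 0 ∧ Equivalent d' dTwoSharp) := by
  refine (jumps_pointForm_iff (x := some (.heis p hp))).trans ⟨?_, ?_⟩
  · rintro ⟨_ | y, h, e⟩
    · exact h.elim
    · cases y with
      | three => exact .inl ⟨h, e⟩
      | twoSharp => exact .inr ⟨h, e⟩
      | _ => exact h.elim
  · rintro (⟨h, e⟩ | ⟨h, e⟩)
    · exact ⟨some .three, h, e⟩
    · exact ⟨some .twoSharp, h, e⟩

theorem jumps_dOneSharp_iff (d' : StructConst) :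
    Jumps dOneSharp d' ↔ Equivalent d' (heisFamily ![1, 1]) := by
  refine (jumps_pointForm_iff (x := some .oneSharp)).trans ⟨?_, fun e => ?_⟩
  · rintro ⟨_ | y, h, e⟩
    · exact h.elim
    · cases y with
      | heis q hq => exact e.trans (equivalent_heisFamily_of_eq hq h).symm
      | _ => exact h.elim
  · exact ⟨some (.heis ![1, 1] (pair_ne_zero_of_or (.inl one_ne_zero))), rfl, e⟩

theorem jumps_bigFamily_iff {p : Fin 3 → ℂ} (hp : p ≠ 0) (d' : StructConst) :
    Jumps (bigFamily p) d' ↔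
      (p 0 * p 1 * p 2 = 0 ∧ Equivalent d' dTwoSharp) ∨
      (∃ (a b : ℂ) (hq : ![a, b, a + b] ≠ 0),
        (Label.big p hp).Same (Label.big ![a, b, a + b] hq) ∧
          (Equivalent d' (heisFamily ![a, b]) ∨ (a + b = 0 ∧ Equivalent d' dThree))) := by
  refine (jumps_pointForm_iff (x := some (.big p hp))).trans ⟨?_, ?_⟩
  · rintro ⟨_ | y, h, e⟩
    · exact h.elim
    · cases y with
      | twoSharp => exact .inl ⟨h, e⟩
      | heis q hq =>
        refine .inr ⟨q 0, q 1, heisSpectrum_ne_zero hq, h, .inl ?_⟩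
        have hq' : ![q 0, q 1] = q := by funext i; fin_cases i <;> rfl
        rw [hq']
        exact e
      | three =>
        have h1 : (![1, -1, 1 + -1] : Fin 3 → ℂ) = ![1, -1, 0] := by simp
        refine .inr ⟨1, -1, by rw [h1]; exact vec_ne_zero one_ne_zero, ?_, .inr ⟨by simp, e⟩⟩
        change Proportional p ![1, -1, 1 + -1]
        rw [h1]
        exact h
      | _ => exact h.elim
  · rintro (⟨h, e⟩ | ⟨a, b, hq, h, e | ⟨hab, e⟩⟩)
    · exact ⟨some .twoSharp, h, e⟩
    · have hab : (![a, b] : Fin 2 → ℂ) ≠ 0 := by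
        intro h0
        have h1 : a = 0 := by simpa using congrFun h0 0
        have h2 : b = 0 := by simpa using congrFun h0 1
        subst h1 h2
        exact hq (by funext i; fin_cases i <;> simp)
      exact ⟨some (.heis ![a, b] hab), h, e⟩
    · refine ⟨some .three, ?_, e⟩
      have hb : b = -a := by linear_combination hab
      subst hb
      have ha : a ≠ 0 := by
        rintro rfl
        exact hq (by funext i; fin_cases i <;> simp)
      refine Proportional.trans h ⟨a⁻¹, 1, inv_ne_zero ha, funext fun i => ?_⟩
      fin_cases i <;> simp [ha]

/-- A spectrum `(q 0, q 1, q 0 + q 1)` has a repeated entry only if `q 0 = q 1` or one of the two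
vanishes. -/
theorem Proportional.smallSpectrum_heisSpectrum {p q : Fin 2 → ℂ}
    (h : Proportional (smallSpectrum p) (heisSpectrum q)) :
    (p 1 = 0 ∧ q 0 * q 1 = 0) ∨ (p 1 = 2 * p 0 ∧ q 0 = q 1) := by
  obtain ⟨c, hc, h⟩ := h.cases
  simp [smallSpectrum, heisSpectrum] at h
  grind

theorem jumps_smallFamily_iff {a b : ℂ} (hab : a ≠ 0 ∨ b ≠ 0) (d' : StructConst) :
    Jumps (smallFamily ![a, b]) d' ↔
      Equivalent d' (bigFamily ![a, a, b]) ∨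
      (a * b = 0 ∧ Equivalent d' dTwoSharp) ∨
      (b = 0 ∧ Equivalent d' (heisFamily ![1, 0])) ∨
      (b = 2 * a ∧ (Equivalent d' dOneSharp ∨ Equivalent d' (heisFamily ![1, 1]))) := by
  have hp := pair_ne_zero_of_or hab
  refine (jumps_pointForm_iff (x := some (.small _ hp))).trans ⟨?_, ?_⟩
  · rintro ⟨_ | y, h, e⟩
    · exact h.elim
    · cases y with
      | big q hq => exact .inl (e.trans (Proportional.equivalent h).symm)
      | twoSharp => exact .inr (.inl ⟨h, e⟩)
      | oneSharp => exact .inr (.inr (.inr ⟨h, .inl e⟩))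
      | heis q hq =>
        rcases Proportional.smallSpectrum_heisSpectrum h with ⟨h1, h2⟩ | ⟨h1, h2⟩
        · exact .inr (.inr (.inl ⟨h1, e.trans (equivalent_heisFamily_of_mul hq h2)⟩))
        · exact .inr (.inr (.inr ⟨h1, .inr (e.trans (equivalent_heisFamily_of_eq hq h2).symm)⟩))
      | _ => exact h.elim
  · have h1 (s : ℂ) : (![1, s] : Fin 2 → ℂ) ≠ 0 := pair_ne_zero_of_or (.inl one_ne_zero)
    rintro (e | ⟨h, e⟩ | ⟨rfl, e⟩ | ⟨rfl, e | e⟩)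
    · exact ⟨some (.big ![a, a, b] (smallSpectrum_ne_zero hp)),
        ⟨1, 1, one_ne_zero, by simp [smallSpectrum]⟩, e⟩
    · exact ⟨some .twoSharp, h, e⟩
    · have ha : a ≠ 0 := by simpa using hab
      refine ⟨some (.heis ![1, 0] (h1 0)), ?_, e⟩
      refine ⟨a⁻¹, Equiv.swap 1 2, inv_ne_zero ha, funext fun i => ?_⟩
      fin_cases i <;> simp [smallSpectrum, heisSpectrum, ha, Equiv.swap_apply_def]
    · exact ⟨some .oneSharp, rfl, e⟩
    · have ha : a ≠ 0 := by simpa using hab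
      refine ⟨some (.heis ![1, 1] (h1 1)), ?_, e⟩
      refine ⟨a⁻¹, 1, inv_ne_zero ha, funext fun i => ?_⟩
      fin_cases i <;> simp [smallSpectrum, heisSpectrum, ha]
      field_simp
      norm_num

theorem jumps_dThreeStar_iff (d' : StructConst) : Jumps dThreeStar d' ↔
    Equivalent d' (smallFamily ![1, 1]) ∨ Equivalent d' (bigFamily ![1, 1, 1]) := by
  refine (jumps_pointForm_iff (x := some .threeStar)).trans ⟨?_, ?_⟩
  · rintro ⟨_ | y, h, e⟩
    · exact h.elim
    · cases y with
      | small q hq => exact .inl (e.trans (equivalent_smallFamily_of_eq hq h).symm)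
      | big q hq => exact .inr (e.trans (Proportional.equivalent h).symm)
      | _ => exact h.elim
  · rintro (e | e)
    · exact ⟨some (.small ![1, 1] (pair_ne_zero_of_or (.inl one_ne_zero))), rfl, e⟩
    · exact ⟨some (.big ![1, 1, 1] (vec_ne_zero one_ne_zero)), ⟨1, 1, one_ne_zero, by simp⟩, e⟩

theorem jumps_dTwoStar_iff (d' : StructConst) : Jumps dTwoStar d' ↔
    (∃ p : Fin 3 → ℂ, p ≠ 0 ∧ Equivalent d' (bigFamily p)) ∨
    (∃ p : Fin 2 → ℂ, p ≠ 0 ∧ Equivalent d' (heisFamily p)) ∨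
    Equivalent d' dTwoSharp ∨ Equivalent d' dThree := by
  refine (jumps_pointForm_iff (x := some .twoStar)).trans ⟨?_, ?_⟩
  · rintro ⟨_ | y, h, e⟩
    · exact h.elim
    · cases y with
      | big q hq => exact .inl ⟨q, hq, e⟩
      | heis q hq => exact .inr (.inl ⟨q, hq, e⟩)
      | twoSharp => exact .inr (.inr (.inl e))
      | three => exact .inr (.inr (.inr e))
      | _ => exact h.elim
  · rintro (⟨p, hp, e⟩ | ⟨p, hp, e⟩ | e | e)
    · exact ⟨some (.big p hp), trivial, e⟩
    · exact ⟨some (.heis p hp), trivial, e⟩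
    · exact ⟨some .twoSharp, trivial, e⟩
    · exact ⟨some .three, trivial, e⟩

theorem exists_form_of_ne_zero {d : StructConst} (hd : IsLie d) (h0 : d ≠ 0) :
    ∃ x : Label, Equivalent d x.form := by
  obtain ⟨_ | x, hx⟩ := isClassified_of_isLie hd
  · exact (h0 (equivalent_zero_iff.mp hx)).elim
  · exact ⟨x, hx⟩

theorem jumps_dOne_iff {d' : StructConst} (hd' : IsLie d') : Jumps dOne d' ↔
    d' ≠ 0 ∧ ¬ Equivalent d' dOne ∧ ¬ Equivalent d' dThreeStar := by
  constructor
  · intro h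
    refine ⟨?_, fun e => h.1 e.symm, fun e => ?_⟩
    · rintro rfl
      exact (jumps_iff_of_equivalent (x := some .one) (y := none) (.refl _) (.refl _)).mp h
    · exact (jumps_iff_of_equivalent (x := some .one) (y := some .threeStar) (.refl _) e).mp h
  · rintro ⟨h0, h1, h2⟩
    obtain ⟨y, hy⟩ := exists_form_of_ne_zero hd' h0
    refine (jumps_iff_of_equivalent (x := some .one) (y := some y) (.refl _) hy).mpr ?_
    cases y with
    | one => exact (h1 hy).elim
    | threeStar => exact (h2 hy).elim
    | _ => trivial

theorem jumps_zero_iff {d' : StructConst} (hd' : IsLie d') : Jumps 0 d' ↔ d' ≠ 0 := by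
  constructor
  · rintro h rfl
    exact h.1 (.refl _)
  · intro h0
    obtain ⟨y, hy⟩ := exists_form_of_ne_zero hd' h0
    exact (jumps_iff_of_equivalent (x := none) (y := some y) (.refl _) hy).mpr trivial

/-- Outside the three families there are only seven classes, counting zero, so finitely many
neighbourhoods of `d` are intersected. -/
theorem eventually_equivalent_or_jumps_or_nearAlong {d : StructConst} (hd : IsLie d) {ε : ℝ}
    (hε : 0 < ε) : ∀ᶠ d' in 𝓝 d, IsLie d' →
      Equivalent d' d ∨ Jumps d d' ∨ NearAlong bigFamily ε d d' ∨
        NearAlong smallFamily ε d d' ∨ NearAlong heisFamily ε d d' := by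
  filter_upwards [isModuliFamily_bigFamily.eventually_nearAlong hd hε,
    isModuliFamily_smallFamily.eventually_nearAlong hd hε,
    isModuliFamily_heisFamily.eventually_nearAlong hd hε,
    eventually_jumps_of_equivalent hd none,
    eventually_jumps_of_equivalent hd (some .one),
    eventually_jumps_of_equivalent hd (some .oneSharp),
    eventually_jumps_of_equivalent hd (some .twoStar),
    eventually_jumps_of_equivalent hd (some .twoSharp),
    eventually_jumps_of_equivalent hd (some .three),
    eventually_jumps_of_equivalent hd (some .threeStar)]
    with d' hb hs hh h0 h1 h1' h2 h2' h3 h3' hd'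
  obtain ⟨x, hx⟩ := isClassified_of_isLie hd'
  have key : (Equivalent d' d ∨ Jumps d d') → Equivalent d' d ∨ Jumps d d' ∨
      NearAlong bigFamily ε d d' ∨ NearAlong smallFamily ε d d' ∨ NearAlong heisFamily ε d d' :=
    fun h => h.imp_right .inl
  rcases x with _ | x
  · exact key (h0 hx)
  cases x with
  | big p hp => exact .inr (.inr (.inl (hb p hp hx)))
  | small p hp => exact .inr (.inr (.inr (.inl (hs p hp hx))))
  | heis p hp => exact .inr (.inr (.inr (.inr (hh p hp hx))))
  | one => exact key (h1 hx)
  | oneSharp => exact key (h1' hx)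
  | twoStar => exact key (h2 hx)
  | twoSharp => exact key (h2' hx)
  | three => exact key (h3 hx)
  | threeStar => exact key (h3' hx)

end FourDimLie

open FourDimLie in
theorem mainTheorem5 :
    -- the points of the moduli space
    ((∀ x : Label, IsLie x.form ∧ x.form ≠ 0) ∧
      (∀ d : StructConst, IsLie d → d ≠ 0 → ∃ x : Label, Equivalent d x.form) ∧
      (∀ x y : Label, Equivalent x.form y.form ↔ x.Same y)) ∧
    -- jump deformations of each element
    (∀ d' : StructConst, ¬ Jumps dThree d') ∧
    (∀ d' : StructConst, ¬ Jumps dTwoSharp d') ∧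
    (∀ a b : ℂ, (a ≠ 0 ∨ b ≠ 0) → ∀ d' : StructConst,
      Jumps (heisFamily ![a, b]) d' ↔
        (a + b = 0 ∧ Equivalent d' dThree) ∨ (a * b = 0 ∧ Equivalent d' dTwoSharp)) ∧
    (∀ d' : StructConst, Jumps dOneSharp d' ↔ Equivalent d' (heisFamily ![1, 1])) ∧
    (∀ p : Fin 3 → ℂ, ∀ hp : p ≠ 0, ∀ d' : StructConst,
      Jumps (bigFamily p) d' ↔
        (p 0 * p 1 * p 2 = 0 ∧ Equivalent d' dTwoSharp) ∨
        (∃ (a b : ℂ) (hq : ![a, b, a + b] ≠ 0),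
          (Label.big p hp).Same (Label.big ![a, b, a + b] hq) ∧
            (Equivalent d' (heisFamily ![a, b]) ∨ (a + b = 0 ∧ Equivalent d' dThree)))) ∧
    (∀ a b : ℂ, (a ≠ 0 ∨ b ≠ 0) → ∀ d' : StructConst,
      Jumps (smallFamily ![a, b]) d' ↔
        Equivalent d' (bigFamily ![a, a, b]) ∨
        (a * b = 0 ∧ Equivalent d' dTwoSharp) ∨
        (b = 0 ∧ Equivalent d' (heisFamily ![1, 0])) ∨
        (b = 2 * a ∧ (Equivalent d' dOneSharp ∨ Equivalent d' (heisFamily ![1, 1])))) ∧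
    (∀ d' : StructConst, Jumps dThreeStar d' ↔
        Equivalent d' (smallFamily ![1, 1]) ∨ Equivalent d' (bigFamily ![1, 1, 1])) ∧
    (∀ d' : StructConst, Jumps dTwoStar d' ↔
        (∃ p : Fin 3 → ℂ, p ≠ 0 ∧ Equivalent d' (bigFamily p)) ∨
        (∃ p : Fin 2 → ℂ, p ≠ 0 ∧ Equivalent d' (heisFamily p)) ∨
        Equivalent d' dTwoSharp ∨ Equivalent d' dThree) ∧
    (∀ d' : StructConst, IsLie d' → (Jumps dOne d' ↔
        d' ≠ 0 ∧ ¬ Equivalent d' dOne ∧ ¬ Equivalent d' dThreeStar)) ∧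
    (∀ d' : StructConst, IsLie d' → (Jumps 0 d' ↔ d' ≠ 0)) ∧
    -- deformations along the families
    (∀ d : StructConst, IsLie d →
      FamilyRule bigFamily d ∧ FamilyRule smallFamily d ∧ FamilyRule heisFamily d) ∧
    -- an element deforms to everything to which a jump target of it deforms
    (∀ d d' : StructConst, Jumps d d' →
      (∀ d'' : StructConst, Jumps d' d'' → Jumps d d'') ∧
      (∀ p : Fin 3 → ℂ, p ≠ 0 → DeformsAlong bigFamily p d' → DeformsAlong bigFamily p d) ∧
      (∀ p : Fin 2 → ℂ, p ≠ 0 → DeformsAlong smallFamily p d' → DeformsAlong smallFamily p d) ∧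
      (∀ p : Fin 2 → ℂ, p ≠ 0 → DeformsAlong heisFamily p d' → DeformsAlong heisFamily p d)) ∧
    -- there are no other local deformations
    (∀ d : StructConst, IsLie d → ∀ ε > 0, ∀ᶠ d' in 𝓝 d, IsLie d' →
      Equivalent d' d ∨ Jumps d d' ∨ NearAlong bigFamily ε d d' ∨
        NearAlong smallFamily ε d d' ∨ NearAlong heisFamily ε d d') := by
  refine ⟨⟨fun x => ⟨isLie_form x, x.form_ne_zero⟩, fun d => exists_form_of_ne_zero, fun x y => ?_⟩,
    not_jumps_dThree, not_jumps_dTwoSharp,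
    fun a b h => jumps_heisFamily_iff (pair_ne_zero_of_or h), jumps_dOneSharp_iff,
    fun p hp => jumps_bigFamily_iff hp, fun a b => jumps_smallFamily_iff, jumps_dThreeStar_iff,
    jumps_dTwoStar_iff, fun d' => jumps_dOne_iff, fun d' => jumps_zero_iff,
    fun d hd => ⟨isModuliFamily_bigFamily.familyRule hd, isModuliFamily_smallFamily.familyRule hd,
      isModuliFamily_heisFamily.familyRule hd⟩,
    fun d d' h => ⟨fun d'' => h.trans, fun p => isModuliFamily_bigFamily.deformsAlong_of_jumps h,
      fun p => isModuliFamily_smallFamily.deformsAlong_of_jumps h,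
      fun p => isModuliFamily_heisFamily.deformsAlong_of_jumps h⟩,
    fun d hd ε hε => eventually_equivalent_or_jumps_or_nearAlong hd hε⟩
  exact ⟨samePoint_of_equivalent (x := some x) (y := some y), Label.Same.equivalent⟩
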